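/- Let $k_0\ge 1$ be an integer and let $\mu$, $\mu'_j$, $\mu''_i$, $\mu_{ij}$ ($0\le i,j<k_0$) be probability measures on $\mathbb Z^2$. Let $Z=\{Z(n)\}_{n\ge 0}$ be the Markov chain on $\mathbb N^2$ (with $\mathbb N=\{0,1,2,\dots\}$) with transition probabilities $$p\bigl((i,j)\to(i',j')\bigr)=\begin{cases}\mu(i'-i,j'-j)& i,j\ge k_0,\\ \mu'_j(i'-i,j'-j)& i\ge k_0>j,\\ \mu''_i(i'-i,j'-j)& j\ge k_0>i,\\ \mu_{ij}(i'-i,j'-j)& i,j<k_0.\end{cases}$$ Let $Z_0$ be the homogeneous random walk on $\mathbb Z^2$ with jump law $\mu$. Let $Z_1=(X_1,Y_1)$ be the walk on $\mathbb N\times\mathbb Z$ with jump law $\mu$ at $(i,j)$ if $i\ge k_0$ and $\mu''_i$ if $i<k_0$, and let $Z_2=(X_2,Y_2)$ be the walk on $\mathbb Z\times\mathbb N$ with jump law $\mu$ at $(i,j)$ if $j\ge k_0$ and $\mu'_j$ if $j<k_0$. The first coordinate $X_1$ of $Z_1$ and the second coordinate $Y_2$ of $Z_2$ are Markov chains on $\mathbb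 N$. Let $m_1=\sum_{(i,j)} i\,\mu(i,j)$ and $m_2=\sum_{(i,j)} j\,\mu(i,j)$. Assume: 1. $\mu(i',j')=0$ if $i'<-k_0$ or $j'<-k_0$; $\mu'_j(i',j')=0$ if $i'<-k_0$ or $j'<-j$; $\mu''_i(i',j')=0$ if $j'<-k_0$ or $i'<-i$; $\mu_{ij}(i',j')=0$ if $i'<-i$ or $j'<-j$ (for all $0\le i,j<k_0$). 2. There are $\delta,\gamma,C>0$ with $\sup_{z\in\mathbb N^2}\mathbb E_z\bigl(\exp\langle(\delta,\gamma),Z(1)-z\rangle\bigr)\le C$. 3. $Z_0$, $Z_1$, $Z_2$ and $Z$ are irreducible on their respective state spaces. 4. $m_1<0$ and $m_2<0$. 5. $V_1>0$ and $V_2>0$, where $V_1=\sum_{i\ge 0}\pi_1(i)\,\mathbb E_{(i,0)}(Y_1(1))$ and $V_2=\sum_{j\ge 0}\pi_2(j)\,\mathbb E_{(0,j)}(X_2(1))$, and $\pi_1,\pi_2$ are the invariant probability distributions of $X_1$ and $Y_2$ (which exist and are unique under 1–4). Let $g\bigl((i_0,j_0)\to(i,j)\bigr)=\sum_{n\ge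 0}\mathbb P_{(i_0,j_0)}(Z(n)=(i,j))$ be the Green function of $Z$, let $\mathcal N_1$ be the total number of visits (over times $n\ge 0$) of $Z$ to the horizontal strip $\mathbb N\times\{0,\dots,k_0-1\}$, and let $\mathcal N_2$ be the total number of visits of $Z$ to the vertical strip $\{0,\dots,k_0-1\}\times\mathbb N$. Then the Green function is finite and: - for every $i\in\mathbb N$ there are constants $C_i,\delta_i>0$ such that for all $(i_0,j_0)\in\mathbb N^2$ and all $j\in\mathbb N$, $$\Bigl|g\bigl((i_0,j_0)\to(i,j)\bigr)-\mathbb P_{(i_0,j_0)}(\mathcal N_1<\infty)\,\frac{\pi_1(i)}{V_1}\Bigr|\le C_i\,e^{-\delta_i(j-j_0)};$$ - for every $j\in\mathbb N$ there are constants $C'_j,\delta'_j>0$ such that for all $(i_0,j_0)\in\mathbb N^2$ and all $i\in\mathbb N$, $$\Bigl|g\bigl((i_0,j_0)\to(i,j)\bigr)-\mathbb P_{(i_0,j_0)}(\mathcal N_2<\infty)\,\frac{\pi_2(j)}{V_2}\Bigr|\le C'_j\,e^{-\delta'_j(i-i_0)}.$$ -/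

import Mathlib

open MeasureTheory ProbabilityTheory
open scoped ENNReal

noncomputable section

/-! ## Markov chains on a countable state space -/

section MarkovChain

variable {S : Type*} [MeasurableSpace S] [Countable S] [MeasurableSingletonClass S]

/-- The Markov kernel `x ↦ K x` attached to transition probabilities `K x y = p(x → y)`. -/
def stepKernel (K : S → PMF S) : Kernel S S :=
  Kernel.ofFunOfCountable fun x => (K x).toMeasure

instance (K : S → PMF S) : IsMarkovKernel (stepKernel K) :=
  ⟨fun x => (inferInstance : IsProbabilityMeasure (K x).toMeasure)⟩

/-- The transition kernels of the chain with respect to its past: given the trajectory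
`h = (h 0, …, h n)` up to time `n`, the next state has law `K (h n)`. -/
def historyKernel (K : S → PMF S) (n : ℕ) : Kernel ((i : Finset.Iic n) → S) S :=
  (stepKernel K).comap (fun h => h ⟨n, Finset.mem_Iic.2 le_rfl⟩) (measurable_pi_apply _)

instance (K : S → PMF S) (n : ℕ) : IsMarkovKernel (historyKernel K n) :=
  inferInstanceAs (IsMarkovKernel ((stepKernel K).comap _ _))

/-- The law `ℙ_x`, on the space of trajectories `ω = (ω 0, ω 1, …)`, of the time-homogeneous Markov
chain with transition probabilities `K` started at `x` (Ionescu-Tulcea). The value of the chain at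
time `n` is `ω n`. -/
def pathLaw (K : S → PMF S) (x : S) : Measure (ℕ → S) :=
  Kernel.traj (X := fun _ => S) (historyKernel K) 0 fun _ => x

/-- Irreducibility: every state is reached with positive probability from every state. -/
def IsIrreducibleChain (K : S → PMF S) : Prop :=
  ∀ x y : S, ∃ n : ℕ, 0 < pathLaw K x {ω | ω n = y}

/-- The Green function `∑ₙ ℙ_x(ω n = y)`, with values in `[0, ∞]`. -/
def green (K : S → PMF S) (x y : S) : ℝ≥0∞ :=
  ∑' n : ℕ, pathLaw K x {ω | ω n = y}

end MarkovChain

/-- `π` is an invariant probability distribution of the chain with transition probabilities `K`: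
`∑ₓ π x * K x y = π y` for all `y`. -/
def IsInvariantDistribution {S : Type*} (K : S → PMF S) (π : PMF S) : Prop :=
  ∀ y : S, ∑' x : S, π x * K x y = π y

/-- The invariant probability distribution of a chain (an arbitrary distribution if the chain has
none; it is unique for the irreducible positive recurrent chains to which it is applied). -/
def invariantDistribution {S : Type*} [Inhabited S] (K : S → PMF S) : PMF S :=
  haveI : Nonempty (PMF S) := ⟨PMF.pure default⟩
  Classical.epsilon (IsInvariantDistribution K)

/-! ## The reflected random walk in the quarter plane -/

/-- The data of the model: the width `k₀` of the boundary strips and the jump distributions.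
`μ` rules the interior, `μ' j` the row `j < k₀`, `μ'' i` the column `i < k₀`, and `μc i j` the
corner point `(i, j)` with `i, j < k₀` (the values at other indices play no role). -/
structure ReflectedWalk where
  k₀ : ℕ
  k₀_pos : 0 < k₀
  μ : PMF (ℤ × ℤ)
  μ' : ℕ → PMF (ℤ × ℤ)
  μ'' : ℕ → PMF (ℤ × ℤ)
  μc : ℕ → ℕ → PMF (ℤ × ℤ)

namespace ReflectedWalk

variable (W : ReflectedWalk)

/-- The law of the jump of the main walk `Z` from `(i, j) ∈ ℕ²`. -/
def jump (z : ℕ × ℕ) : PMF (ℤ × ℤ) :=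
  if W.k₀ ≤ z.1 then (if W.k₀ ≤ z.2 then W.μ else W.μ' z.2)
  else (if W.k₀ ≤ z.2 then W.μ'' z.1 else W.μc z.1 z.2)

/-- The law of the jump of the half-plane walk `Z₁` from `(i, j) ∈ ℕ × ℤ`. -/
def jump₁ (i : ℕ) : PMF (ℤ × ℤ) := if W.k₀ ≤ i then W.μ else W.μ'' i

/-- The law of the jump of the half-plane walk `Z₂` from `(i, j) ∈ ℤ × ℕ`. -/
def jump₂ (j : ℕ) : PMF (ℤ × ℤ) := if W.k₀ ≤ j then W.μ else W.μ' j

/-- The jumps do not lead out of the quadrant, and in each direction they are bounded below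
by `-k₀`. -/
def JumpsBoundedBelow : Prop :=
  (∀ d : ℤ × ℤ, d.1 < -(W.k₀ : ℤ) ∨ d.2 < -(W.k₀ : ℤ) → W.μ d = 0) ∧
  (∀ j < W.k₀, ∀ d : ℤ × ℤ, d.1 < -(W.k₀ : ℤ) ∨ d.2 < -(j : ℤ) → W.μ' j d = 0) ∧
  (∀ i < W.k₀, ∀ d : ℤ × ℤ, d.2 < -(W.k₀ : ℤ) ∨ d.1 < -(i : ℤ) → W.μ'' i d = 0) ∧
  (∀ i < W.k₀, ∀ j < W.k₀, ∀ d : ℤ × ℤ, d.1 < -(i : ℤ) ∨ d.2 < -(j : ℤ) → W.μc i j d = 0)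

/-- Uniform exponential moments: `𝔼_z exp⟨(δ, γ), Z(1) - z⟩ ≤ C` for all `z ∈ ℕ²`, for some
`δ, γ, C > 0`. -/
def ExponentialMoments : Prop :=
  ∃ δ γ C : ℝ, 0 < δ ∧ 0 < γ ∧ 0 < C ∧ ∀ z : ℕ × ℕ,
    ∑' d : ℤ × ℤ, W.jump z d * ENNReal.ofReal (Real.exp (δ * d.1 + γ * d.2)) ≤ ENNReal.ofReal C

/-- Transition probabilities of the main walk `Z` on `ℕ²`. Under `JumpsBoundedBelow` the
coordinates to which `Int.toNat` is applied are almost surely nonnegative, so that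
`p((i, j) → (i', j'))` is the mass that `jump (i, j)` gives to `(i' - i, j' - j)`. -/
def Z (z : ℕ × ℕ) : PMF (ℕ × ℕ) :=
  (W.jump z).map fun d => (((z.1 : ℤ) + d.1).toNat, ((z.2 : ℤ) + d.2).toNat)

/-- Transition probabilities of the homogeneous walk `Z₀` on `ℤ²`. -/
def Z₀ (z : ℤ × ℤ) : PMF (ℤ × ℤ) :=
  W.μ.map fun d => (z.1 + d.1, z.2 + d.2)

/-- Transition probabilities of the local walk `Z₁ = (X₁, Y₁)` on `ℕ × ℤ`. -/
def Z₁ (z : ℕ × ℤ) : PMF (ℕ × ℤ) :=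
  (W.jump₁ z.1).map fun d => (((z.1 : ℤ) + d.1).toNat, z.2 + d.2)

/-- Transition probabilities of the local walk `Z₂ = (X₂, Y₂)` on `ℤ × ℕ`. -/
def Z₂ (z : ℤ × ℕ) : PMF (ℤ × ℕ) :=
  (W.jump₂ z.2).map fun d => (z.1 + d.1, ((z.2 : ℤ) + d.2).toNat)

/-- All four walks are irreducible. -/
def Irreducible : Prop :=
  IsIrreducibleChain W.Z₀ ∧ IsIrreducibleChain W.Z₁ ∧
  IsIrreducibleChain W.Z₂ ∧ IsIrreducibleChain W.Z

/-- Transition probabilities `p₁(i, i') = ∑_{j'} p₁((i, 0) → (i', j'))` of the induced chain `X₁`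
on `ℕ`. -/
def X₁ (i : ℕ) : PMF ℕ := (W.Z₁ (i, 0)).map Prod.fst

/-- Transition probabilities `p₂(j, j') = ∑_{i'} p₂((0, j) → (i', j'))` of the induced chain `Y₂`
on `ℕ`. -/
def Y₂ (j : ℕ) : PMF ℕ := (W.Z₂ (0, j)).map Prod.snd

/-- First coordinate of the drift of `μ`. -/
def m₁ : ℝ := ∑' d : ℤ × ℤ, (d.1 : ℝ) * (W.μ d).toReal

/-- Second coordinate of the drift of `μ`. -/
def m₂ : ℝ := ∑' d : ℤ × ℤ, (d.2 : ℝ) * (W.μ d).toReal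

/-- The invariant distribution of `X₁`. -/
def π₁ : PMF ℕ := invariantDistribution W.X₁

/-- The invariant distribution of `Y₂`. -/
def π₂ : PMF ℕ := invariantDistribution W.Y₂

/-- `V₁ = ∑ᵢ π₁(i) 𝔼_{(i, 0)}(Y₁(1))`. -/
def V₁ : ℝ := ∑' i : ℕ, (W.π₁ i).toReal * ∑' d : ℤ × ℤ, (d.2 : ℝ) * (W.jump₁ i d).toReal

/-- `V₂ = ∑ⱼ π₂(j) 𝔼_{(0, j)}(X₂(1))`. -/
def V₂ : ℝ := ∑' j : ℕ, (W.π₂ j).toReal * ∑' d : ℤ × ℤ, (d.1 : ℝ) * (W.jump₂ j d).toReal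

/-- Number of visits of a trajectory to the horizontal strip `ℕ × {0, …, k₀ - 1}`. -/
def N₁ (ω : ℕ → ℕ × ℕ) : ℝ≥0∞ :=
  ∑' n : ℕ, Set.indicator {z : ℕ × ℕ | z.2 < W.k₀} 1 (ω n)

/-- Number of visits of a trajectory to the vertical strip `{0, …, k₀ - 1} × ℕ`. -/
def N₂ (ω : ℕ → ℕ × ℕ) : ℝ≥0∞ :=
  ∑' n : ℕ, Set.indicator {z : ℕ × ℕ | z.1 < W.k₀} 1 (ω n)

/-- `ℙ_z(N₁ < ∞)` for the main walk: the probability of escape along the vertical axis. -/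
def escape₁ (z : ℕ × ℕ) : ℝ := (pathLaw W.Z z).real {ω | W.N₁ ω < ∞}

/-- `ℙ_z(N₂ < ∞)` for the main walk: the probability of escape along the horizontal axis. -/
def escape₂ (z : ℕ × ℕ) : ℝ := (pathLaw W.Z z).real {ω | W.N₂ ω < ∞}

end ReflectedWalk

end

noncomputable section

open Filter Topology Preorder

/-! ## Markov chains: transition operator, Green function, convergence along trajectories -/

/-! Fix a column `i`. Above the low rows, `Z` moves like the strip walk `Z₁`, which is invariant
under vertical translations. So the Green function of `Z` with target `(i, j)` is compared with that
of `Z₁`.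

Strip walk. Seen at its successive visits to column `i`, `Z₁` is a random walk on `ℤ` whose step is
the vertical displacement over one excursion. Since `m₁ < 0`, a Lyapunov function gives this step
exponential moments (`StripWalk.exists_potential_bound`). By the cycle formula
`StripWalk.mean_hitMeasure` its mean is `m = V₁ / π₁(i) > 0`, and irreducibility makes it aperiodic
(`StripWalk.aperiodic`). A renewal theorem with exponential rate (`exists_renewal_sequence`) then
yields `StripWalk.exists_green_function`: a bounded `F` on `ℕ × ℤ`, harmonic up to a unit mass at
`(i, 0)`, which tends to `0` upwards and satisfies `|F(x, y) - c| ≤ C e^{ty - δ'x}` with `c = π₁(i)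
/ V₁`. The factor `e^{-δ'x}` comes from `m₂ < 0`: a walk started far to the right goes down before
it returns to column `i`, and arrives far below the target (`StripWalk.lap_decay`).

Quadrant. The function `f(x, y) = F(x, y - j)` satisfies `f - P f = 1_{(i, j)} + error`. The error
lives on the rows below `k₀`, where `Z` and `Z₁` differ, and is `O(e^{-tj - δ'x})` there
(`QuadrantWalk.exists_defect_le`). Its potential is `O(e^{-tj})` uniformly in the starting point,
once the sums over `x` of `g(s → (x, y)) e^{-δ'x}` are bounded uniformly in `s`. That bound is
obtained from the other half-plane walk: `V₂ > 0` provides a superharmonic function bounded by `1`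
whose defect far along a row is a slowly decaying exponential (`QuadrantWalk.tsum_green_high_le`, in
mirrored coordinates).

Conclusion. Hence `g(s → (i, j)) = f(s) - lim 𝔼 f(Z(n)) + O(e^{-tj})`. The chain is transient and
visits the boundary strips infinitely often, and `f(Z(n))` converges almost surely by a martingale
argument. As `f` tends to `c` along the horizontal strip and to `0` along the vertical one, the
limit is `c (1 - ℙ(N₁ < ∞))` (`tendsto_integral_eval`). Finally `f(s) - c` is `O(e^{-t(j - j₀)})`.
The second half is the same argument with the axes exchanged. -/

/-- The transition operator `f ↦ (x ↦ 𝔼ₓ f(ω 1))` on nonnegative functions. -/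
def transOp {S : Type*} (K : S → PMF S) (f : S → ℝ≥0∞) (x : S) : ℝ≥0∞ := ∑' y, K x y * f y

theorem transOp_mono {S : Type*} (K : S → PMF S) : Monotone (transOp K) :=
  fun _ _ h x => ENNReal.tsum_le_tsum fun y => mul_le_mul_right (h y) (K x y)

theorem transOp_add {S : Type*} (K : S → PMF S) (f g : S → ℝ≥0∞) :
    transOp K (f + g) = transOp K f + transOp K g := by
  funext x
  simp [transOp, mul_add, ENNReal.tsum_add]

/-- A supersolution of `e + T ψ ≤ ψ` dominates the potential of `e`. -/
theorem sum_iterate_le_of_supersolution {S : Type*} {T : (S → ℝ≥0∞) → S → ℝ≥0∞} (hT : Monotone T)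
    (hadd : ∀ f g, T (f + g) = T f + T g) {e ψ : S → ℝ≥0∞} (h : e + T ψ ≤ ψ) (n : ℕ) :
    ∑ m ∈ Finset.range n, T^[m] e ≤ ψ := by
  -- Additivity in `[0, ∞]` does not give `T 0 = 0`, hence the restriction to nonempty sums.
  have hsum : ∀ n : ℕ, 1 ≤ n →
      T (∑ m ∈ Finset.range n, T^[m] e) = ∑ m ∈ Finset.range n, T^[m + 1] e := by
    intro n hn
    induction n, hn using Nat.le_induction with
    | base => simp
    | succ n _ ih =>
      rw [Finset.sum_range_succ, hadd, ih, Finset.sum_range_succ, Function.iterate_succ_apply' T n]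
  rcases Nat.eq_zero_or_pos n with rfl | hn
  · intro x; simp
  induction n, hn using Nat.le_induction with
  | base => simpa using (le_add_of_nonneg_right (zero_le : 0 ≤ T ψ)).trans h
  | succ n hn ih =>
    rw [Finset.sum_range_succ', add_comm, ← hsum n hn]
    exact (add_le_add (by simp) (hT ih)).trans h

theorem tsum_iterate_le_of_supersolution {S : Type*} {T : (S → ℝ≥0∞) → S → ℝ≥0∞} (hT : Monotone T)
    (hadd : ∀ f g, T (f + g) = T f + T g) {e ψ : S → ℝ≥0∞} (h : e + T ψ ≤ ψ) (x : S) :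
    ∑' m, T^[m] e x ≤ ψ x := by
  rw [ENNReal.tsum_eq_iSup_nat]
  refine iSup_le fun n => ?_
  simpa using sum_iterate_le_of_supersolution hT hadd h n x

/-- Number of visits to `A`. -/
def visits {S : Type*} (A : Set S) (ω : ℕ → S) : ℝ≥0∞ := ∑' n : ℕ, Set.indicator A 1 (ω n)

theorem visits_eq_top_of_frequently {S : Type*} {A : Set S} {ω : ℕ → S} (h : ∃ᶠ n in atTop, ω n ∈ A) :
    visits A ω = ∞ := by
  by_contra hne
  have h0 := ENNReal.tendsto_atTop_zero_of_tsum_ne_top hne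
  have h1 : ∀ᶠ n in atTop, Set.indicator A (1 : S → ℝ≥0∞) (ω n) < 1 :=
    h0.eventually (gt_mem_nhds one_pos)
  obtain ⟨n, hn, hn'⟩ := (h.and_eventually h1).exists
  simp [hn] at hn'

theorem frequently_of_visits_eq_top {S : Type*} {A : Set S} {ω : ℕ → S} (h : visits A ω = ∞) :
    ∃ᶠ n in atTop, ω n ∈ A := by
  by_contra hne
  rw [not_frequently, eventually_atTop] at hne
  obtain ⟨N, hN⟩ := hne
  refine absurd h ?_
  rw [visits, tsum_eq_sum (s := Finset.range N) fun n hn => by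
    simp [hN n (by simpa using hn)]]
  refine ENNReal.sum_ne_top.2 fun n _ => ?_
  by_cases hA : ω n ∈ A <;> simp [hA]

/-! ### Markov property of the path law and convergence of functions along trajectories. -/

section PathLaw

set_option linter.unusedSectionVars false

variable {S : Type*} [MeasurableSpace S] [Countable S] [MeasurableSingletonClass S]

theorem PMF.lintegral_eq_tsum' (q : PMF S) (f : S → ℝ≥0∞) :
    ∫⁻ y, f y ∂q.toMeasure = ∑' y, q y * f y := by
  rw [lintegral_countable']
  exact tsum_congr fun y => by
    rw [PMF.toMeasure_apply_singleton _ _ (measurableSet_singleton y), mul_comm]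

instance (K : S → PMF S) (x : S) : IsProbabilityMeasure (pathLaw K x) :=
  inferInstanceAs (IsProbabilityMeasure (Kernel.traj (X := fun _ => S) (historyKernel K) 0 _))

theorem pathLaw_map_zero (K : S → PMF S) (x : S) : ∀ᵐ ω ∂pathLaw K x, ω 0 = x := by
  have h : (pathLaw K x).map (frestrictLe 0) = Measure.dirac (fun _ => x) := by
    have := Kernel.traj_map_frestrictLe_apply (X := fun _ => S) (κ := historyKernel K) 0 0 (fun _ => x)
    rw [Kernel.partialTraj_self, Kernel.id_apply] at this
    exact this
  have h2 : ∀ᵐ y ∂((pathLaw K x).map (frestrictLe (π := fun _ => S) 0)),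
      y = fun _ => x := by
    rw [h, ae_dirac_eq (a := (fun _ => x : (i : Finset.Iic 0) → S))]; exact rfl
  have h3 := ae_of_ae_map (by fun_prop) h2
  filter_upwards [h3] with ω hω
  exact congrFun hω ⟨0, by simp⟩

/-- The Markov property at time `n`, tested against an arbitrary functional `Φ` of the past: the
joint law of the past and the next state is a composition product with the one-step kernel. -/
theorem pathLaw_lintegral_succ (K : S → PMF S) (x : S) (n : ℕ)
    (Φ : ((i : Finset.Iic n) → S) → ℝ≥0∞) (f : S → ℝ≥0∞) :
    ∫⁻ ω, Φ (frestrictLe n ω) * f (ω (n + 1)) ∂pathLaw K x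
      = ∫⁻ ω, Φ (frestrictLe n ω) * transOp K f (ω n) ∂pathLaw K x := by
  have hΦ : Measurable Φ := measurable_of_countable _
  have hf : Measurable f := measurable_of_countable _
  have h1 := Kernel.partialTraj_compProd_eq_map_traj (X := fun _ => S)
    (κ := historyKernel K) (Nat.zero_le n) (x₀ := fun _ => x)
  have h2 : ∫⁻ ω, Φ (frestrictLe n ω) * f (ω (n + 1)) ∂pathLaw K x
      = ∫⁻ q, Φ q.1 * f q.2 ∂((pathLaw K x).map (fun ω ↦ (frestrictLe n ω, ω (n + 1)))) := by
    rw [lintegral_map (by fun_prop) (by fun_prop)]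
  rw [h2, pathLaw, ← h1, Measure.lintegral_compProd (by fun_prop)]
  have h3 := Kernel.traj_map_frestrictLe_apply (X := fun _ => S) (κ := historyKernel K) 0 n (fun _ => x)
  rw [← h3, lintegral_map (measurable_of_countable _) (by fun_prop)]
  refine lintegral_congr fun ω => ?_
  simp only
  rw [lintegral_const_mul _ hf]
  congr 1
  exact PMF.lintegral_eq_tsum' (K (ω n)) f

theorem pathLaw_lintegral_iterate (K : S → PMF S) (x : S) (n : ℕ) (f : S → ℝ≥0∞) :
    ∫⁻ ω, f (ω n) ∂pathLaw K x = (transOp K)^[n] f x := by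
  induction n generalizing f with
  | zero =>
    have : (fun ω : ℕ → S => f (ω 0)) =ᵐ[pathLaw K x] fun _ => f x := by
      filter_upwards [pathLaw_map_zero K x] with ω hω
      rw [hω]
    rw [lintegral_congr_ae this]
    simp
  | succ n ih =>
    have := pathLaw_lintegral_succ K x n 1 f
    simp only [Pi.one_apply, one_mul] at this
    rw [this, ih, Function.iterate_succ_apply]

theorem pathLaw_apply_eq (K : S → PMF S) (x y : S) (n : ℕ) :
    pathLaw K x {ω | ω n = y} = (transOp K)^[n] (Set.indicator {y} 1) x := by
  rw [← pathLaw_lintegral_iterate]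
  have : MeasurableSet {ω : ℕ → S | ω n = y} :=
    measurableSet_eq_fun (measurable_pi_apply n) measurable_const
  rw [← lintegral_indicator_one this]
  refine lintegral_congr fun ω => ?_
  simp only [Set.indicator, Set.mem_singleton_iff, Set.mem_ofPred_eq]
  rfl

/-- Exchanging the sums over states and times turns integrals against the Green function into
potentials, to which the supersolution bound applies. -/
theorem tsum_green_mul (K : S → PMF S) (x : S) (e : S → ℝ≥0∞) :
    ∑' y, green K x y * e y = ∑' n, (transOp K)^[n] e x := by
  simp_rw [green, ← ENNReal.tsum_mul_right]
  rw [ENNReal.tsum_comm]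
  refine tsum_congr fun n => ?_
  rw [← pathLaw_lintegral_iterate]
  rw [← lintegral_map (μ := pathLaw K x) (g := fun ω => ω n) (measurable_of_countable e)
    (measurable_pi_apply n), lintegral_countable']
  refine tsum_congr fun y => ?_
  rw [Measure.map_apply (measurable_pi_apply n) (measurableSet_singleton y), mul_comm]
  rfl

theorem green_eq_tsum_iterate (K : S → PMF S) (x y : S) :
    green K x y = ∑' n, (transOp K)^[n] (Set.indicator {y} 1) x :=
  tsum_congr fun n => pathLaw_apply_eq K x y n

theorem isIrreducibleChain_iff (K : S → PMF S) :
    IsIrreducibleChain K ↔ ∀ x y, ∃ n, 0 < (transOp K)^[n] (Set.indicator {y} 1) x := by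
  simp only [IsIrreducibleChain, pathLaw_apply_eq]

/-- A superharmonic `ψ` that loses at least `e` at each visit cannot lose more than its initial
value. -/
theorem tsum_green_mul_le (K : S → PMF S) {e ψ : S → ℝ≥0∞} (h : e + transOp K ψ ≤ ψ) (x : S) :
    ∑' y, green K x y * e y ≤ ψ x := by
  rw [tsum_green_mul]
  exact tsum_iterate_le_of_supersolution (transOp_mono K) (transOp_add K) h x

theorem pathLaw_setIntegral_succ (K : S → PMF S) (x : S) (n : ℕ) {f : S → ℝ} {C : ℝ}
    (hC : ∀ y, |f y| ≤ C) {s : Set (ℕ → S)}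
    (hs : MeasurableSet[Filtration.piLE (X := fun _ : ℕ => S) n] s) :
    ∫ ω in s, f (ω (n + 1)) ∂pathLaw K x
      = ∫ ω in s, (∫ y, f y ∂(K (ω n)).toMeasure) ∂pathLaw K x := by
  rw [Filtration.piLE_eq_comap_frestrictLe] at hs
  obtain ⟨B, hB, rfl⟩ := hs
  have hpre : MeasurableSet (frestrictLe (π := fun _ => S) n ⁻¹' B) := by
    exact measurable_frestrictLe n hB
  have hf : Measurable f := measurable_of_countable _
  have hC0 : 0 ≤ C := (abs_nonneg _).trans (hC x)
  have h1 := Kernel.partialTraj_compProd_eq_map_traj (X := fun _ => S)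
    (κ := historyKernel K) (Nat.zero_le n) (x₀ := fun _ => x)
  have h3 := Kernel.traj_map_frestrictLe_apply (X := fun _ => S) (κ := historyKernel K) 0 n (fun _ => x)
  have hg : Measurable (fun q : ((i : Finset.Iic n) → S) × S => B.indicator 1 q.1 * f q.2) :=
    measurable_of_countable _
  have hbd : ∀ q : ((i : Finset.Iic n) → S) × S, ‖B.indicator 1 q.1 * f q.2‖ ≤ C := by
    intro q
    by_cases hq : q.1 ∈ B <;> simp [hq, hC, hC0]
  have h2 : ∫ ω in (frestrictLe (π := fun _ => S) n ⁻¹' B), f (ω (n + 1)) ∂pathLaw K x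
      = ∫ q, B.indicator 1 q.1 * f q.2
          ∂((pathLaw K x).map (fun ω ↦ (frestrictLe n ω, ω (n + 1)))) := by
    rw [integral_map (by fun_prop) hg.aestronglyMeasurable, ← integral_indicator hpre]
    refine integral_congr_ae (ae_of_all _ fun ω => ?_)
    by_cases hω : frestrictLe (π := fun _ => S) n ω ∈ B <;> simp [hω]
  rw [h2, pathLaw, ← h1, Measure.integral_compProd
    (Integrable.of_bound hg.aestronglyMeasurable C (ae_of_all _ hbd)), ← h3,
    integral_map (by fun_prop) (measurable_of_countable _).aestronglyMeasurable,
    ← integral_indicator hpre]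
  refine integral_congr_ae (ae_of_all _ fun ω => ?_)
  by_cases hω : frestrictLe (π := fun _ => S) n ω ∈ B
  · simp only [hω, Set.indicator_of_mem, Pi.one_apply, one_mul, Set.mem_preimage]
    rfl
  · simp [hω]

/-- The defect `f - P f` of a bounded function. -/
def defect (K : S → PMF S) (f : S → ℝ) (x : S) : ℝ := f x - ∫ y, f y ∂(K x).toMeasure

theorem abs_integral_toMeasure_le (K : S → PMF S) {f : S → ℝ} {C : ℝ} (hC : ∀ y, |f y| ≤ C)
    (x : S) : |∫ y, f y ∂(K x).toMeasure| ≤ C := by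
  have := norm_integral_le_of_norm_le_const (μ := (K x).toMeasure) (f := f) (C := C) (ae_of_all _ hC)
  simpa using this

theorem integrable_eval (K : S → PMF S) (x : S) (n : ℕ) {f : S → ℝ} {C : ℝ}
    (hC : ∀ y, |f y| ≤ C) : Integrable (fun ω : ℕ → S => f (ω n)) (pathLaw K x) :=
  Integrable.of_bound
    ((measurable_of_countable f).comp (measurable_pi_apply n)).aestronglyMeasurable C
    (ae_of_all _ fun _ => hC _)

theorem abs_defect_le (K : S → PMF S) {f : S → ℝ} {C : ℝ} (hC : ∀ y, |f y| ≤ C) (x : S) :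
    |defect K f x| ≤ C + C :=
  (abs_sub _ _).trans (add_le_add (hC x) (abs_integral_toMeasure_le K hC x))

theorem integral_eval_eq (K : S → PMF S) (x : S) {f : S → ℝ} {C : ℝ} (hC : ∀ y, |f y| ≤ C)
    (n : ℕ) : ∫ ω, f (ω n) ∂pathLaw K x
      = f x - ∑ m ∈ Finset.range n, ∫ ω, defect K f (ω m) ∂pathLaw K x := by
  induction n with
  | zero =>
    have : (fun ω : ℕ → S => f (ω 0)) =ᵐ[pathLaw K x] fun _ => f x := by
      filter_upwards [pathLaw_map_zero K x] with ω hω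
      rw [hω]
    rw [integral_congr_ae this]
    simp
  | succ n ih =>
    have h := pathLaw_setIntegral_succ K x n hC (s := Set.univ) MeasurableSet.univ
    simp only [Measure.restrict_univ] at h
    rw [h, Finset.sum_range_succ, ← sub_sub, ← ih,
      ← integral_sub (integrable_eval K x n hC) (integrable_eval K x n (abs_defect_le K hC))]
    simp [defect]

/-- Doob decomposition: `f(ω n)` plus the accumulated defects is a martingale. It is bounded in `L¹`
because the defects are summable in mean, so it converges, and the accumulated defects converge
almost surely as well. -/
theorem ae_tendsto_of_summable_defect (K : S → PMF S) (x : S) {f : S → ℝ} {C : ℝ}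
    (hC : ∀ y, |f y| ≤ C)
    (hsum : ∑' n, ∫⁻ ω, ENNReal.ofReal |defect K f (ω n)| ∂pathLaw K x ≠ ∞) :
    ∀ᵐ ω ∂pathLaw K x, ∃ l, Tendsto (fun n => f (ω n)) atTop (𝓝 l) := by
  set D := defect K f with hD
  have hDC := abs_defect_le K hC
  have hmD : ∀ n, Measurable (fun ω : ℕ → S => D (ω n)) := fun n =>
    (measurable_of_countable D).comp (measurable_pi_apply n)
  have hmf : ∀ n, Measurable (fun ω : ℕ → S => f (ω n)) := fun n =>
    (measurable_of_countable f).comp (measurable_pi_apply n)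
  let M : ℕ → (ℕ → S) → ℝ := fun n ω => f (ω n) + ∑ m ∈ Finset.range n, D (ω m)
  have hmS : ∀ n, Measurable (fun ω : ℕ → S => ∑ m ∈ Finset.range n, D (ω m)) := fun n =>
    Finset.measurable_sum _ fun m _ => hmD m
  have hMint : ∀ n, Integrable (M n) (pathLaw K x) := fun n =>
    (integrable_eval K x n hC).add (integrable_finsetSum _ fun m _ => integrable_eval K x m hDC)
  have hcoord : ∀ {n m : ℕ}, m ≤ n → ∀ g : S → ℝ,
      Measurable[Filtration.piLE (X := fun _ : ℕ => S) n] (fun ω : ℕ → S => g (ω m)) := by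
    intro n m hmn g
    rw [Filtration.piLE_eq_comap_frestrictLe]
    have h1 : (fun ω : ℕ → S => g (ω m))
        = (fun h : ((i : Finset.Iic n) → S) => g (h ⟨m, Finset.mem_Iic.2 hmn⟩)) ∘ frestrictLe n :=
      rfl
    rw [h1]
    exact (measurable_of_countable _).comp (comap_measurable _)
  have hadp : StronglyAdapted (Filtration.piLE (X := fun _ : ℕ => S)) M := by
    intro n
    refine Measurable.stronglyMeasurable ?_
    refine Measurable.add (hcoord le_rfl f) (Finset.measurable_sum _ fun m hm => ?_)
    exact hcoord (Finset.mem_range.1 hm).le D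
  have hsub : Submartingale M Filtration.piLE (pathLaw K x) := by
    refine submartingale_of_setIntegral_le_succ hadp hMint fun n s hs => le_of_eq ?_
    have hS : Integrable (fun ω : ℕ → S => ∑ m ∈ Finset.range n, D (ω m)) (pathLaw K x) :=
      integrable_finsetSum _ fun m _ => integrable_eval K x m hDC
    have hP : Integrable (fun ω : ℕ → S => ∫ y, f y ∂(K (ω n)).toMeasure) (pathLaw K x) :=
      integrable_eval K x n (f := fun z => ∫ y, f y ∂(K z).toMeasure)
        (abs_integral_toMeasure_le K hC)
    have hS' : Integrable (fun ω : ℕ → S => ∑ m ∈ Finset.range (n + 1), D (ω m)) (pathLaw K x) :=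
      integrable_finsetSum _ fun m _ => integrable_eval K x m hDC
    have e1 : ∫ ω in s, M (n + 1) ω ∂pathLaw K x = ∫ ω in s, f (ω (n + 1)) ∂pathLaw K x
        + ∫ ω in s, ∑ m ∈ Finset.range (n + 1), D (ω m) ∂pathLaw K x :=
      integral_add (integrable_eval K x (n + 1) hC).restrict hS'.restrict
    rw [e1, pathLaw_setIntegral_succ K x n hC hs, ← integral_add hP.restrict hS'.restrict]
    refine integral_congr_ae (ae_of_all _ fun ω => ?_)
    simp only [M, Finset.sum_range_succ, hD, defect]
    ring
  set R : ℝ≥0∞ := ∑' n, ∫⁻ ω, ENNReal.ofReal |D (ω n)| ∂pathLaw K x with hR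
  have hbdd : ∀ n, eLpNorm (M n) 1 (pathLaw K x)
      ≤ ((ENNReal.ofReal C + R).toNNReal : ℝ≥0∞) := by
    intro n
    rw [ENNReal.coe_toNNReal (ENNReal.add_ne_top.2 ⟨ENNReal.ofReal_ne_top, hsum⟩),
      eLpNorm_one_eq_lintegral_enorm]
    have : ∀ ω, ‖M n ω‖ₑ ≤ ENNReal.ofReal C + ∑ m ∈ Finset.range n, ENNReal.ofReal |D (ω m)| := by
      intro ω
      refine (enorm_add_le _ _).trans (add_le_add ?_ ((enorm_sum_le _ _).trans ?_))
      · rw [Real.enorm_eq_ofReal_abs]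
        exact ENNReal.ofReal_le_ofReal (hC _)
      · exact (Finset.sum_congr rfl fun m _ => by rw [Real.enorm_eq_ofReal_abs]).le
    refine (lintegral_mono this).trans ?_
    have hmm : ∀ m, Measurable fun ω : ℕ → S => ENNReal.ofReal |D (ω m)| := fun m =>
      ENNReal.measurable_ofReal.comp (hmD m).norm
    rw [lintegral_add_left measurable_const, lintegral_finsetSum _ fun m _ => hmm m]
    simp only [lintegral_const, measure_univ, mul_one]
    exact add_le_add_right (ENNReal.sum_le_tsum _) _
  have hlim := hsub.exists_ae_tendsto_of_bdd hbdd
  have hmm : ∀ m, Measurable fun ω : ℕ → S => ENNReal.ofReal |D (ω m)| := fun m =>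
    ENNReal.measurable_ofReal.comp (hmD m).norm
  have hsumae : ∀ᵐ ω ∂pathLaw K x, ∑' n, ENNReal.ofReal |D (ω n)| < ∞ := by
    refine ae_lt_top (Measurable.tsum hmm) ?_
    rw [lintegral_tsum fun m => (hmm m).aemeasurable]
    exact hsum
  filter_upwards [hlim, hsumae] with ω ⟨l, hl⟩ hω
  have hs : Summable fun n => D (ω n) := by
    refine Summable.of_norm ?_
    have := ENNReal.summable_toReal hω.ne
    simpa [Real.norm_eq_abs] using this
  refine ⟨l - ∑' n, D (ω n), ?_⟩
  have := hl.sub hs.hasSum.tendsto_sum_nat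
  simpa [M] using this

/-- Borel–Cantelli: the Green function is the sum of the probabilities of the visits. -/
theorem ae_finite_visits (K : S → PMF S) (x y : S) (h : green K x y ≠ ∞) :
    ∀ᵐ ω ∂pathLaw K x, ∀ᶠ n in atTop, ω n ≠ y := by
  have := measure_limsup_atTop_eq_zero (μ := pathLaw K x) (s := fun n => {ω : ℕ → S | ω n = y}) h
  rw [← compl_mem_ae_iff] at this
  filter_upwards [this] with ω hω
  simpa [limsup_eq_iInf_iSup_of_nat, Set.mem_compl_iff, eventually_atTop] using hω

theorem measurable_visits (A : Set S) : Measurable (visits A) :=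
  Measurable.tsum fun n => (measurable_of_countable (Set.indicator A 1)).comp
    (measurable_pi_apply n)

/-- Limit of `𝔼 f(ω n)` for a bounded, asymptotically harmonic `f` which tends to `c` along `A` and
to `0` along `B`, when the chain leaves finite sets and visits `A` or `B` infinitely often. -/
theorem tendsto_integral_eval (K : S → PMF S) (x : S) {f : S → ℝ} {C : ℝ} (hC : ∀ y, |f y| ≤ C)
    (hsum : ∑' n, ∫⁻ ω, ENNReal.ofReal |defect K f (ω n)| ∂pathLaw K x ≠ ∞)
    (hgreen : ∀ y, green K x y ≠ ∞) {A B : Set S}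
    (hAB : ∀ᵐ ω ∂pathLaw K x, (∃ᶠ n in atTop, ω n ∈ A) ∨ ∃ᶠ n in atTop, ω n ∈ B) {c : ℝ}
    (hA : Tendsto f (cofinite ⊓ 𝓟 A) (𝓝 c)) (hB : Tendsto f (cofinite ⊓ 𝓟 B) (𝓝 0)) :
    Tendsto (fun n => ∫ ω, f (ω n) ∂pathLaw K x) atTop
      (𝓝 (c * (1 - (pathLaw K x).real {ω | visits A ω < ∞}))) := by
  have hmeas : MeasurableSet {ω : ℕ → S | visits A ω < ∞} :=
    measurableSet_lt (measurable_visits A) measurable_const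
  have hcof : ∀ᵐ ω ∂pathLaw K x, Tendsto ω atTop cofinite := by
    have : ∀ᵐ ω ∂pathLaw K x, ∀ y, ∀ᶠ n in atTop, ω n ≠ y :=
      ae_all_iff.2 fun y => ae_finite_visits K x y (hgreen y)
    filter_upwards [this] with ω hω
    exact le_cofinite_iff_eventually_ne.2 hω
  -- The limit along the whole trajectory is identified on the subsequence of visits to `E`, which
  -- leaves every finite set.
  have hsub : ∀ {ω : ℕ → S} {E : Set S} {l a : ℝ}, Tendsto ω atTop cofinite →
      (∃ᶠ n in atTop, ω n ∈ E) → Tendsto f (cofinite ⊓ 𝓟 E) (𝓝 a) →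
      Tendsto (fun n => f (ω n)) atTop (𝓝 l) → l = a := by
    intro ω E l a hω hE ha hl
    obtain ⟨φ, hφ, hφE⟩ := extraction_of_frequently_atTop hE
    have h1 : Tendsto (fun n => f (ω (φ n))) atTop (𝓝 l) := hl.comp hφ.tendsto_atTop
    have h2 : Tendsto (fun n => ω (φ n)) atTop (cofinite ⊓ 𝓟 E) :=
      tendsto_inf.2 ⟨hω.comp hφ.tendsto_atTop, tendsto_principal.2 (Eventually.of_forall hφE)⟩
    exact tendsto_nhds_unique h1 (ha.comp h2)
  have hlim : ∀ᵐ ω ∂pathLaw K x, Tendsto (fun n => f (ω n)) atTop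
      (𝓝 (c * (1 - Set.indicator {ω | visits A ω < ∞} 1 ω))) := by
    filter_upwards [hcof, ae_tendsto_of_summable_defect K x hC hsum, hAB] with ω hω ⟨l, hl⟩ hor
    by_cases hv : visits A ω < ∞
    · have hnA : ¬ ∃ᶠ n in atTop, ω n ∈ A := fun h => hv.ne (visits_eq_top_of_frequently h)
      have hl0 := hsub hω (hor.resolve_left hnA) hB hl
      subst hl0
      simpa [hv] using hl
    · have hA' := frequently_of_visits_eq_top (not_lt_top_iff.1 hv)
      have hlc := hsub hω hA' hA hl
      subst hlc
      simpa [hv] using hl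
  have hint := tendsto_integral_of_dominated_convergence (μ := pathLaw K x) (fun _ => C)
    (fun n => (integrable_eval K x n hC).aestronglyMeasurable) (integrable_const _)
    (fun n => ae_of_all _ fun ω => hC (ω n)) hlim
  convert hint using 2
  have hind : Integrable (Set.indicator {ω : ℕ → S | visits A ω < ∞} (1 : (ℕ → S) → ℝ))
      (pathLaw K x) := (integrable_const (1 : ℝ)).indicator hmeas
  rw [integral_const_mul, integral_sub (integrable_const _) hind, integral_indicator_one hmeas]
  simp

end PathLaw

/-! ## Exponential moments -/

/-- The exponential weight `e^{t l}` in `[0, ∞]`. -/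
def expWeight (t l : ℝ) : ℝ≥0∞ := ENNReal.ofReal (Real.exp (t * l))

theorem expWeight_add (t l l' : ℝ) : expWeight t (l + l') = expWeight t l * expWeight t l' := by
  rw [expWeight, mul_add, Real.exp_add, ENNReal.ofReal_mul (Real.exp_pos _).le]; rfl

theorem expWeight_zero_right (t : ℝ) : expWeight t 0 = 1 := by simp [expWeight]

theorem expWeight_zero_left (l : ℝ) : expWeight 0 l = 1 := by simp [expWeight]

theorem expWeight_ne_top (t l : ℝ) : expWeight t l ≠ ∞ := ENNReal.ofReal_ne_top

theorem expWeight_ne_zero (t l : ℝ) : expWeight t l ≠ 0 := by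
  simp [expWeight, Real.exp_pos]

theorem expWeight_mono {t l t' l' : ℝ} (h : t * l ≤ t' * l') : expWeight t l ≤ expWeight t' l' :=
  ENNReal.ofReal_le_ofReal (Real.exp_le_exp.2 h)

theorem PMF.tsum_map_mul {α β : Type*} (q : PMF α) (g : α → β) (f : β → ℝ≥0∞) :
    ∑' y, q.map g y * f y = ∑' a, q a * f (g a) := by
  classical
  simp_rw [PMF.map_apply, ← ENNReal.tsum_mul_right]
  rw [ENNReal.tsum_comm]
  refine tsum_congr fun a => ?_
  rw [tsum_eq_single (g a) fun y hy => by simp [hy]]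
  simp

/-- Two-sided exponential moments of order `δ`, bounded by `C`. -/
def ExpMoment (q : PMF (ℤ × ℤ)) (δ : ℝ) (C : ℝ≥0∞) : Prop :=
  ∑' d : ℤ × ℤ, q d * expWeight δ (|(d.1 : ℝ)| + |(d.2 : ℝ)|) ≤ C

theorem ExpMoment.integrable {q : PMF (ℤ × ℤ)} {δ : ℝ} {C : ℝ≥0∞} (h : ExpMoment q δ C)
    (hC : C ≠ ∞) {f : ℤ × ℤ → ℝ}
    (hf : ∀ d, |f d| ≤ Real.exp (δ * (|(d.1 : ℝ)| + |(d.2 : ℝ)|))) :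
    Integrable f q.toMeasure := by
  refine ⟨(measurable_of_countable f).aestronglyMeasurable, ?_⟩
  rw [hasFiniteIntegral_iff_enorm, PMF.lintegral_eq_tsum']
  refine lt_of_le_of_lt (ENNReal.tsum_le_tsum fun d => mul_le_mul_right ?_ _) (h.trans_lt hC.lt_top)
  rw [Real.enorm_eq_ofReal_abs]
  exact ENNReal.ofReal_le_ofReal (hf d)

/-- The moment generating function of `a d.1 + b d.2` is `1` at `0`, and its derivative there is the
mean, which is negative. -/
theorem ExpMoment.eventually_lt_one {q : PMF (ℤ × ℤ)} {δ : ℝ} {C : ℝ≥0∞} (h : ExpMoment q δ C)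
    (hδ : 0 < δ) (hC : C ≠ ∞) {a b : ℝ}
    (hab : a * (∑' d : ℤ × ℤ, (d.1 : ℝ) * (q d).toReal)
      + b * (∑' d : ℤ × ℤ, (d.2 : ℝ) * (q d).toReal) < 0) :
    ∀ᶠ t in 𝓝[>] (0 : ℝ), ∑' d : ℤ × ℤ, q d * expWeight t (a * d.1 + b * d.2) < 1 := by
  set X : ℤ × ℤ → ℝ := fun d => a * d.1 + b * d.2 with hX
  have hexp : ∀ t : ℝ, |t| * (|a| + |b|) ≤ δ → Integrable (fun d => Real.exp (t * X d))
      q.toMeasure := by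
    intro t ht
    refine h.integrable hC fun d => ?_
    rw [Real.abs_exp]
    refine Real.exp_le_exp.2 ((le_abs_self _).trans ?_)
    rw [abs_mul]
    have h1 : |X d| ≤ |a| * |(d.1 : ℝ)| + |b| * |(d.2 : ℝ)| := by
      rw [← abs_mul, ← abs_mul]; exact abs_add_le _ _
    have h2 : |X d| ≤ (|a| + |b|) * (|(d.1 : ℝ)| + |(d.2 : ℝ)|) := by
      nlinarith [abs_nonneg a, abs_nonneg b, abs_nonneg (d.1 : ℝ), abs_nonneg (d.2 : ℝ)]
    calc |t| * |X d| ≤ |t| * ((|a| + |b|) * (|(d.1 : ℝ)| + |(d.2 : ℝ)|)) := by gcongr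
      _ = |t| * (|a| + |b|) * (|(d.1 : ℝ)| + |(d.2 : ℝ)|) := by ring
      _ ≤ _ := by gcongr
  have hnhds : ∀ᶠ t in 𝓝 (0 : ℝ), |t| * (|a| + |b|) ≤ δ := by
    have : Tendsto (fun t : ℝ => |t| * (|a| + |b|)) (𝓝 0) (𝓝 (|0| * (|a| + |b|))) :=
      Continuous.tendsto (by fun_prop) 0
    simp only [abs_zero, zero_mul] at this
    exact this.eventually_le_const hδ
  have hint0 : (0 : ℝ) ∈ interior (integrableExpSet X q.toMeasure) := by
    rw [mem_interior_iff_mem_nhds]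
    filter_upwards [hnhds] with t ht using hexp t ht
  have hlin : ∀ d : ℤ × ℤ, |(d.1 : ℝ)| + |(d.2 : ℝ)|
      ≤ (1 / δ) * Real.exp (δ * (|(d.1 : ℝ)| + |(d.2 : ℝ)|)) := by
    intro d
    rw [one_div, inv_mul_eq_div, le_div_iff₀ hδ, mul_comm]
    linarith [Real.add_one_le_exp (δ * (|(d.1 : ℝ)| + |(d.2 : ℝ)|))]
  have hexp' := h.integrable hC (f := fun d => Real.exp (δ * (|(d.1 : ℝ)| + |(d.2 : ℝ)|)))
    fun d => by rw [Real.abs_exp]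
  have hi1 : Integrable (fun d : ℤ × ℤ => (d.1 : ℝ)) q.toMeasure :=
    (hexp'.const_mul (1 / δ)).mono' (measurable_of_countable _).aestronglyMeasurable
      (ae_of_all _ fun d => by
        rw [Real.norm_eq_abs]; linarith [hlin d, abs_nonneg (d.2 : ℝ)])
  have hi2 : Integrable (fun d : ℤ × ℤ => (d.2 : ℝ)) q.toMeasure :=
    (hexp'.const_mul (1 / δ)).mono' (measurable_of_countable _).aestronglyMeasurable
      (ae_of_all _ fun d => by
        rw [Real.norm_eq_abs]; linarith [hlin d, abs_nonneg (d.1 : ℝ)])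
  have hmean : ∫ d, X d ∂q.toMeasure < 0 := by
    simp only [hX]
    rw [integral_add (hi1.const_mul a) (hi2.const_mul b), integral_const_mul, integral_const_mul,
      PMF.integral_eq_tsum _ _ hi1, PMF.integral_eq_tsum _ _ hi2]
    simpa [mul_comm] using hab
  have hder : HasDerivAt (mgf X q.toMeasure) (∫ d, X d ∂q.toMeasure) 0 := by
    have := hasDerivAt_mgf hint0
    simpa using this
  have hslope := (hasDerivAt_iff_tendsto_slope.1 hder).eventually_lt_const hmean
  have hslope' : ∀ᶠ t in 𝓝[>] (0 : ℝ), slope (mgf X q.toMeasure) 0 t < 0 :=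
    hslope.filter_mono (nhdsWithin_mono _ fun t ht => ne_of_gt ht)
  filter_upwards [hslope', hnhds.filter_mono nhdsWithin_le_nhds, self_mem_nhdsWithin]
    with t ht1 ht2 ht3
  have ht3 : 0 < t := ht3
  have hlt : mgf X q.toMeasure t < 1 := by
    rw [slope_def_field, mgf_zero, sub_zero, div_lt_iff₀ ht3] at ht1
    simp at ht1
    linarith
  rw [← PMF.lintegral_eq_tsum']
  have : ∫⁻ d, expWeight t (a * d.1 + b * d.2) ∂q.toMeasure
      = ENNReal.ofReal (mgf X q.toMeasure t) := by
    rw [mgf, ofReal_integral_eq_lintegral_ofReal (hexp t ht2) (ae_of_all _ fun d => by positivity)]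
    rfl
  rw [this, ← ENNReal.ofReal_one]
  exact (ENNReal.ofReal_lt_ofReal_iff one_pos).2 hlt

theorem ExpMoment.mono {q : PMF (ℤ × ℤ)} {δ δ' : ℝ} {C : ℝ≥0∞} (h : ExpMoment q δ C)
    (hδ : δ' ≤ δ) : ExpMoment q δ' C :=
  (ENNReal.tsum_le_tsum fun _ => mul_le_mul_right (expWeight_mono (by gcongr)) _).trans h

/-! ## Walks on the strip `ℕ × ℤ` -/

/-- First coordinate after the jump `d` from a point of abscissa `x`. -/
def stepX (x : ℕ) (d : ℤ × ℤ) : ℕ := ((x : ℤ) + d.1).toNat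

/-- The walk on `ℕ × ℤ` whose jump law `p x` only depends on the first coordinate. -/
def stripChain (p : ℕ → PMF (ℤ × ℤ)) (z : ℕ × ℤ) : PMF (ℕ × ℤ) :=
  (p z.1).map fun d => (stepX z.1 d, z.2 + d.2)

theorem transOp_stripChain (p : ℕ → PMF (ℤ × ℤ)) (f : ℕ × ℤ → ℝ≥0∞) (z : ℕ × ℤ) :
    transOp (stripChain p) f z = ∑' d, p z.1 d * f (stepX z.1 d, z.2 + d.2) :=
  PMF.tsum_map_mul _ _ _

/-- Walks on `ℕ × ℤ` which are homogeneous beyond column `k`, have exponential moments, jumps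
bounded below and negative drift in the interior. -/
structure StripWalk (p : ℕ → PMF (ℤ × ℤ)) (k : ℕ) : Prop where
  interior : ∀ x, k ≤ x → p x = p k
  fst_ge : ∀ x d, p x d ≠ 0 → -(k : ℤ) ≤ d.1
  nonneg : ∀ x d, p x d ≠ 0 → 0 ≤ (x : ℤ) + d.1
  moments : ∃ δ C, 0 < δ ∧ C ≠ ∞ ∧ ∀ x, ExpMoment (p x) δ C
  drift_fst : ∑' d : ℤ × ℤ, (d.1 : ℝ) * (p k d).toReal < 0
  drift_snd : ∑' d : ℤ × ℤ, (d.2 : ℝ) * (p k d).toReal < 0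
  irreducible : IsIrreducibleChain (stripChain p)

/-! ### Excursions away from a column: killed operators and first return laws. -/

section Killed

variable (p : ℕ → PMF (ℤ × ℤ)) (i : ℕ)

/-- The operator of the walk killed on column `i`, tilted by `e^{t y}`. -/
def killedOp (t : ℝ) (ψ : ℕ → ℝ≥0∞) (x : ℕ) : ℝ≥0∞ :=
  ∑' d : ℤ × ℤ, p x d * (expWeight t d.2 * if stepX x d = i then 0 else ψ (stepX x d))

/-- The tilted one-step probability to enter column `i`. -/
def killedExit (t : ℝ) (x : ℕ) : ℝ≥0∞ :=
  ∑' d : ℤ × ℤ, p x d * (expWeight t d.2 * if stepX x d = i then 1 else 0)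

/-- Probability, from column `x`, to return to column `i` for the first time at time `n + 1` with
vertical displacement `l`. -/
def hit : ℕ → ℕ → ℤ → ℝ≥0∞
  | 0, x, l => ∑' d : ℤ × ℤ, p x d * if stepX x d = i then (if d.2 = l then 1 else 0) else 0
  | n + 1, x, l => ∑' d : ℤ × ℤ, p x d * if stepX x d = i then 0 else hit n (stepX x d) (l - d.2)

/-- Law of the vertical displacement until the first return to column `i`. -/
def hitLaw (x : ℕ) (l : ℤ) : ℝ≥0∞ := ∑' n, hit p i n x l

/-- Law of the vertical displacement until the first visit (at a time `≥ 0`) to column `i`. -/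
def hitLaw₀ (x : ℕ) (l : ℤ) : ℝ≥0∞ := if x = i then (if l = 0 then 1 else 0) else hitLaw p i x l

/-- Laplace transform of `hitLaw`. -/
def lap (t : ℝ) (x : ℕ) : ℝ≥0∞ := ∑' l : ℤ, hitLaw p i x l * expWeight t l

/-- Laplace transform of `hitLaw₀`. -/
def lap₀ (t : ℝ) (x : ℕ) : ℝ≥0∞ := ∑' l : ℤ, hitLaw₀ p i x l * expWeight t l

variable {p i}

theorem killedOp_mono (t : ℝ) : Monotone (killedOp p i t) := by
  intro f g h x
  refine ENNReal.tsum_le_tsum fun d => ?_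
  gcongr
  split_ifs
  · exact le_rfl
  · exact h _

theorem killedOp_add (t : ℝ) (f g : ℕ → ℝ≥0∞) :
    killedOp p i t (f + g) = killedOp p i t f + killedOp p i t g := by
  funext x
  simp only [killedOp, Pi.add_apply, ← ENNReal.tsum_add]
  refine tsum_congr fun d => ?_
  split_ifs <;> ring

theorem killedOp_smul (t : ℝ) (c : ℝ≥0∞) (f : ℕ → ℝ≥0∞) :
    killedOp p i t (c • f) = c • killedOp p i t f := by
  funext x
  simp only [killedOp, Pi.smul_apply, smul_eq_mul, ← ENNReal.tsum_mul_left]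
  refine tsum_congr fun d => ?_
  split_ifs <;> ring

theorem hitLaw_eq (x : ℕ) (l : ℤ) :
    hitLaw p i x l = ∑' d : ℤ × ℤ, p x d * hitLaw₀ p i (stepX x d) (l - d.2) := by
  rw [hitLaw, tsum_eq_zero_add' ENNReal.summable]
  simp only [hit]
  rw [ENNReal.tsum_comm, ← ENNReal.tsum_add]
  refine tsum_congr fun d => ?_
  rw [ENNReal.tsum_mul_left, ← mul_add]
  congr 1
  by_cases h : stepX x d = i
  · simp [h, hitLaw₀, sub_eq_zero, eq_comm]
  · simp [h, hitLaw₀, hitLaw]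

theorem lap₀_of_eq (t : ℝ) : lap₀ p i t i = 1 := by
  rw [lap₀, tsum_eq_single 0 fun l hl => by simp [hitLaw₀, hl]]
  simp [hitLaw₀, expWeight_zero_right]

theorem lap₀_of_ne (t : ℝ) {x : ℕ} (h : x ≠ i) : lap₀ p i t x = lap p i t x := by
  simp [lap₀, hitLaw₀, h, lap]

/-- Integration against the first return law, decomposed at the first step. -/
theorem tsum_hitLaw_mul (x : ℕ) (f : ℤ → ℝ≥0∞) :
    ∑' l, hitLaw p i x l * f l
      = ∑' d : ℤ × ℤ, p x d * ∑' l, hitLaw₀ p i (stepX x d) l * f (d.2 + l) := by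
  simp_rw [hitLaw_eq, ← ENNReal.tsum_mul_right, ← ENNReal.tsum_mul_left]
  rw [ENNReal.tsum_comm]
  refine tsum_congr fun d => ?_
  rw [← (Equiv.addLeft d.2).tsum_eq]
  refine tsum_congr fun l => ?_
  simp [mul_assoc]

theorem lap_eq (t : ℝ) (x : ℕ) :
    lap p i t x = ∑' d : ℤ × ℤ, p x d * (expWeight t d.2 * lap₀ p i t (stepX x d)) := by
  rw [lap, tsum_hitLaw_mul x fun l => expWeight t l]
  refine tsum_congr fun d => ?_
  rw [lap₀, ← ENNReal.tsum_mul_left (a := expWeight t d.2)]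
  refine congrArg _ (tsum_congr fun l => ?_)
  push_cast
  rw [expWeight_add]
  ring

theorem lap_eq' (t : ℝ) : lap p i t = killedExit p i t + killedOp p i t (lap p i t) := by
  funext x
  rw [lap_eq, Pi.add_apply, killedExit, killedOp, ← ENNReal.tsum_add]
  refine tsum_congr fun d => ?_
  by_cases h : stepX x d = i
  · simp [h, lap₀_of_eq]
  · simp [h, lap₀_of_ne]

/-- The weight `e^{ty}` is multiplicative along the path, so tilting the jumps one by one tilts the
whole displacement. -/
theorem tsum_hit_mul (t : ℝ) (n : ℕ) (x : ℕ) :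
    ∑' l : ℤ, hit p i n x l * expWeight t l = (killedOp p i t)^[n] (killedExit p i t) x := by
  induction n generalizing x with
  | zero =>
    simp only [hit, ← ENNReal.tsum_mul_right, Function.iterate_zero, id_eq, killedExit]
    rw [ENNReal.tsum_comm]
    refine tsum_congr fun d => ?_
    rw [tsum_eq_single d.2 fun l hl => by simp [hl.symm]]
    split_ifs <;> simp_all
  | succ n ih =>
    simp only [hit, ← ENNReal.tsum_mul_right, Function.iterate_succ_apply']
    rw [ENNReal.tsum_comm, killedOp]
    refine tsum_congr fun d => ?_
    by_cases h : stepX x d = i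
    · simp [h]
    · simp only [h, if_false, mul_assoc, ENNReal.tsum_mul_left]
      congr 1
      rw [← ih, ← (Equiv.addLeft d.2).tsum_eq, ← ENNReal.tsum_mul_left]
      refine tsum_congr fun l => ?_
      simp only [Equiv.coe_addLeft, add_sub_cancel_left]
      push_cast
      rw [expWeight_add]
      ring

theorem lap_eq_tsum (t : ℝ) (x : ℕ) :
    lap p i t x = ∑' n, (killedOp p i t)^[n] (killedExit p i t) x := by
  simp_rw [lap, hitLaw, ← ENNReal.tsum_mul_right]
  rw [ENNReal.tsum_comm]
  exact tsum_congr fun n => tsum_hit_mul t n x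

/-- `lap` is the smallest supersolution of its own first-step equation `lap_eq'`. -/
theorem lap_le (t : ℝ) {ψ : ℕ → ℝ≥0∞} (h : killedExit p i t + killedOp p i t ψ ≤ ψ) :
    lap p i t ≤ ψ := fun x => by
  rw [lap_eq_tsum]
  exact tsum_iterate_le_of_supersolution (killedOp_mono t) (killedOp_add t) h x

theorem killedExit_add_killedOp_one : killedExit p i 0 + killedOp p i 0 1 = 1 := by
  funext x
  rw [Pi.add_apply, killedExit, killedOp, ← ENNReal.tsum_add]
  have : ∀ d : ℤ × ℤ, p x d * (expWeight 0 d.2 * if stepX x d = i then 1 else 0)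
      + p x d * (expWeight 0 d.2 * if stepX x d = i then 0 else (1 : ℕ → ℝ≥0∞) (stepX x d))
        = p x d := by
    intro d
    split_ifs <;> simp [expWeight_zero_left]
  simp_rw [this]
  exact (p x).tsum_coe

theorem killedOp_one_le : killedOp p i 0 1 ≤ 1 :=
  (le_add_of_nonneg_left zero_le).trans killedExit_add_killedOp_one.le

/-- The iterate `(killedOp p i 0)^[n] 1 x` is the probability, from column `x`, not to enter column
`i` at times `1, …, n`. -/
theorem survival_antitone (x : ℕ) : Antitone fun n => (killedOp p i 0)^[n] 1 x := by
  refine antitone_nat_of_succ_le fun n => ?_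
  rw [Function.iterate_succ_apply]
  exact (killedOp_mono 0).iterate n killedOp_one_le x

/-- Standing in column `i` at time `n + 1` and having avoided it at times `1, …, n + 1` are
incompatible events. -/
theorem survival_add_le (v : ℤ) (n : ℕ) (z : ℕ × ℤ) :
    (killedOp p i 0)^[n + 1] 1 z.1
      + (transOp (stripChain p))^[n + 1] (Set.indicator {(i, v)} 1) z ≤ 1 := by
  induction n generalizing z with
  | zero =>
    simp only [zero_add, Function.iterate_one]
    rw [killedOp, transOp_stripChain, ← ENNReal.tsum_add, ← (p z.1).tsum_coe]
    refine ENNReal.tsum_le_tsum fun d => ?_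
    by_cases h : stepX z.1 d = i
    · simp only [h, if_true, mul_zero, zero_add]
      exact mul_le_of_le_one_right' (Set.indicator_le_self' (by simp) _)
    · simp [h, expWeight_zero_left]
  | succ n ih =>
    rw [Function.iterate_succ_apply', Function.iterate_succ_apply' (transOp _), killedOp,
      transOp_stripChain, ← ENNReal.tsum_add, ← (p z.1).tsum_coe]
    refine ENNReal.tsum_le_tsum fun d => ?_
    rw [expWeight_zero_left, one_mul, ← mul_add]
    refine mul_le_of_le_one_right' (le_trans ?_ (ih (stepX z.1 d, z.2 + d.2)))
    gcongr
    split_ifs <;> simp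

theorem exists_survival_lt_one (hirr : IsIrreducibleChain (stripChain p)) (i x : ℕ) :
    ∃ n, (killedOp p i 0)^[n] 1 x < 1 := by
  -- The height `1` of the target differs from the initial height, so the path has at least one step
  -- even if `x = i`.
  obtain ⟨n, hn⟩ := (isIrreducibleChain_iff _).1 hirr (x, 0) (i, 1)
  cases n with
  | zero => simp at hn
  | succ n =>
    refine ⟨n + 1, ?_⟩
    have h := survival_add_le (p := p) (i := i) 1 n (x, 0)
    refine lt_of_lt_of_le ?_ h
    refine ENNReal.lt_add_right ?_ hn.ne'
    exact ne_top_of_le_ne_top ENNReal.one_ne_top (le_self_add.trans h)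

/-- Only finitely many columns are involved and survival decreases with time, so the largest time
and the smallest gap serve them all. -/
theorem exists_survival_add_le (hirr : IsIrreducibleChain (stripChain p)) (i k : ℕ) :
    ∃ N, ∃ θ : ℝ≥0∞, θ ≠ 0 ∧ ∀ x < k, (killedOp p i 0)^[N] 1 x + θ ≤ 1 := by
  induction k with
  | zero => exact ⟨0, 1, one_ne_zero, by simp⟩
  | succ k ih =>
    obtain ⟨N, θ, hθ, hN⟩ := ih
    obtain ⟨n, hn⟩ := exists_survival_lt_one hirr i k
    refine ⟨max N n, min θ (1 - (killedOp p i 0)^[n] 1 k), ?_, fun x hx => ?_⟩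
    · rw [← pos_iff_ne_zero]
      exact lt_min (pos_iff_ne_zero.2 hθ) (tsub_pos_of_lt hn)
    · rcases Nat.lt_succ_iff_lt_or_eq.1 hx with hx | rfl
      · exact (add_le_add (survival_antitone x (le_max_left N n)) (min_le_left _ _)).trans (hN x hx)
      · refine (add_le_add (survival_antitone x (le_max_right N n)) (min_le_right _ _)).trans ?_
        rw [add_tsub_cancel_of_le hn.le]

end Killed

/-! ### Exponential estimates for excursions. -/

section KilledBounds

variable {p : ℕ → PMF (ℤ × ℤ)} {i k : ℕ}

theorem killedOp_iterate_smul (t : ℝ) (c : ℝ≥0∞) (f : ℕ → ℝ≥0∞) (n : ℕ) :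
    (killedOp p i t)^[n] (c • f) = c • (killedOp p i t)^[n] f := by
  induction n with
  | zero => rfl
  | succ n ih => rw [Function.iterate_succ_apply', ih, killedOp_smul,
      ← Function.iterate_succ_apply' (killedOp p i t)]

theorem StripWalk.stepX_cast (h : StripWalk p k) {x : ℕ} {d : ℤ × ℤ} (hd : p x d ≠ 0) :
    ((stepX x d : ℕ) : ℝ) = x + d.1 := by
  have := Int.toNat_of_nonneg (h.nonneg x d hd)
  exact_mod_cast this

theorem StripWalk.tsum_expWeight_step (h : StripWalk p k) (x : ℕ) (ε : ℝ) (f : ℤ × ℤ → ℝ≥0∞) :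
    ∑' d : ℤ × ℤ, p x d * (f d * expWeight ε (stepX x d))
      = (∑' d : ℤ × ℤ, p x d * (f d * expWeight ε d.1)) * expWeight ε x := by
  rw [← ENNReal.tsum_mul_right]
  refine tsum_congr fun d => ?_
  by_cases hd : p x d = 0
  · simp [hd]
  · rw [h.stepX_cast hd, expWeight_add]; ring

theorem StripWalk.killedOp_exp_le (h : StripWalk p k) (t ε : ℝ) (x : ℕ) :
    killedOp p i t (fun x => expWeight ε x) x
      ≤ (∑' d : ℤ × ℤ, p x d * (expWeight t d.2 * expWeight ε d.1)) * expWeight ε x := by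
  rw [← h.tsum_expWeight_step]
  refine ENNReal.tsum_le_tsum fun d => ?_
  gcongr
  split_ifs
  · exact zero_le
  · exact le_rfl

theorem expWeight_abs_le {δ ε : ℝ} (hε : ε ≤ δ) (hε0 : 0 ≤ ε) (a b : ℝ) :
    expWeight δ |b| * expWeight ε a ≤ expWeight δ (|a| + |b|) := by
  rw [add_comm, expWeight_add]
  gcongr
  refine expWeight_mono ((mul_le_mul_of_nonneg_left (le_abs_self a) hε0).trans ?_)
  gcongr

/-- Convexity of `exp` between `0` and `δ|l|`. It makes the tilted operator a perturbation of size
`|t| / δ` of the untilted one. -/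
theorem expWeight_perturb {δ t : ℝ} (hδ : 0 < δ) (ht : |t| ≤ δ) (l : ℝ) :
    expWeight t l ≤ 1 + ENNReal.ofReal (|t| / δ) * expWeight δ |l| := by
  have hs0 : 0 ≤ |t| / δ := by positivity
  have hs1 : |t| / δ ≤ 1 := (div_le_one hδ).2 ht
  have hconv := convexOn_exp.2 (Set.mem_univ (0 : ℝ)) (Set.mem_univ (δ * |l|))
    (sub_nonneg.2 hs1) hs0 (by ring)
  simp only [smul_eq_mul, mul_zero, zero_add, Real.exp_zero, mul_one] at hconv
  have h1 : t * l ≤ |t| / δ * (δ * |l|) := by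
    rw [← mul_assoc, div_mul_cancel₀ _ hδ.ne', ← abs_mul]; exact le_abs_self _
  rw [expWeight, expWeight, ← ENNReal.ofReal_mul hs0, ← ENNReal.ofReal_one,
    ← ENNReal.ofReal_add zero_le_one (by positivity)]
  refine ENNReal.ofReal_le_ofReal ((Real.exp_le_exp.2 h1).trans (hconv.trans ?_))
  linarith

/-- A finite number of survival probabilities gives a bounded strict supersolution on `[0, k)`. -/
theorem exists_bounded_supersolution (hirr : IsIrreducibleChain (stripChain p)) (i k : ℕ) :
    ∃ (N : ℕ) (θ : ℝ≥0∞) (v : ℕ → ℝ≥0∞), θ ≠ 0 ∧ (∀ x, v x ≤ N) ∧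
      killedOp p i 0 v ≤ v ∧ ∀ x < k, killedOp p i 0 v x + θ ≤ v x := by
  obtain ⟨N, θ, hθ, hN⟩ := exists_survival_add_le hirr i k
  have hle : ∀ n x, (killedOp p i 0)^[n] 1 x ≤ 1 := fun n x => by
    simpa using survival_antitone (p := p) (i := i) x (Nat.zero_le n)
  -- Telescoping: for `v` the sum of the first `N` survival probabilities, `v - T v = 1 - T^N 1`,
  -- which is nonnegative everywhere and at least `θ` below column `k`.
  have key : ∀ n x, killedOp p i 0 (∑ m ∈ Finset.range n, (killedOp p i 0)^[m] 1) x + 1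
      = (∑ m ∈ Finset.range n, (killedOp p i 0)^[m] 1) x + (killedOp p i 0)^[n] 1 x := by
    intro n x
    induction n with
    | zero => simp [killedOp]
    | succ n ih =>
      rw [Finset.sum_range_succ, killedOp_add, Pi.add_apply, add_right_comm, ih,
        ← Function.iterate_succ_apply' (killedOp p i 0), Pi.add_apply]
  refine ⟨N, θ, ∑ m ∈ Finset.range N, (killedOp p i 0)^[m] 1, hθ, fun x => ?_, fun x => ?_,
    fun x hx => ?_⟩
  · rw [Finset.sum_apply]
    exact (Finset.sum_le_sum fun m _ => hle m x).trans (by simp)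
  · have h1 := (key N x).le.trans (add_le_add_right (hle N x) _)
    exact (ENNReal.add_le_add_iff_right ENNReal.one_ne_top).1 h1
  · have hfin : (killedOp p i 0)^[N] 1 x ≠ ∞ := ne_top_of_le_ne_top ENNReal.one_ne_top (hle N x)
    have h1 : killedOp p i 0 (∑ m ∈ Finset.range N, (killedOp p i 0)^[m] 1) x + θ
        + (killedOp p i 0)^[N] 1 x
        ≤ (∑ m ∈ Finset.range N, (killedOp p i 0)^[m] 1) x + (killedOp p i 0)^[N] 1 x := by
      rw [← key N x, add_assoc, add_comm θ]
      exact add_le_add_right (hN x hx) _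
    exact (ENNReal.add_le_add_iff_right hfin).1 h1

/-- The function is `e^{εx} + A v`, with `v` the bounded supersolution above. Beyond column `k` the
negative drift contracts `e^{εx}` by a factor `ρ < 1`. Below it the image of `e^{εx}` is at most `B
e^{εk}`, and `A` is chosen so that the gain `A θ` of `A v` equals this amount. -/
theorem StripWalk.exists_lyapunov (h : StripWalk p k) (i : ℕ) :
    ∃ (δ ε : ℝ) (B c C₁ : ℝ≥0∞) (ψ : ℕ → ℝ≥0∞), 0 < ε ∧ ε ≤ δ ∧ B ≠ ∞ ∧ c ≠ 0 ∧ C₁ ≠ ∞ ∧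
      (∀ x, ExpMoment (p x) δ B) ∧ (∀ x, ψ x ≤ C₁ * expWeight ε x) ∧
      ∀ x, killedOp p i 0 ψ x + c * expWeight ε x ≤ ψ x := by
  obtain ⟨δ, B, hδ, hB, hmom⟩ := h.moments
  have hev := (hmom k).eventually_lt_one hδ hB (a := 1) (b := 0) (by simpa using h.drift_fst)
  obtain ⟨ε, hρ, hε⟩ := (hev.and (Ioc_mem_nhdsGT hδ)).exists
  set ρ := ∑' d : ℤ × ℤ, p k d * expWeight ε (1 * d.1 + 0 * d.2) with hρdef
  obtain ⟨N, θ, v, hθ, hvN, hv1, hv2⟩ := exists_bounded_supersolution h.irreducible i k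
  set A : ℝ≥0∞ := B * expWeight ε k / θ with hA
  have hAtop : A ≠ ∞ := ENNReal.div_ne_top (ENNReal.mul_ne_top hB (expWeight_ne_top _ _)) hθ
  have hmul : ∀ x, ∑' d : ℤ × ℤ, p x d * (expWeight 0 d.2 * expWeight ε d.1) ≤ B := by
    intro x
    refine le_trans (ENNReal.tsum_le_tsum fun d => mul_le_mul_right ?_ _) (hmom x)
    refine le_trans (mul_le_mul' (expWeight_mono ?_) le_rfl) (expWeight_abs_le hε.2 hε.1.le _ _)
    rw [zero_mul]
    exact mul_nonneg hδ.le (abs_nonneg _)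
  refine ⟨δ, ε, B, 1 - ρ, 1 + A * N, fun x => expWeight ε x + A * v x, hε.1, hε.2, hB,
    (tsub_pos_of_lt hρ).ne', ENNReal.add_ne_top.2 ⟨ENNReal.one_ne_top,
    ENNReal.mul_ne_top hAtop (ENNReal.natCast_ne_top N)⟩, hmom, fun x => ?_, fun x => ?_⟩
  · change expWeight ε x + A * v x ≤ _
    rw [add_mul, one_mul]
    refine add_le_add le_rfl ?_
    calc A * v x ≤ A * N := by gcongr; exact hvN x
      _ ≤ A * N * expWeight ε x := by
        refine le_mul_of_one_le_right' ?_
        rw [← expWeight_zero_left 0]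
        exact expWeight_mono (by have := hε.1; rw [zero_mul]; positivity)
  · have hsplit : killedOp p i 0 (fun x => expWeight ε x + A * v x) x
        = killedOp p i 0 (fun x => expWeight ε x) x + A * killedOp p i 0 v x := by
      have := congrFun (killedOp_add (p := p) (i := i) 0 (fun x => expWeight ε x) (A • v)) x
      rw [killedOp_smul] at this
      exact this
    rw [hsplit]
    rcases lt_or_ge x k with hx | hx
    · have h1 : killedOp p i 0 (fun x => expWeight ε x) x ≤ A * θ := by
        rw [hA, ENNReal.div_mul_cancel hθ]
        · refine (h.killedOp_exp_le 0 ε x).trans ?_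
          gcongr
          · exact hmul x
          · exact expWeight_mono (by have := hε.1; gcongr)
        · have := (le_add_self.trans (hv2 x hx)).trans (hvN x)
          exact ne_top_of_le_ne_top (ENNReal.natCast_ne_top N) this
      have h2 : (1 - ρ) * expWeight ε x ≤ expWeight ε x := mul_le_of_le_one_left' tsub_le_self
      calc _ ≤ A * θ + A * killedOp p i 0 v x + expWeight ε x := by gcongr
        _ = A * (killedOp p i 0 v x + θ) + expWeight ε x := by ring
        _ ≤ A * v x + expWeight ε x := by gcongr; exact hv2 x hx
        _ = _ := add_comm _ _
    · have h1 : killedOp p i 0 (fun x => expWeight ε x) x ≤ ρ * expWeight ε x := by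
        refine (h.killedOp_exp_le 0 ε x).trans ?_
        rw [h.interior x hx, hρdef]
        simp [expWeight_zero_left]
      calc _ ≤ ρ * expWeight ε x + A * v x + (1 - ρ) * expWeight ε x := by
            gcongr; exact hv1 x
        _ = (ρ + (1 - ρ)) * expWeight ε x + A * v x := by ring
        _ = _ := by rw [add_tsub_cancel_of_le hρ.le, one_mul]

/-- Tilting costs at most `(|t| / δ) B C₁ e^{εx}`, which for small `t` of either sign is half of the
Lyapunov gain `c e^{εx}`. The remaining half bounds the potential of `e^{εx}` for the tilted killed
operator, hence also `lap`, since `killedExit` is at most a multiple of `e^{εx}`. -/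
theorem StripWalk.exists_potential_bound (h : StripWalk p k) (i : ℕ) :
    ∃ (ε t₁ : ℝ) (D : ℝ≥0∞), 0 < ε ∧ 0 < t₁ ∧ D ≠ ∞ ∧
      (∀ x, ExpMoment (p x) t₁ D) ∧
      (∀ t, |t| ≤ t₁ → ∀ x, lap p i t x ≤ D * expWeight ε x) ∧
      ∀ x, ∑' n, (killedOp p i 0)^[n] (fun x => expWeight ε x) x ≤ D * expWeight ε x := by
  obtain ⟨δ, ε, B, c, C₁, ψ, hε, hεδ, hB, hc, hC₁, hmom, hψ, hlyap⟩ := h.exists_lyapunov i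
  have hδ : 0 < δ := hε.trans_le hεδ
  have hc2 : c / 2 ≠ 0 := by simp [hc]
  have hBC : B * C₁ ≠ ∞ := ENNReal.mul_ne_top hB hC₁
  obtain ⟨t₁, ht₁, ht₁δ, hsmall⟩ : ∃ t₁, 0 < t₁ ∧ t₁ ≤ δ ∧
      ENNReal.ofReal (t₁ / δ) * (B * C₁) ≤ c / 2 := by
    have hlim : Tendsto (fun t : ℝ => ENNReal.ofReal (t / δ) * (B * C₁)) (𝓝[>] 0) (𝓝 0) := by
      have h1 : Tendsto (fun t : ℝ => ENNReal.ofReal (t / δ)) (𝓝[>] 0) (𝓝 0) := by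
        have : Tendsto (fun t : ℝ => t / δ) (𝓝 0) (𝓝 (0 / δ)) :=
          Continuous.tendsto (by fun_prop) 0
        rw [zero_div] at this
        simpa using (ENNReal.tendsto_ofReal this).mono_left nhdsWithin_le_nhds
      simpa using ENNReal.Tendsto.mul_const h1 (Or.inr hBC)
    obtain ⟨t, ht, ht'⟩ := ((hlim.eventually_le_const (pos_iff_ne_zero.2 hc2)).and
      (Ioc_mem_nhdsGT hδ)).exists
    exact ⟨t, ht'.1, ht'.2, ht⟩
  have hpert : ∀ t, |t| ≤ t₁ → ∀ x, killedOp p i t ψ x + c / 2 * expWeight ε x ≤ ψ x := by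
    intro t ht x
    have h1 : killedOp p i t ψ x
        ≤ killedOp p i 0 ψ x + ENNReal.ofReal (t₁ / δ) * (B * C₁) * expWeight ε x := by
      have h2 : ∑' d : ℤ × ℤ, p x d * (expWeight δ |(d.2 : ℝ)| * expWeight ε (stepX x d))
          ≤ B * expWeight ε x := by
        rw [h.tsum_expWeight_step x ε fun d => expWeight δ |(d.2 : ℝ)|]
        gcongr
        exact (ENNReal.tsum_le_tsum fun d =>
          mul_le_mul_right (expWeight_abs_le hεδ hε.le _ _) _).trans (hmom x)
      calc killedOp p i t ψ x
          ≤ killedOp p i 0 ψ x + ∑' d : ℤ × ℤ, ENNReal.ofReal (t₁ / δ) * C₁ *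
            (p x d * (expWeight δ |(d.2 : ℝ)| * expWeight ε (stepX x d))) := by
            rw [killedOp, killedOp, ← ENNReal.tsum_add]
            refine ENNReal.tsum_le_tsum fun d => ?_
            by_cases hd : stepX x d = i
            · simp [hd]
            · simp only [hd, if_false, expWeight_zero_left, one_mul]
              have hp : expWeight t d.2 ≤ 1 + ENNReal.ofReal (t₁ / δ) * expWeight δ |(d.2 : ℝ)| :=
                (expWeight_perturb hδ (ht.trans ht₁δ) _).trans (by gcongr)
              calc p x d * (expWeight t d.2 * ψ (stepX x d))
                  ≤ p x d * ((1 + ENNReal.ofReal (t₁ / δ) * expWeight δ |(d.2 : ℝ)|)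
                    * ψ (stepX x d)) := by gcongr
                _ = p x d * ψ (stepX x d) + ENNReal.ofReal (t₁ / δ) *
                    (p x d * (expWeight δ |(d.2 : ℝ)| * ψ (stepX x d))) := by ring
                _ ≤ p x d * ψ (stepX x d) + ENNReal.ofReal (t₁ / δ) *
                    (p x d * (expWeight δ |(d.2 : ℝ)| * (C₁ * expWeight ε (stepX x d)))) := by
                    gcongr; exact hψ _
                _ = _ := by ring
        _ ≤ killedOp p i 0 ψ x + ENNReal.ofReal (t₁ / δ) * C₁ * (B * expWeight ε x) := by
            rw [ENNReal.tsum_mul_left]; gcongr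
        _ = _ := by ring
    calc _ ≤ killedOp p i 0 ψ x + ENNReal.ofReal (t₁ / δ) * (B * C₁) * expWeight ε x
          + c / 2 * expWeight ε x := by gcongr
      _ ≤ killedOp p i 0 ψ x + c / 2 * expWeight ε x + c / 2 * expWeight ε x := by gcongr
      _ = killedOp p i 0 ψ x + (c / 2 + c / 2) * expWeight ε x := by ring
      _ ≤ ψ x := by rw [ENNReal.add_halves]; exact hlyap x
  set D₀ : ℝ≥0∞ := (c / 2)⁻¹ * C₁ with hD₀
  -- Finiteness of `c` is read off from the Lyapunov inequality at `x = 0`.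
  have hc2top : c / 2 ≠ ∞ := by
    refine ne_top_of_le_ne_top hC₁ ?_
    have := (le_add_self.trans (hpert 0 (by simpa using ht₁.le) 0)).trans (hψ 0)
    simpa [expWeight] using this
  have hpot : ∀ t, |t| ≤ t₁ → ∀ x,
      ∑' n, (killedOp p i t)^[n] (fun x => expWeight ε x) x ≤ D₀ * expWeight ε x := by
    intro t ht x
    have h1 := tsum_iterate_le_of_supersolution (killedOp_mono (p := p) (i := i) t)
      (killedOp_add t) (e := (c / 2) • fun x : ℕ => expWeight ε x) (ψ := ψ)
      (fun x => (add_comm _ _).le.trans (hpert t ht x)) x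
    simp_rw [killedOp_iterate_smul, Pi.smul_apply, smul_eq_mul, ENNReal.tsum_mul_left] at h1
    rw [hD₀, mul_assoc, mul_comm, ← div_eq_mul_inv, ENNReal.le_div_iff_mul_le (Or.inl hc2)
      (Or.inl hc2top), mul_comm]
    exact h1.trans (hψ x)
  have hexit : ∀ t, |t| ≤ t₁ → killedExit p i t ≤ B • fun x : ℕ => expWeight ε x := by
    intro t ht x
    rw [Pi.smul_apply, smul_eq_mul]
    refine le_trans ?_ (le_mul_of_one_le_right' (b := expWeight ε x) ?_)
    · refine (ENNReal.tsum_le_tsum fun d => mul_le_mul_right ?_ _).trans (hmom x)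
      refine (mul_le_of_le_one_right' (by split_ifs <;> simp)).trans (expWeight_mono ?_)
      have h1 : t * d.2 ≤ |t| * |(d.2 : ℝ)| := by rw [← abs_mul]; exact le_abs_self _
      refine h1.trans ?_
      gcongr
      · exact ht.trans ht₁δ
      · linarith [abs_nonneg (d.1 : ℝ)]
    · rw [← expWeight_zero_left 0]
      exact expWeight_mono (by rw [zero_mul]; positivity)
  refine ⟨ε, t₁, B * D₀ + D₀ + B, hε, ht₁, ?_, fun x => ((hmom x).mono ht₁δ).trans le_add_self,
    fun t ht x => ?_, fun x => ?_⟩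
  · have : D₀ ≠ ∞ := ENNReal.mul_ne_top (ENNReal.inv_ne_top.2 hc2) hC₁
    finiteness
  · rw [lap_eq_tsum]
    calc _ ≤ ∑' n, B * (killedOp p i t)^[n] (fun x => expWeight ε x) x := by
          refine ENNReal.tsum_le_tsum fun n => ?_
          have := (killedOp_mono (p := p) (i := i) t).iterate n (hexit t ht) x
          rwa [killedOp_iterate_smul] at this
      _ ≤ B * (D₀ * expWeight ε x) := by
          rw [ENNReal.tsum_mul_left]; gcongr; exact hpot t ht x
      _ = B * D₀ * expWeight ε x := by ring
      _ ≤ _ := by gcongr; exact le_self_add.trans le_self_add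
  · refine (hpot 0 (by simpa using ht₁.le) x).trans ?_
    gcongr
    exact le_add_self.trans le_self_add

/-- Survival probabilities are even summable, since `1 ≤ e^{εx}` and the potential of `e^{εx}` is
finite. -/
theorem StripWalk.tendsto_survival (h : StripWalk p k) (i x : ℕ) :
    Tendsto (fun n => (killedOp p i 0)^[n] 1 x) atTop (𝓝 0) := by
  obtain ⟨ε, t₁, D, hε, ht₁, hD, -, -, hpot⟩ := h.exists_potential_bound i
  refine ENNReal.tendsto_atTop_zero_of_tsum_ne_top (ne_top_of_le_ne_top
    (ENNReal.mul_ne_top hD (expWeight_ne_top ε x)) (le_trans ?_ (hpot x)))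
  refine ENNReal.tsum_le_tsum fun n => (killedOp_mono 0).iterate n (fun y => ?_) x
  rw [Pi.one_apply, ← expWeight_zero_left 0]
  exact expWeight_mono (by rw [zero_mul]; positivity)

theorem sum_killedExit_add_survival (n x : ℕ) :
    ∑ m ∈ Finset.range n, (killedOp p i 0)^[m] (killedExit p i 0) x + (killedOp p i 0)^[n] 1 x
      = 1 := by
  induction n with
  | zero => simp
  | succ n ih =>
    have h1 : ∀ n, (killedOp p i 0)^[n] (killedExit p i 0 + killedOp p i 0 1)
        = (killedOp p i 0)^[n] (killedExit p i 0) + (killedOp p i 0)^[n] (killedOp p i 0 1) := by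
      intro n
      induction n with
      | zero => rfl
      | succ n ih => simp only [Function.iterate_succ_apply', ih, killedOp_add]
    have h2 := congrFun (h1 n) x
    rw [killedExit_add_killedOp_one, ← Function.iterate_succ_apply, Pi.add_apply] at h2
    rw [Finset.sum_range_succ, add_assoc, ← h2, ih]

theorem StripWalk.lap_zero (h : StripWalk p k) (i x : ℕ) : lap p i 0 x = 1 := by
  rw [lap_eq_tsum]
  have h1 := (ENNReal.tendsto_nat_tsum fun n => (killedOp p i 0)^[n] (killedExit p i 0) x).add
    (h.tendsto_survival i x)
  simp_rw [sum_killedExit_add_survival, add_zero] at h1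
  exact tendsto_nhds_unique h1 tendsto_const_nhds

theorem StripWalk.tsum_hitLaw (h : StripWalk p k) (i x : ℕ) : ∑' l, hitLaw p i x l = 1 := by
  rw [← h.lap_zero i x, lap]
  exact tsum_congr fun l => by rw [expWeight_zero_left, mul_one]

theorem StripWalk.tsum_hitLaw₀ (h : StripWalk p k) (i x : ℕ) : ∑' l, hitLaw₀ p i x l = 1 := by
  by_cases hx : x = i
  · simp [hitLaw₀, hx]
  · simp [hitLaw₀, hx, h.tsum_hitLaw]

/-- For small `t > 0`, the Laplace transform of the return law decays exponentially in the initial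
column: the walk goes down while it comes back. -/
theorem StripWalk.lap_decay (h : StripWalk p k) (i : ℕ) :
    ∀ᶠ t in 𝓝[>] (0 : ℝ), ∃ (δ' : ℝ) (C : ℝ≥0∞), 0 < δ' ∧ C ≠ ∞ ∧
      ∀ x, lap p i t x ≤ C * expWeight (-δ') x := by
  obtain ⟨ε, t₁, D, hε, ht₁, hD, hmom, hlap, -⟩ := h.exists_potential_bound i
  set m₁ := ∑' d : ℤ × ℤ, (d.1 : ℝ) * (p k d).toReal with hm₁
  set m₂ := ∑' d : ℤ × ℤ, (d.2 : ℝ) * (p k d).toReal with hm₂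
  have hn₁ : m₁ < 0 := h.drift_fst
  have hn₂ : m₂ < 0 := h.drift_snd
  -- With this slope `d.2 - b d.1` has mean `m₂ / 2 < 0` in the interior, so `e^{t(y - bx)}` is
  -- superharmonic there for small `t > 0`.
  set b : ℝ := m₂ / (2 * m₁) with hb
  have hbpos : 0 < b := div_pos_of_neg_of_neg hn₂ (by linarith)
  have hbm : b * m₁ = m₂ / 2 := by have := hn₁.ne; rw [hb]; field_simp
  have hev := (hmom k).eventually_lt_one ht₁ hD (a := -b) (b := 1)
    (by rw [← hm₁, ← hm₂]; linarith)
  filter_upwards [hev, Ioc_mem_nhdsGT ht₁] with t hlt ht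
  have hfin : ∀ x, lap p i t x ≠ ∞ := fun x => ne_top_of_le_ne_top
    (ENNReal.mul_ne_top hD (expWeight_ne_top _ _)) (hlap t (by rw [abs_of_pos ht.1]; exact ht.2) x)
  -- From column `K` on, the jump law is the interior one and, jumps being at least `-k`, column `i`
  -- cannot be reached in one step.
  set K := max k (i + k + 1) with hK
  set C : ℝ≥0∞ := ∑ x ∈ Finset.range K, lap p i t x * expWeight (t * b) x with hC
  refine ⟨t * b, C, mul_pos ht.1 hbpos, ?_, ?_⟩
  · exact ENNReal.sum_ne_top.2 fun x _ => ENNReal.mul_ne_top (hfin x) (expWeight_ne_top _ _)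
  set g : ℕ → ℝ≥0∞ := fun x => C * expWeight (-(t * b)) x with hg
  have hinv : ∀ x : ℕ, expWeight (t * b) x * expWeight (-(t * b)) x = 1 := fun x => by
    rw [expWeight, expWeight, ← ENNReal.ofReal_mul (Real.exp_pos _).le, ← Real.exp_add]
    simp
  have hsmall : ∀ x < K, lap p i t x ≤ g x := by
    intro x hx
    calc lap p i t x = lap p i t x * expWeight (t * b) x * expWeight (-(t * b)) x := by
          rw [mul_assoc, hinv, mul_one]
      _ ≤ g x := by
          simp only [hg]
          gcongr
          exact Finset.single_le_sum (f := fun x : ℕ => lap p i t x * expWeight (t * b) x)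
            (fun _ _ => zero_le) (Finset.mem_range.2 hx)
  -- The minimum with `g` is still a supersolution: below `K` the constant `C` makes `lap ≤ g`, and
  -- from `K` on `g` is itself superharmonic. Minimality of `lap` then forces `lap ≤ g` everywhere.
  have hsuper : killedExit p i t + killedOp p i t (lap p i t ⊓ g) ≤ lap p i t ⊓ g := by
    have h1 : killedExit p i t + killedOp p i t (lap p i t ⊓ g) ≤ lap p i t := by
      conv_rhs => rw [lap_eq']
      exact add_le_add_right (killedOp_mono t inf_le_left) _
    refine le_inf h1 fun x => ?_
    rcases lt_or_ge x K with hx | hx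
    · exact (h1 x).trans (hsmall x hx)
    · have hexit : killedExit p i t x = 0 := by
        refine ENNReal.tsum_eq_zero.2 fun d => ?_
        by_cases hd : p x d = 0
        · simp [hd]
        · have e1 := h.fst_ge x d hd
          have hne : stepX x d ≠ i := by
            have hxK : i + k + 1 ≤ x := (le_max_right _ _).trans hx
            unfold stepX
            omega
          simp [hne]
      rw [Pi.add_apply, hexit, zero_add]
      calc killedOp p i t (lap p i t ⊓ g) x ≤ killedOp p i t g x :=
            killedOp_mono t inf_le_right x
        _ = C * killedOp p i t (fun x => expWeight (-(t * b)) x) x :=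
            congrFun (killedOp_smul t C fun x : ℕ => expWeight (-(t * b)) x) x
        _ ≤ C * ((∑' d : ℤ × ℤ, p x d * (expWeight t d.2 * expWeight (-(t * b)) d.1))
              * expWeight (-(t * b)) x) := by
            gcongr; exact h.killedOp_exp_le _ _ _
        _ ≤ C * (1 * expWeight (-(t * b)) x) := by
            gcongr
            rw [h.interior x ((le_max_left _ _).trans hx)]
            refine le_trans (ENNReal.tsum_le_tsum fun d => mul_le_mul_right ?_ _) hlt.le
            rw [expWeight, expWeight, expWeight, ← ENNReal.ofReal_mul (Real.exp_pos _).le,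
              ← Real.exp_add]
            refine ENNReal.ofReal_le_ofReal (Real.exp_le_exp.2 (le_of_eq ?_))
            ring
        _ = g x := by simp [hg]
  exact fun x => (lap_le t hsuper x).trans inf_le_right

/-- Uniformly in the starting column, the displacement cannot be large and positive: a bound on
`lap` at some `s > 0` and Markov's inequality give a level `L` exceeded with probability at most
`1/2`. Hence the bound `e^{-tL} / 2`. -/
theorem StripWalk.lap_neg_lower (h : StripWalk p k) (i : ℕ) {t : ℝ} (ht : 0 < t) :
    ∃ c : ℝ, 0 < c ∧ ∀ x, ENNReal.ofReal c ≤ lap p i (-t) x := by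
  obtain ⟨s, ⟨δ', C, hδ', hC, hdec⟩, hs⟩ := ((h.lap_decay i).and self_mem_nhdsWithin).exists
  have hs : 0 < s := hs
  have hbound : ∀ x, lap p i s x ≤ C := fun x => (hdec x).trans <| by
    refine mul_le_of_le_one_right' ?_
    rw [← expWeight_zero_left 0]
    refine expWeight_mono ?_
    rw [zero_mul, neg_mul, neg_nonpos]
    positivity
  obtain ⟨L, hL⟩ : ∃ L : ℝ, expWeight s (-L) * C ≤ 2⁻¹ := by
    have h1 : Tendsto (fun L : ℝ => expWeight s (-L)) atTop (𝓝 0) := by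
      have : Tendsto (fun L : ℝ => Real.exp (s * -L)) atTop (𝓝 0) := by
        refine Real.tendsto_exp_atBot.comp ?_
        simp only [mul_neg]
        exact tendsto_neg_atTop_atBot.comp (tendsto_id.const_mul_atTop hs)
      have := ENNReal.tendsto_ofReal this
      rwa [ENNReal.ofReal_zero] at this
    have h2 := ENNReal.Tendsto.mul_const h1 (Or.inr hC)
    rw [zero_mul] at h2
    exact (h2.eventually_le_const (by simp)).exists
  refine ⟨Real.exp (-t * L) / 2, by positivity, fun x => ?_⟩
  set a := expWeight (-t) L with ha
  have hpt : ∀ l : ℤ, a ≤ expWeight (-t) l + a * expWeight s (-L) * expWeight s l := by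
    intro l
    rcases le_total (l : ℝ) L with hl | hl
    · exact (expWeight_mono (by nlinarith)).trans le_self_add
    · refine le_trans ?_ le_add_self
      rw [mul_assoc, ← expWeight_add]
      refine le_mul_of_one_le_right' ?_
      rw [← expWeight_zero_left 0]
      exact expWeight_mono (by rw [zero_mul]; exact mul_nonneg hs.le (by linarith))
  have hsum : a ≤ lap p i (-t) x + a * 2⁻¹ := by
    calc a = ∑' l, hitLaw p i x l * a := by rw [ENNReal.tsum_mul_right, h.tsum_hitLaw, one_mul]
      _ ≤ ∑' l : ℤ, (hitLaw p i x l * expWeight (-t) l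
            + a * expWeight s (-L) * (hitLaw p i x l * expWeight s l)) := by
          refine ENNReal.tsum_le_tsum fun l => ?_
          calc _ ≤ hitLaw p i x l
                * (expWeight (-t) l + a * expWeight s (-L) * expWeight s l) := by
                gcongr; exact hpt l
            _ = _ := by ring
      _ = lap p i (-t) x + a * (expWeight s (-L) * lap p i s x) := by
          rw [ENNReal.tsum_add, ENNReal.tsum_mul_left, mul_assoc]; rfl
      _ ≤ lap p i (-t) x + a * (expWeight s (-L) * C) := by gcongr; exact hbound x
      _ ≤ _ := by gcongr
  have hfin : a * 2⁻¹ ≠ ∞ := ENNReal.mul_ne_top (expWeight_ne_top _ _) (by simp)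
  have h2 : a * 2⁻¹ + a * 2⁻¹ ≤ lap p i (-t) x + a * 2⁻¹ := by
    rwa [← mul_add, ENNReal.inv_two_add_inv_two, mul_one]
  have h3 := (ENNReal.add_le_add_iff_right hfin).1 h2
  convert h3 using 1
  rw [ha, expWeight, div_eq_mul_inv, ENNReal.ofReal_mul (Real.exp_pos _).le,
    ENNReal.ofReal_inv_of_pos two_pos]
  simp

end KilledBounds

/-! ## Renewal theorem with exponential rate on `ℤ` -/

section Renewal

theorem Real.exp_zpow_eq (s : ℝ) (l : ℤ) : Real.exp s ^ l = Real.exp (l * s) := by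
  rw [← Real.rpow_intCast, ← Real.exp_mul, mul_comm]

/-- The open annulus `e^{-t} < |z| < e^t`. -/
def expAnnulus (t : ℝ) : Set ℂ := {z | Real.exp (-t) < ‖z‖ ∧ ‖z‖ < Real.exp t}

theorem isOpen_expAnnulus (t : ℝ) : IsOpen (expAnnulus t) :=
  (isOpen_lt continuous_const continuous_norm).inter (isOpen_lt continuous_norm continuous_const)

theorem expAnnulus_mono {t t' : ℝ} (h : t ≤ t') : expAnnulus t ⊆ expAnnulus t' := fun _ hz =>
  ⟨(Real.exp_le_exp.2 (neg_le_neg h)).trans_lt hz.1, hz.2.trans_le (Real.exp_le_exp.2 h)⟩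

theorem ne_zero_of_mem_expAnnulus {t : ℝ} {z : ℂ} (hz : z ∈ expAnnulus t) : z ≠ 0 :=
  norm_pos_iff.1 ((Real.exp_pos _).trans hz.1)

theorem mem_expAnnulus_of_norm_eq_exp {t s : ℝ} (h : |s| < t) {z : ℂ} (hz : ‖z‖ = Real.exp s) :
    z ∈ expAnnulus t := by
  rw [abs_lt] at h
  rw [expAnnulus, Set.mem_ofPred_eq, hz, Real.exp_lt_exp, Real.exp_lt_exp]
  exact h

theorem norm_zpow_le {t : ℝ} {z : ℂ} (hz : z ∈ expAnnulus t) (l : ℤ) :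
    ‖z ^ l‖ ≤ Real.exp (t * l) + Real.exp (-t * l) := by
  have h0 : 0 < ‖z‖ := norm_pos_iff.2 (ne_zero_of_mem_expAnnulus hz)
  obtain ⟨s, hs⟩ : ∃ s, Real.exp s = ‖z‖ := ⟨_, Real.exp_log h0⟩
  have h1 := hz.1
  have h2 := hz.2
  rw [← hs, Real.exp_lt_exp] at h1 h2
  rw [norm_zpow, ← hs, Real.exp_zpow_eq]
  rcases le_total 0 (l : ℝ) with hl | hl
  · exact (Real.exp_le_exp.2 (by nlinarith)).trans (le_add_of_nonneg_right (Real.exp_pos _).le)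
  · exact (Real.exp_le_exp.2 (by nlinarith)).trans (le_add_of_nonneg_left (Real.exp_pos _).le)

variable {ν : ℤ → ℝ} {t₁ m : ℝ}

/-- Generating function of `ν`. -/
def genFun (ν : ℤ → ℝ) (z : ℂ) : ℂ := ∑' l, (ν l : ℂ) * z ^ l

theorem norm_genFun_term_le (hν0 : ∀ l, 0 ≤ ν l) (l : ℤ) {z : ℂ} (hz : z ∈ expAnnulus t₁) :
    ‖(ν l : ℂ) * z ^ l‖ ≤ ν l * Real.exp (t₁ * l) + ν l * Real.exp (-t₁ * l) := by
  rw [norm_mul, Complex.norm_real, Real.norm_of_nonneg (hν0 l), ← mul_add]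
  exact mul_le_mul_of_nonneg_left (norm_zpow_le hz l) (hν0 l)

theorem differentiableOn_genFun_term (l : ℤ) :
    DifferentiableOn ℂ (fun z : ℂ => (ν l : ℂ) * z ^ l) (expAnnulus t₁) := fun _ hz =>
  ((differentiableAt_zpow.2 (Or.inl (ne_zero_of_mem_expAnnulus hz))).const_mul
    _).differentiableWithinAt

theorem differentiableOn_genFun (hν0 : ∀ l, 0 ≤ ν l)
    (hsum : Summable fun l : ℤ => ν l * Real.exp (t₁ * l) + ν l * Real.exp (-t₁ * l)) :
    DifferentiableOn ℂ (genFun ν) (expAnnulus t₁) :=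
  Complex.differentiableOn_tsum_of_summable_norm hsum differentiableOn_genFun_term
    (isOpen_expAnnulus t₁) fun l _ hz => norm_genFun_term_le hν0 l hz

theorem one_mem_expAnnulus (ht : 0 < t₁) : (1 : ℂ) ∈ expAnnulus t₁ :=
  mem_expAnnulus_of_norm_eq_exp (s := 0) (by simpa using ht) (by simp)

theorem hasDerivAt_genFun (hν0 : ∀ l, 0 ≤ ν l) (ht : 0 < t₁)
    (hsum : Summable fun l : ℤ => ν l * Real.exp (t₁ * l) + ν l * Real.exp (-t₁ * l))
    (hm : HasSum (fun l : ℤ => ν l * l) m) : HasDerivAt (genFun ν) (m : ℂ) 1 := by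
  have h1 := Complex.hasSum_deriv_of_summable_norm hsum differentiableOn_genFun_term
    (isOpen_expAnnulus t₁) (fun l _ hz => norm_genFun_term_le hν0 l hz) (one_mem_expAnnulus ht)
  have h2 : HasSum (fun l : ℤ => deriv (fun z : ℂ => (ν l : ℂ) * z ^ l) 1) (m : ℂ) := by
    have h3 := Complex.hasSum_ofReal.2 hm
    refine h3.congr_fun ?_ |> id
    intro l
    simp
  have hd := ((differentiableOn_genFun hν0 hsum).differentiableAt
    ((isOpen_expAnnulus t₁).mem_nhds (one_mem_expAnnulus ht))).hasDerivAt
  have : deriv (genFun ν) 1 = m := h1.unique h2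
  rwa [this] at hd

/-- The sum is `1` at `t = 0`, with derivative `-m < 0`. -/
theorem eventually_tsum_exp_neg_lt_one (hν0 : ∀ l, 0 ≤ ν l) (hν1 : HasSum ν 1) (ht : 0 < t₁)
    (hsum : Summable fun l : ℤ => ν l * Real.exp (t₁ * l) + ν l * Real.exp (-t₁ * l))
    (hm : HasSum (fun l : ℤ => ν l * l) m) (hm0 : 0 < m) :
    ∀ᶠ t in 𝓝[>] (0 : ℝ), ∑' l : ℤ, ν l * Real.exp (-t * l) < 1 := by
  have hd := hasDerivAt_genFun hν0 ht hsum hm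
  have hreal : ∀ t : ℝ, genFun ν (Complex.exp (-t))
      = ((∑' l : ℤ, ν l * Real.exp (-t * l) : ℝ) : ℂ) := by
    intro t
    rw [Complex.ofReal_tsum]
    refine tsum_congr fun l => ?_
    rw [← Complex.exp_int_mul]
    push_cast
    ring_nf
  have h1 : HasDerivAt (fun t : ℂ => genFun ν (Complex.exp (-t))) (-m : ℂ) ((0 : ℝ) : ℂ) := by
    have h2 : HasDerivAt (fun t : ℂ => Complex.exp (-t)) (-1) ((0 : ℝ) : ℂ) := by
      have := (hasDerivAt_neg ((0 : ℝ) : ℂ)).cexp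
      simpa using this
    have h3 : HasDerivAt (genFun ν) (m : ℂ) (Complex.exp (-((0 : ℝ) : ℂ))) := by simpa using hd
    have := h3.comp ((0 : ℝ) : ℂ) h2
    rw [mul_neg, mul_one] at this
    exact this
  have h4 := h1.real_of_complex
  simp only [hreal, Complex.ofReal_re] at h4
  have hslope := (hasDerivAt_iff_tendsto_slope.1 h4).eventually_lt_const (u := 0) (by simpa using hm0)
  have hslope' := hslope.filter_mono (nhdsWithin_mono _ fun t ht => ne_of_gt ht :
    𝓝[>] (0 : ℝ) ≤ 𝓝[≠] 0)
  filter_upwards [hslope', self_mem_nhdsWithin] with t h5 h6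
  have h6 : 0 < t := h6
  rw [slope_def_field, sub_zero, div_lt_iff₀ h6] at h5
  simp [hν1.tsum_eq] at h5
  simpa using h5

/-- The Laurent coefficient `(2πi)⁻¹ ∮_{|z| = ρ} z^{-k-1} g(z) dz`. -/
def laurentCoeff (g : ℂ → ℂ) (ρ : ℝ) (k : ℤ) : ℂ :=
  (2 * Real.pi * Complex.I : ℂ)⁻¹ • ∮ z in C(0, ρ), z ^ (-k - 1) * g z

theorem norm_laurentCoeff_le {g : ℂ → ℂ} {s C : ℝ} (hC : ∀ z : ℂ, ‖z‖ = Real.exp s → ‖g z‖ ≤ C)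
    (k : ℤ) : ‖laurentCoeff g (Real.exp s) k‖ ≤ C * Real.exp (-s * k) := by
  have h := circleIntegral.norm_two_pi_i_inv_smul_integral_le_of_norm_le_const
    (f := fun z : ℂ => z ^ (-k - 1) * g z) (c := 0) (R := Real.exp s)
    (C := Real.exp (-s * (k + 1)) * C) (Real.exp_pos s).le fun z hz => by
      have hz : ‖z‖ = Real.exp s := by simpa using hz
      rw [norm_mul, norm_zpow, hz, Real.exp_zpow_eq]
      have : ((-k - 1 : ℤ) : ℝ) * s = -s * (k + 1) := by push_cast; ring
      rw [this]
      exact mul_le_mul_of_nonneg_left (hC z hz) (Real.exp_pos _).le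
  refine h.trans (le_of_eq ?_)
  rw [← mul_assoc, ← Real.exp_add, mul_comm]
  congr 2
  ring

theorem laurentCoeff_one {ρ : ℝ} (hρ : 0 < ρ) (k : ℤ) :
    laurentCoeff (fun _ => 1) ρ k = if k = 0 then 1 else 0 := by
  rw [laurentCoeff]
  simp only [mul_one]
  split_ifs with hk
  · subst hk
    have := circleIntegral.integral_sub_center_inv 0 hρ.ne'
    simp only [sub_zero] at this
    simp only [neg_zero, zero_sub, zpow_neg_one, this, smul_eq_mul]
    refine inv_mul_cancel₀ ?_
    simp [Real.pi_ne_zero]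
  · have := circleIntegral.integral_sub_zpow_of_ne (n := -k - 1) (by omega) 0 0 ρ
    simp only [sub_zero] at this
    rw [this, smul_zero]

theorem circleIntegrable_laurent {g : ℂ → ℂ} {ρ : ℝ} (hρ : 0 < ρ)
    (hg : ContinuousOn g (Metric.sphere 0 ρ)) (k : ℤ) :
    CircleIntegrable (fun z : ℂ => z ^ (-k - 1) * g z) 0 ρ := by
  refine ContinuousOn.circleIntegrable hρ.le (ContinuousOn.mul ?_ hg)
  refine continuousOn_id.zpow₀ _ fun z hz => Or.inl ?_
  rintro rfl
  simp [hρ.ne] at hz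

theorem laurentCoeff_sub {g h : ℂ → ℂ} {ρ : ℝ} (hρ : 0 < ρ)
    (hg : ContinuousOn g (Metric.sphere 0 ρ)) (hh : ContinuousOn h (Metric.sphere 0 ρ)) (k : ℤ) :
    laurentCoeff (fun z => g z - h z) ρ k = laurentCoeff g ρ k - laurentCoeff h ρ k := by
  rw [laurentCoeff, laurentCoeff, laurentCoeff, ← smul_sub, ← circleIntegral.integral_sub
    (circleIntegrable_laurent hρ hg k) (circleIntegrable_laurent hρ hh k)]
  simp only [mul_sub]

theorem laurentCoeff_congr {g h : ℂ → ℂ} {ρ : ℝ} (hρ : 0 < ρ)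
    (hgh : ∀ z : ℂ, ‖z‖ = ρ → g z = h z) (k : ℤ) : laurentCoeff g ρ k = laurentCoeff h ρ k := by
  have : (∮ z in C(0, ρ), z ^ (-k - 1) * g z) = ∮ z in C(0, ρ), z ^ (-k - 1) * h z :=
    circleIntegral.integral_congr hρ.le fun z hz => by
      simp only [hgh z (by simpa using hz)]
  rw [laurentCoeff, laurentCoeff, this]

/-- Multiplication by the generating function acts on coefficients by convolution. -/
theorem hasSum_laurentCoeff_conv (hν0 : ∀ l, 0 ≤ ν l)
    (hsum : Summable fun l : ℤ => ν l * Real.exp (t₁ * l) + ν l * Real.exp (-t₁ * l))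
    {g : ℂ → ℂ} {s : ℝ} (hs : |s| < t₁) (hg : ContinuousOn g (Metric.sphere 0 (Real.exp s)))
    (k : ℤ) : HasSum (fun l => (ν l : ℂ) * laurentCoeff g (Real.exp s) (k - l))
      (laurentCoeff (fun z => genFun ν z * g z) (Real.exp s) k) := by
  set ρ := Real.exp s with hρdef
  have hρ : 0 < ρ := Real.exp_pos s
  have hz0 : ∀ z ∈ Metric.sphere (0 : ℂ) ρ, z ≠ 0 := by
    rintro z hz rfl
    simp [hρ.ne] at hz
  obtain ⟨M, hM⟩ : ∃ M, ∀ z ∈ Metric.sphere (0 : ℂ) ρ, ‖z ^ (-k - 1) * g z‖ ≤ M :=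
    (isCompact_sphere 0 ρ).exists_bound_of_continuousOn
      ((continuousOn_id.zpow₀ _ fun z hz => Or.inl (hz0 z hz)).mul hg)
  have hcont : ∀ l : ℤ, ContinuousOn (fun z : ℂ => (ν l : ℂ) * z ^ l * (z ^ (-k - 1) * g z))
      (Metric.sphere 0 ρ) := fun l =>
    (continuousOn_const.mul (continuousOn_id.zpow₀ _ fun z hz => Or.inl (hz0 z hz))).mul
      ((continuousOn_id.zpow₀ _ fun z hz => Or.inl (hz0 z hz)).mul hg)
  have hunif := tendstoUniformlyOn_tsum (hsum.mul_right M) (s := Metric.sphere (0 : ℂ) ρ)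
    (f := fun (l : ℤ) (z : ℂ) => (ν l : ℂ) * z ^ l * (z ^ (-k - 1) * g z)) fun l z hz => by
      rw [norm_mul]
      exact mul_le_mul (norm_genFun_term_le hν0 l
        (mem_expAnnulus_of_norm_eq_exp hs (by simpa using hz))) (hM z hz) (norm_nonneg _)
        (by have := hν0 l; positivity)
  have hlim := hunif.tendsto_circleIntegral_of_continuousOn hρ.le
    (Eventually.of_forall fun F => continuousOn_finsetSum _ fun l _ => hcont l)
  have hlim2 := hlim.const_smul (2 * Real.pi * Complex.I : ℂ)⁻¹
  have e1 : ∀ F : Finset ℤ, (2 * Real.pi * Complex.I : ℂ)⁻¹ •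
      (∮ z in C(0, ρ), ∑ l ∈ F, (ν l : ℂ) * z ^ l * (z ^ (-k - 1) * g z))
      = ∑ l ∈ F, (ν l : ℂ) * laurentCoeff g ρ (k - l) := by
    intro F
    rw [circleIntegral.integral_fun_sum fun l _ => (hcont l).circleIntegrable hρ.le,
      Finset.smul_sum]
    refine Finset.sum_congr rfl fun l _ => ?_
    rw [laurentCoeff, smul_eq_mul, smul_eq_mul, mul_left_comm,
      ← circleIntegral.integral_const_mul (a := (ν l : ℂ))]
    refine congrArg _ (circleIntegral.integral_congr hρ.le fun z hz => ?_)
    have : z ^ (-(k - l) - 1) = z ^ l * z ^ (-k - 1) := by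
      rw [← zpow_add₀ (hz0 z hz)]; congr 1; ring
    simp only [this]
    ring
  simp_rw [e1] at hlim2
  have e2 : laurentCoeff (fun z => genFun ν z * g z) ρ k = (2 * Real.pi * Complex.I : ℂ)⁻¹ •
      ∮ z in C(0, ρ), ∑' l, (ν l : ℂ) * z ^ l * (z ^ (-k - 1) * g z) := by
    rw [laurentCoeff]
    congr 1
    refine circleIntegral.integral_congr hρ.le fun z _ => ?_
    simp only [tsum_mul_right, genFun]
    ring
  rw [e2]
  exact hlim2

/-- Coefficients of `1 / (1 - z)` in the unit disc. -/
theorem laurentCoeff_geometric {s : ℝ} (hs : s < 0) (k : ℤ) :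
    laurentCoeff (fun z => (1 - z)⁻¹) (Real.exp s) k = if 0 ≤ k then 1 else 0 := by
  set ρ := Real.exp s with hρdef
  have hρ : 0 < ρ := Real.exp_pos s
  have hρ1 : ρ < 1 := Real.exp_lt_one_iff.2 hs
  have hne : ∀ z : ℂ, ‖z‖ = ρ → 1 - z ≠ 0 := by
    intro z hz h
    rw [← sub_eq_zero.1 h] at hz
    simp at hz
    linarith
  have hz0 : ∀ z : ℂ, ‖z‖ = ρ → z ≠ 0 := by
    rintro z hz rfl
    simp [hρ.ne] at hz
  have hc1 : ContinuousOn (fun z : ℂ => (1 - z)⁻¹) (Metric.sphere 0 ρ) :=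
    (continuousOn_const.sub continuousOn_id).inv₀ fun z hz => hne z (by simpa using hz)
  have hc2 : ContinuousOn (fun z : ℂ => z * (1 - z)⁻¹) (Metric.sphere 0 ρ) := continuousOn_id.mul hc1
  -- The identity `(1 - z)⁻¹ - z (1 - z)⁻¹ = 1`, read on coefficients.
  have hstep : ∀ k : ℤ, laurentCoeff (fun z => (1 - z)⁻¹) ρ k
      = laurentCoeff (fun z => (1 - z)⁻¹) ρ (k - 1) + if k = 0 then 1 else 0 := by
    intro k
    rw [← laurentCoeff_one hρ k, ← sub_eq_iff_eq_add']
    have h1 : laurentCoeff (fun z => (1 - z)⁻¹) ρ (k - 1)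
        = laurentCoeff (fun z => z * (1 - z)⁻¹) ρ k := by
      rw [laurentCoeff, laurentCoeff]
      congr 1
      refine circleIntegral.integral_congr hρ.le fun z hz => ?_
      have : z ^ (-(k - 1) - 1) = z ^ (-k - 1) * z := by
        rw [← zpow_add_one₀ (hz0 z (by simpa using hz))]; congr 1; ring
      simp only [this, mul_assoc]
    rw [h1, ← laurentCoeff_sub hρ hc1 hc2]
    refine laurentCoeff_congr hρ (fun z hz => ?_) k
    have := hne z hz
    field_simp
  -- By the recursion all coefficients of negative index are equal, and Cauchy's estimate at index
  -- `k - n` tends to `0` with `n` because `s < 0`.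
  have hneg : ∀ k : ℤ, k < 0 → laurentCoeff (fun z => (1 - z)⁻¹) ρ k = 0 := by
    intro k hk
    have hconst : ∀ n : ℕ, laurentCoeff (fun z => (1 - z)⁻¹) ρ (k - n)
        = laurentCoeff (fun z => (1 - z)⁻¹) ρ k := by
      intro n
      induction n with
      | zero => simp
      | succ n ih =>
        have := hstep (k - n)
        rw [if_neg (by omega), add_zero, ih] at this
        rw [this]
        push_cast
        congr 1
        ring
    obtain ⟨M, hM⟩ := (isCompact_sphere (0 : ℂ) ρ).exists_bound_of_continuousOn hc1
    have hbd : ∀ n : ℕ, ‖laurentCoeff (fun z => (1 - z)⁻¹) ρ k‖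
        ≤ M * Real.exp (-s * k) * Real.exp s ^ n := by
      intro n
      rw [← hconst n, mul_assoc, ← Real.exp_nat_mul, ← Real.exp_add]
      refine (norm_laurentCoeff_le (fun z hz => hM z (by simpa using hz)) (k - n)).trans
        (le_of_eq ?_)
      congr 2
      push_cast
      ring
    have hlim : Tendsto (fun n : ℕ => M * Real.exp (-s * k) * Real.exp s ^ n) atTop (𝓝 0) := by
      have := (tendsto_pow_atTop_nhds_zero_of_lt_one hρ.le hρ1).const_mul (M * Real.exp (-s * k))
      rwa [mul_zero] at this
    exact norm_le_zero_iff.1 (ge_of_tendsto' hlim hbd)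
  split_ifs with hk
  · obtain ⟨n, rfl⟩ := Int.eq_ofNat_of_zero_le hk
    induction n with
    | zero => rw [hstep, hneg _ (by simp)]; simp
    | succ n ih =>
      rw [hstep, if_neg (by omega), add_zero]
      push_cast
      rw [add_sub_cancel_right]
      exact ih (by omega)
  · exact hneg k (by omega)

/-- Cauchy's theorem in the annulus. Moving the contour across the unit circle turns growth on one
side of `ℤ` into decay on the other. -/
theorem laurentCoeff_eq_of_differentiableOn {g : ℂ → ℂ} {τ s : ℝ} (hs : 0 < s) (hsτ : s < τ)
    (hg : DifferentiableOn ℂ g (expAnnulus τ)) (k : ℤ) :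
    laurentCoeff g (Real.exp s) k = laurentCoeff g (Real.exp (-s)) k := by
  rw [laurentCoeff, laurentCoeff]
  congr 1
  have hd : ∀ z ∈ Metric.closedBall (0 : ℂ) (Real.exp s) \ Metric.ball 0 (Real.exp (-s)),
      DifferentiableAt ℂ (fun z : ℂ => z ^ (-k - 1) * g z) z := by
    intro z hz
    simp only [Set.mem_sdiff, mem_closedBall_zero_iff, mem_ball_zero_iff, not_lt] at hz
    have hzA : z ∈ expAnnulus τ :=
      ⟨(Real.exp_lt_exp.2 (neg_lt_neg hsτ)).trans_le hz.2, hz.1.trans_lt (Real.exp_lt_exp.2 hsτ)⟩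
    exact (differentiableAt_zpow.2 (Or.inl (ne_zero_of_mem_expAnnulus hzA))).mul
      (hg.differentiableAt ((isOpen_expAnnulus τ).mem_nhds hzA))
  refine Complex.circleIntegral_eq_of_differentiable_on_annulus_off_countable (Real.exp_pos _)
    (Real.exp_le_exp.2 (by linarith)) Set.countable_empty
    (fun z hz => (hd z hz).continuousAt.continuousWithinAt) fun z hz => hd z ?_
  simp only [Set.mem_sdiff, mem_closedBall_zero_iff, mem_ball_zero_iff, not_lt, not_le,
    Set.mem_empty_iff_false, not_false_eq_true, and_true] at hz ⊢
  exact ⟨hz.1.le, hz.2.le⟩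

/-- A function without zeros on the unit circle has none on a neighbouring annulus. -/
theorem exists_expAnnulus_ne_zero {T : ℂ → ℂ} (ht : 0 < t₁) (hT : ContinuousOn T (expAnnulus t₁))
    (h : ∀ z : ℂ, ‖z‖ = 1 → T z ≠ 0) : ∃ τ, 0 < τ ∧ τ ≤ t₁ ∧ ∀ z ∈ expAnnulus τ, T z ≠ 0 := by
  set A : Set ℂ := {z | Real.exp (-(t₁ / 2)) ≤ ‖z‖ ∧ ‖z‖ ≤ Real.exp (t₁ / 2)} with hA
  have hAc : IsCompact A := by
    refine Metric.isCompact_of_isClosed_isBounded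
      ((isClosed_le continuous_const continuous_norm).inter
        (isClosed_le continuous_norm continuous_const)) ?_
    exact (Metric.isBounded_closedBall (x := (0 : ℂ)) (r := Real.exp (t₁ / 2))).subset
      fun z hz => by simpa using hz.2
  have hAsub : A ⊆ expAnnulus t₁ := fun z hz =>
    ⟨(Real.exp_lt_exp.2 (by linarith)).trans_le hz.1,
      hz.2.trans_lt (Real.exp_lt_exp.2 (by linarith))⟩
  have hZ : IsCompact (A ∩ T ⁻¹' {0}) :=
    hAc.of_isClosed_subset ((hT.mono hAsub).preimage_isClosed_of_isClosed hAc.isClosed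
      isClosed_singleton) Set.inter_subset_left
  have hsub : ∀ τ ≤ t₁ / 2, expAnnulus τ ⊆ A := fun τ hτ z hz =>
    ⟨(Real.exp_le_exp.2 (neg_le_neg hτ)).trans hz.1.le, hz.2.le.trans (Real.exp_le_exp.2 hτ)⟩
  rcases (A ∩ T ⁻¹' {0}).eq_empty_or_nonempty with hE | hne
  · refine ⟨t₁ / 2, by positivity, by linarith, fun z hz h0 => ?_⟩
    exact Set.notMem_empty z (hE ▸ ⟨hsub _ le_rfl hz, h0⟩)
  · have hlog : ContinuousOn (fun z : ℂ => |Real.log ‖z‖|) (A ∩ T ⁻¹' {0}) := by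
      refine (ContinuousOn.log continuous_norm.continuousOn fun z hz => ?_).abs
      exact norm_ne_zero_iff.2 (ne_zero_of_mem_expAnnulus (hAsub hz.1))
    -- The zero nearest to the unit circle, as measured by `|log ‖z‖|`, limits the width of the
    -- zero-free annulus.
    obtain ⟨z₀, hz₀, hmin⟩ := hZ.exists_isMinOn hne hlog
    have hz₀pos : 0 < ‖z₀‖ := norm_pos_iff.2 (ne_zero_of_mem_expAnnulus (hAsub hz₀.1))
    have hpos : 0 < |Real.log ‖z₀‖| := by
      refine abs_pos.2 fun h0 => h z₀ ?_ hz₀.2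
      exact Real.eq_one_of_pos_of_log_eq_zero hz₀pos h0
    refine ⟨min (t₁ / 2) |Real.log ‖z₀‖|, lt_min (by positivity) hpos,
      (min_le_left _ _).trans (by linarith), fun z hz h0 => ?_⟩
    have hzA := hsub _ (min_le_left _ _) hz
    have h1 := hmin ⟨hzA, h0⟩
    have h1 : |Real.log ‖z₀‖| ≤ |Real.log ‖z‖| := h1
    have h2 : |Real.log ‖z‖| < |Real.log ‖z₀‖| := by
      have hzpos : 0 < ‖z‖ := norm_pos_iff.2 (ne_zero_of_mem_expAnnulus hz)
      rw [abs_lt]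
      refine ⟨?_, ?_⟩
      · rw [Real.lt_log_iff_exp_lt hzpos]
        exact (Real.exp_le_exp.2 (neg_le_neg (min_le_right _ _))).trans_lt hz.1
      · rw [Real.log_lt_iff_lt_exp hzpos]
        exact hz.2.trans_le (Real.exp_le_exp.2 (min_le_right _ _))
    linarith

/-- **Renewal theorem with exponential rate**: an aperiodic law `ν` on `ℤ` with exponential moments
and positive mean `m` has a renewal sequence which tends to `1 / m` exponentially fast at `+∞`,
and to `0` exponentially fast at `-∞`. -/
theorem exists_renewal_sequence (hν0 : ∀ l, 0 ≤ ν l) (hν1 : HasSum ν 1) (ht : 0 < t₁)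
    (hsum : Summable fun l : ℤ => ν l * Real.exp (t₁ * l) + ν l * Real.exp (-t₁ * l))
    (hm : HasSum (fun l : ℤ => ν l * l) m) (hm0 : 0 < m)
    (haper : ∀ z : ℂ, ‖z‖ = 1 → genFun ν z = 1 → z = 1) :
    ∃ (U : ℤ → ℝ) (C t₂ : ℝ), 0 < t₂ ∧ 0 < C ∧
      (∀ k, HasSum (fun l => ν l * U (k - l)) (U k - if k = 0 then 1 else 0)) ∧
      (∀ k, |U k - 1 / m| ≤ C * Real.exp (-t₂ * k)) ∧ ∀ k, |U k| ≤ C * Real.exp (t₂ * k) := by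
  have h1mem : ∀ {τ : ℝ}, 0 < τ → expAnnulus τ ∈ 𝓝 (1 : ℂ) := fun hτ =>
    (isOpen_expAnnulus _).mem_nhds (one_mem_expAnnulus hτ)
  have hφd := differentiableOn_genFun hν0 hsum
  have hφ1 : genFun ν 1 = 1 := by
    simp only [genFun, one_zpow, mul_one]
    exact_mod_cast (Complex.hasSum_ofReal.2 hν1).tsum_eq
  have hφ' := hasDerivAt_genFun hν0 ht hsum hm
  set T : ℂ → ℂ := dslope (fun z => 1 - genFun ν z) 1 with hT
  have hTd : DifferentiableOn ℂ T (expAnnulus t₁) :=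
    (Complex.differentiableOn_dslope (h1mem ht)).2 (hφd.const_sub 1)
  have hTmul : ∀ z, (z - 1) * T z = 1 - genFun ν z := by
    intro z
    have := sub_smul_dslope (fun z => 1 - genFun ν z) 1 z
    simpa [hφ1] using this
  have hT1 : T 1 = -m := by
    rw [hT, dslope_same]
    exact (hφ'.const_sub 1).deriv
  have hmC : (m : ℂ) ≠ 0 := by exact_mod_cast hm0.ne'
  have hT0 : ∀ z : ℂ, ‖z‖ = 1 → T z ≠ 0 := by
    intro z hz h0
    have h := hTmul z
    rw [h0, mul_zero, eq_comm, sub_eq_zero] at h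
    have hz1 := haper z hz h.symm
    subst hz1
    rw [hT1] at h0
    exact hmC (neg_eq_zero.1 h0)
  obtain ⟨τ, hτ, hτt, hTne⟩ := exists_expAnnulus_ne_zero ht hTd.continuousOn hT0
  set Q : ℂ → ℂ := fun z => (T z)⁻¹ with hQ
  have hQd : DifferentiableOn ℂ Q (expAnnulus τ) := (hTd.mono (expAnnulus_mono hτt)).inv hTne
  -- `B` is `(1 - genFun ν)⁻¹` minus its polar part `m⁻¹ (1 - z)⁻¹`, so it is holomorphic on the
  -- whole annulus.
  set B : ℂ → ℂ := dslope Q 1 with hB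
  have hBd : DifferentiableOn ℂ B (expAnnulus τ) :=
    (Complex.differentiableOn_dslope (h1mem hτ)).2 hQd
  have hBmul : ∀ z, (z - 1) * B z = Q z + (m : ℂ)⁻¹ := by
    intro z
    have := sub_smul_dslope Q 1 z
    rw [smul_eq_mul] at this
    rw [hB, this, hQ]
    simp only [hT1, inv_neg, sub_neg_eq_add]
  have hinv : ∀ z ∈ expAnnulus τ, z ≠ 1 → 1 - genFun ν z ≠ 0 ∧
      (1 - genFun ν z)⁻¹ = B z - (-((m : ℂ)⁻¹ * (1 - z)⁻¹)) := by
    intro z hz hz1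
    have h1 : z - 1 ≠ 0 := sub_ne_zero.2 hz1
    have h2 := hTne z hz
    have h3 : 1 - genFun ν z ≠ 0 := by rw [← hTmul]; exact mul_ne_zero h1 h2
    refine ⟨h3, ?_⟩
    have h4 : B z = (z - 1)⁻¹ * (Q z + (m : ℂ)⁻¹) := by
      rw [← hBmul, inv_mul_cancel_left₀ h1]
    rw [h4, ← hTmul, mul_inv, hQ]
    have h5 : (1 - z)⁻¹ = -(z - 1)⁻¹ := by rw [← inv_neg, neg_sub]
    rw [h5]
    ring
  set t₂ := τ / 2 with ht₂
  have ht₂0 : 0 < t₂ := by positivity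
  have hcirc : ∀ z : ℂ, ‖z‖ = Real.exp (-t₂) → z ∈ expAnnulus τ ∧ z ≠ 1 := by
    intro z hz
    refine ⟨mem_expAnnulus_of_norm_eq_exp (s := -t₂) (by rw [abs_neg, abs_of_pos ht₂0]; linarith)
      hz, ?_⟩
    rintro rfl
    rw [norm_one] at hz
    have := Real.exp_lt_one_iff.2 (neg_lt_zero.2 ht₂0)
    linarith
  set ρ := Real.exp (-t₂) with hρdef
  have hρ : 0 < ρ := Real.exp_pos _
  set g : ℂ → ℂ := fun z => (1 - genFun ν z)⁻¹ with hg
  have hφc : ContinuousOn (genFun ν) (Metric.sphere 0 ρ) := fun z hz =>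
    (hφd.continuousOn z (expAnnulus_mono hτt (hcirc z (by simpa using hz)).1)).mono fun w hw =>
      expAnnulus_mono hτt (hcirc w (by simpa using hw)).1
  have hgc : ContinuousOn g (Metric.sphere 0 ρ) :=
    (continuousOn_const.sub hφc).inv₀ fun z hz =>
      (hinv z (hcirc z (by simpa using hz)).1 (hcirc z (by simpa using hz)).2).1
  have hBc : ContinuousOn B (Metric.sphere 0 ρ) := hBd.continuousOn.mono fun w hw =>
    (hcirc w (by simpa using hw)).1
  -- On a circle inside the unit disc the polar part expands in nonnegative powers: it contributes
  -- `1 / m` for `k ≥ 0` and nothing for `k < 0`.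
  set u : ℤ → ℂ := laurentCoeff g ρ with hu
  have hrenew : ∀ k, HasSum (fun l => (ν l : ℂ) * u (k - l)) (u k - if k = 0 then 1 else 0) := by
    intro k
    have h1 := hasSum_laurentCoeff_conv (s := -t₂) hν0 hsum
      (by rw [abs_neg, abs_of_pos ht₂0]; linarith) hgc k
    convert h1 using 1
    rw [← laurentCoeff_one hρ k, hu, ← laurentCoeff_sub hρ hgc continuousOn_const]
    refine laurentCoeff_congr hρ (fun z hz => ?_) k
    have h3 := (hinv z (hcirc z hz).1 (hcirc z hz).2).1
    simp only [hg]
    field_simp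
    ring
  have hsplit : ∀ k, u k = laurentCoeff B ρ k + if 0 ≤ k then (m : ℂ)⁻¹ else 0 := by
    intro k
    have hgeo := laurentCoeff_geometric (s := -t₂) (neg_lt_zero.2 ht₂0) k
    have hcz : ContinuousOn (fun z : ℂ => -((m : ℂ)⁻¹ * (1 - z)⁻¹)) (Metric.sphere 0 ρ) := by
      refine (continuousOn_const.mul ((continuousOn_const.sub continuousOn_id).inv₀ ?_)).neg
      intro z hz
      exact sub_ne_zero.2 (hcirc z (by simpa using hz)).2.symm
    rw [hu, laurentCoeff_congr hρ (fun z hz => (hinv z (hcirc z hz).1 (hcirc z hz).2).2) k,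
      laurentCoeff_sub hρ hBc hcz, sub_eq_add_neg]
    congr 1
    have : laurentCoeff (fun z => -((m : ℂ)⁻¹ * (1 - z)⁻¹)) ρ k
        = -((m : ℂ)⁻¹ * laurentCoeff (fun z => (1 - z)⁻¹) ρ k) := by
      rw [laurentCoeff, laurentCoeff, smul_eq_mul, smul_eq_mul, mul_left_comm, ← mul_neg,
        ← neg_mul, ← circleIntegral.integral_const_mul (a := -(m : ℂ)⁻¹)]
      congr 2
      funext z
      ring
    rw [this, neg_neg, hgeo]
    split_ifs <;> simp
  obtain ⟨C₁, hC₁⟩ := (isCompact_sphere (0 : ℂ) ρ).exists_bound_of_continuousOn hBc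
  obtain ⟨C₂, hC₂⟩ := (isCompact_sphere (0 : ℂ) (Real.exp t₂)).exists_bound_of_continuousOn
    (hBd.continuousOn.mono fun w hw => mem_expAnnulus_of_norm_eq_exp (s := t₂)
      (by rw [abs_of_pos ht₂0]; linarith) (by simpa using hw))
  have hb1 : ∀ k : ℤ, ‖laurentCoeff B ρ k‖ ≤ C₁ * Real.exp (t₂ * k) := by
    intro k
    have := norm_laurentCoeff_le (g := B) (s := -t₂) (fun z hz => hC₁ z (by simpa using hz)) k
    rwa [neg_neg] at this
  -- The holomorphic part allows the contour to be moved outside the unit disc, which gives the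
  -- decay at `+∞`.
  have hb2 : ∀ k : ℤ, ‖laurentCoeff B ρ k‖ ≤ C₂ * Real.exp (-t₂ * k) := by
    intro k
    rw [hρdef, ← laurentCoeff_eq_of_differentiableOn ht₂0 (by linarith) hBd k]
    exact norm_laurentCoeff_le (g := B) (s := t₂) (fun z hz => hC₂ z (by simpa using hz)) k
  have hC₁0 : 0 ≤ C₁ := by
    have := (norm_nonneg _).trans (hb1 0); simpa using this
  have hC₂0 : 0 ≤ C₂ := by
    have := (norm_nonneg _).trans (hb2 0); simpa using this
  have hre : ∀ k, (u k).re = (laurentCoeff B ρ k).re + if 0 ≤ k then 1 / m else 0 := by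
    intro k
    rw [hsplit, Complex.add_re]
    congr 1
    split_ifs
    · rw [← Complex.ofReal_inv, Complex.ofReal_re, one_div]
    · simp
  have hm' : 0 < 1 / m := by positivity
  refine ⟨fun k => (u k).re, C₁ + C₂ + 1 / m, t₂, ht₂0, by positivity, fun k => ?_, fun k => ?_,
    fun k => ?_⟩
  · have := Complex.hasSum_re (hrenew k)
    convert this using 1
    · funext l; simp
    · rw [Complex.sub_re]; split_ifs <;> simp
  · have h1 := (Complex.abs_re_le_norm _).trans (hb2 k)
    have he := Real.exp_pos (-t₂ * k)
    change |(u k).re - 1 / m| ≤ _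
    rw [hre]
    split_ifs with hk
    · rw [add_sub_cancel_right]
      nlinarith
    · have hk' : (k : ℝ) < 0 := by exact_mod_cast not_le.1 hk
      have he1 : 1 ≤ Real.exp (-t₂ * k) := Real.one_le_exp (by nlinarith)
      rw [add_zero]
      refine (abs_sub _ _).trans ?_
      rw [abs_of_pos hm']
      nlinarith
  · have h1 := (Complex.abs_re_le_norm _).trans (hb1 k)
    have he := Real.exp_pos (t₂ * k)
    simp only [hre]
    split_ifs with hk
    · have hk' : (0 : ℝ) ≤ k := by exact_mod_cast hk
      have he1 : 1 ≤ Real.exp (t₂ * k) := Real.one_le_exp (by positivity)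
      refine (abs_add_le _ _).trans ?_
      rw [abs_of_pos hm']
      nlinarith
    · rw [add_zero]
      nlinarith

end Renewal

/-! ## Mixtures of measures -/

/-- Extends a disintegration identity from nonnegative functions to Bochner integrals. It serves for
the first-step decomposition of return laws and for stationarity. -/
theorem integral_mixture {α β E : Type*} [MeasurableSpace α] [Countable α]
    [MeasurableSingletonClass α] [MeasurableSpace β] [Countable β] [MeasurableSingletonClass β]
    [NormedAddCommGroup E] [NormedSpace ℝ E] {μ : Measure α}
    {κ : α → Measure β} {ν : Measure β} [IsFiniteMeasure μ] [∀ a, IsProbabilityMeasure (κ a)]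
    (hν : ∀ f : β → ℝ≥0∞, ∫⁻ b, f b ∂ν = ∫⁻ a, ∫⁻ b, f b ∂κ a ∂μ)
    {f : β → E} (hf : Integrable f ν) :
    (∀ᵐ a ∂μ, Integrable f (κ a)) ∧ Integrable (fun a => ∫ b, f b ∂κ a) μ ∧
      ∫ b, f b ∂ν = ∫ a, ∫ b, f b ∂κ a ∂μ := by
  set K : Kernel α β := Kernel.ofFunOfCountable κ with hK
  have : IsMarkovKernel K := ⟨fun a => inferInstanceAs (IsProbabilityMeasure (κ a))⟩
  have hcomp : ν = (K ∘ₖ Kernel.const Unit μ) () := by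
    ext s hs
    rw [Kernel.comp_apply' _ _ _ hs, ← lintegral_indicator_one hs, hν]
    refine lintegral_congr fun a => ?_
    rw [lintegral_indicator_one hs]
    rfl
  rw [hcomp] at hf
  refine ⟨?_, ?_, ?_⟩
  · exact hf.ae_of_comp
  · exact hf.integral_comp
  · rw [hcomp, Kernel.integral_comp hf]
    simp [hK, Kernel.ofFunOfCountable]

theorem PMF.ae_iff_forall {α : Type*} [MeasurableSpace α] [Countable α]
    [MeasurableSingletonClass α] (q : PMF α) {P : α → Prop} :
    (∀ᵐ a ∂q.toMeasure, P a) ↔ ∀ a, q a ≠ 0 → P a := by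
  rw [ae_iff_of_countable]
  refine forall_congr' fun a => ?_
  rw [PMF.toMeasure_apply_singleton _ _ (measurableSet_singleton a)]

/-- Equality case of the triangle inequality for an average of points of the unit disc. -/
theorem PMF.eq_one_of_integral_eq_one {α : Type*} [MeasurableSpace α] [Countable α]
    [MeasurableSingletonClass α] (q : PMF α) {g : α → ℂ} (hg : ∀ a, ‖g a‖ ≤ 1)
    (h : ∫ a, g a ∂q.toMeasure = 1) (a : α) (ha : q a ≠ 0) : g a = 1 := by
  have hint : Integrable g q.toMeasure :=
    Integrable.of_bound (measurable_of_countable g).aestronglyMeasurable 1 (ae_of_all _ hg)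
  have hre : ∀ a, (g a).re ≤ 1 := fun a => (Complex.re_le_norm _).trans (hg a)
  have hre1 : ∫ a, (g a).re ∂q.toMeasure = 1 := by
    have := integral_re hint
    simp only [RCLike.re_to_complex] at this
    rw [this, h, Complex.one_re]
  have hintre : Integrable (fun a => (g a).re) q.toMeasure := hint.re
  have h0 : ∫ a, (1 - (g a).re) ∂q.toMeasure = 0 := by
    rw [integral_sub (integrable_const _) hintre, hre1]
    simp
  rw [integral_eq_zero_iff_of_nonneg (fun a => sub_nonneg.2 (hre a))
    ((integrable_const _).sub hintre)] at h0
  have h1 := q.ae_iff_forall.1 h0 a ha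
  have h2 : (g a).re = 1 := by
    simp only [Pi.zero_apply] at h1
    linarith
  have h3 := hg a
  have h4 : (g a).re ^ 2 + (g a).im ^ 2 ≤ 1 := by
    rw [← Complex.sq_norm_sub_sq_re, h2] 
    nlinarith [norm_nonneg (g a)]
  refine Complex.ext h2 ?_
  rw [Complex.one_im]
  nlinarith

/-! ## Return laws as measures -/

section HitMeasure

variable {p : ℕ → PMF (ℤ × ℤ)} {k : ℕ}

/-- Law of the vertical displacement until the first return to column `i`. -/
def hitMeasure (p : ℕ → PMF (ℤ × ℤ)) (i x : ℕ) : Measure ℤ :=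
  Measure.sum fun l => hitLaw p i x l • Measure.dirac l

/-- Law of the vertical displacement until the first visit to column `i`. -/
def hitMeasure₀ (p : ℕ → PMF (ℤ × ℤ)) (i x : ℕ) : Measure ℤ :=
  Measure.sum fun l => hitLaw₀ p i x l • Measure.dirac l

theorem lintegral_hitMeasure (i x : ℕ) (f : ℤ → ℝ≥0∞) :
    ∫⁻ l, f l ∂hitMeasure p i x = ∑' l, hitLaw p i x l * f l := by
  simp [hitMeasure, lintegral_sum_measure]

theorem lintegral_hitMeasure₀ (i x : ℕ) (f : ℤ → ℝ≥0∞) :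
    ∫⁻ l, f l ∂hitMeasure₀ p i x = ∑' l, hitLaw₀ p i x l * f l := by
  simp [hitMeasure₀, lintegral_sum_measure]

theorem hitMeasure₀_of_ne {i x : ℕ} (h : x ≠ i) : hitMeasure₀ p i x = hitMeasure p i x := by
  simp [hitMeasure₀, hitMeasure, hitLaw₀, h]

theorem hitMeasure₀_self (i : ℕ) : hitMeasure₀ p i i = Measure.dirac 0 := by
  ext s hs
  rw [← lintegral_indicator_one hs, lintegral_hitMeasure₀, tsum_eq_single 0 fun l hl => by
    simp [hitLaw₀, hl], ← lintegral_indicator_one hs, lintegral_dirac]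
  simp [hitLaw₀]

theorem hitMeasure_real_singleton (i x : ℕ) (l : ℤ) :
    (hitMeasure p i x).real {l} = (hitLaw p i x l).toReal := by
  rw [measureReal_def, ← lintegral_indicator_one (measurableSet_singleton l), lintegral_hitMeasure,
    tsum_eq_single l fun l' hl' => by simp [hl']]
  simp

theorem StripWalk.isProbabilityMeasure_hitMeasure (h : StripWalk p k) (i x : ℕ) :
    IsProbabilityMeasure (hitMeasure p i x) := ⟨by
  rw [← lintegral_one, lintegral_hitMeasure]
  simp [h.tsum_hitLaw]⟩

theorem StripWalk.isProbabilityMeasure_hitMeasure₀ (h : StripWalk p k) (i x : ℕ) :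
    IsProbabilityMeasure (hitMeasure₀ p i x) := ⟨by
  rw [← lintegral_one, lintegral_hitMeasure₀]
  simp [h.tsum_hitLaw₀]⟩

/-- First step decomposition of integrals against the return law. -/
theorem StripWalk.integral_hitMeasure {E : Type*} [NormedAddCommGroup E] [NormedSpace ℝ E]
    (h : StripWalk p k) (i x : ℕ) {f : ℤ → E} (hf : Integrable f (hitMeasure p i x)) :
    Integrable (fun d : ℤ × ℤ => ∫ l, f (d.2 + l) ∂hitMeasure₀ p i (stepX x d)) (p x).toMeasure ∧
      ∫ l, f l ∂hitMeasure p i x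
        = ∫ d, ∫ l, f (d.2 + l) ∂hitMeasure₀ p i (stepX x d) ∂(p x).toMeasure := by
  have := fun x => h.isProbabilityMeasure_hitMeasure₀ i x
  let κ : ℤ × ℤ → Measure ℤ := fun d => (hitMeasure₀ p i (stepX x d)).map (d.2 + ·)
  have : ∀ d, IsProbabilityMeasure (κ d) := fun d =>
    Measure.isProbabilityMeasure_map (measurable_of_countable _).aemeasurable
  have key : ∀ g : ℤ → ℝ≥0∞,
      ∫⁻ l, g l ∂hitMeasure p i x = ∫⁻ d, ∫⁻ l, g l ∂κ d ∂(p x).toMeasure := by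
    intro g
    rw [lintegral_hitMeasure, tsum_hitLaw_mul, PMF.lintegral_eq_tsum']
    refine tsum_congr fun d => ?_
    rw [lintegral_map (measurable_of_countable _) (measurable_of_countable _),
      lintegral_hitMeasure₀]
  have hκ : ∀ d, ∫ l, f l ∂κ d = ∫ l, f (d.2 + l) ∂hitMeasure₀ p i (stepX x d) := fun d =>
    (MeasurableEquiv.addLeft d.2).measurableEmbedding.integral_map f
  obtain ⟨-, h2, h3⟩ := integral_mixture key hf
  simp only [hκ] at h2 h3
  exact ⟨h2, h3⟩

end HitMeasure

/-! ## Aperiodicity -/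

section Aperiodic

variable {p : ℕ → PMF (ℤ × ℤ)} {k : ℕ}

theorem integral_zpow_hitMeasure_self (h : StripWalk p k) (i : ℕ) {z : ℂ} (hz : ‖z‖ = 1) :
    ∫ l, z ^ l ∂hitMeasure p i i = genFun (fun l => (hitLaw p i i l).toReal) z := by
  have := h.isProbabilityMeasure_hitMeasure i i
  rw [integral_countable]
  · refine tsum_congr fun l => ?_
    rw [hitMeasure_real_singleton, Complex.real_smul]
  · exact Integrable.of_bound (measurable_of_countable _).aestronglyMeasurable 1
      (ae_of_all _ fun l => by simp [hz])

/-- The function `w(x, y) = z^y 𝔼 z^l`, with `l` the displacement from column `x` until column `i`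
is visited, is bounded by `1` and harmonic: in column `i` this is the assumption on `z`. It equals
`1` at `(i, 0)`, hence by the equality case of the triangle inequality at every reachable state. At
the reachable state `(i, 1)` its value is `z`. -/
theorem StripWalk.aperiodic (h : StripWalk p k) (i : ℕ) {z : ℂ} (hz : ‖z‖ = 1)
    (h1 : genFun (fun l => (hitLaw p i i l).toReal) z = 1) : z = 1 := by
  have := fun x => h.isProbabilityMeasure_hitMeasure i x
  have := fun x => h.isProbabilityMeasure_hitMeasure₀ i x
  have hz0 : z ≠ 0 := by rintro rfl; simp at hz
  set w : ℕ × ℤ → ℂ := fun v => z ^ v.2 * ∫ l, z ^ l ∂hitMeasure₀ p i v.1 with hw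
  have hwn : ∀ v, ‖w v‖ ≤ 1 := by
    intro v
    rw [hw, norm_mul, norm_zpow, hz, one_zpow, one_mul]
    have := norm_integral_le_of_norm_le_const (μ := hitMeasure₀ p i v.1) (f := fun l : ℤ => z ^ l)
      (C := 1) (ae_of_all _ fun l => by simp [hz])
    simpa using this
  have hharm : ∀ v, w v = ∫ d, w (stepX v.1 d, v.2 + d.2) ∂(p v.1).toMeasure := by
    intro v
    have hint : Integrable (fun l : ℤ => z ^ l) (hitMeasure p i v.1) :=
      Integrable.of_bound (measurable_of_countable _).aestronglyMeasurable 1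
        (ae_of_all _ fun l => by simp [hz])
    have e1 : ∫ l, z ^ l ∂hitMeasure₀ p i v.1 = ∫ l, z ^ l ∂hitMeasure p i v.1 := by
      by_cases hv : v.1 = i
      · rw [hv, integral_zpow_hitMeasure_self h i hz, h1, hitMeasure₀_self]
        simp
      · rw [hitMeasure₀_of_ne hv]
    have e2 := (h.integral_hitMeasure i v.1 hint).2
    simp only [hw]
    rw [e1, e2, ← integral_const_mul]
    refine integral_congr_ae (ae_of_all _ fun d => ?_)
    simp only
    rw [← integral_const_mul, ← integral_const_mul]
    refine integral_congr_ae (ae_of_all _ fun l => ?_)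
    simp only
    rw [zpow_add₀ hz0, zpow_add₀ hz0]
    ring
  have hreach : ∀ n u v, (transOp (stripChain p))^[n] (Set.indicator {v} 1) u ≠ 0 →
      w u = 1 → w v = 1 := by
    intro n
    induction n with
    | zero =>
      intro u v huv hu
      have : u = v := by
        by_contra hne
        simp [hne] at huv
      rwa [← this]
    | succ n ih =>
      intro u v huv hu
      rw [Function.iterate_succ_apply', transOp_stripChain, Ne, ENNReal.tsum_eq_zero,
        not_forall] at huv
      obtain ⟨d, hd⟩ := huv
      rw [mul_eq_zero, not_or] at hd
      refine ih _ v hd.2 ?_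
      refine (p u.1).eq_one_of_integral_eq_one (g := fun d => w (stepX u.1 d, u.2 + d.2))
        (fun d => hwn _) ?_ d hd.1
      rw [← hharm u, hu]
  obtain ⟨n, hn⟩ := (isIrreducibleChain_iff _).1 h.irreducible (i, 0) (i, 1)
  have := hreach n _ _ hn.ne' (by simp [hw, hitMeasure₀_self])
  simpa [hw, hitMeasure₀_self] using this

end Aperiodic

/-! ## Invariant distributions of the column chain -/

section Invariant

variable {p : ℕ → PMF (ℤ × ℤ)} {k : ℕ} {π : PMF ℕ}

/-- The first coordinate of the walk on the strip. -/
def columnChain (p : ℕ → PMF (ℤ × ℤ)) (x : ℕ) : PMF ℕ := (p x).map (stepX x)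

theorem tsum_invariant (hπ : IsInvariantDistribution (columnChain p) π) (g : ℕ → ℝ≥0∞) :
    ∑' x, π x * ∑' d, p x d * g (stepX x d) = ∑' x, π x * g x := by
  have h1 : ∀ x, ∑' d, p x d * g (stepX x d) = ∑' y, columnChain p x y * g y := fun x =>
    (PMF.tsum_map_mul _ _ _).symm
  simp_rw [h1, ← ENNReal.tsum_mul_left]
  rw [ENNReal.tsum_comm]
  refine tsum_congr fun y => ?_
  rw [← hπ y, ← ENNReal.tsum_mul_right]
  exact tsum_congr fun x => by ring

theorem tsum_invariant_killed (hπ : IsInvariantDistribution (columnChain p) π) (i : ℕ)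
    (g : ℕ → ℝ≥0∞) :
    ∑' x, π x * g x = π i * g i + ∑' x, π x * killedOp p i 0 g x := by
  have h1 := tsum_invariant hπ fun y => if y = i then 0 else g y
  have h2 : ∑' x, π x * killedOp p i 0 g x = ∑' x, π x * if x = i then 0 else g x := by
    rw [← h1]
    refine tsum_congr fun x => ?_
    rw [killedOp]
    simp only [expWeight_zero_left, one_mul]
  have h3 : π i * g i = ∑' x, π x * if x = i then g x else 0 := by
    rw [tsum_eq_single i fun x hx => by simp [hx]]
    simp
  rw [h2, h3, ← ENNReal.tsum_add]
  refine tsum_congr fun x => ?_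
  split_ifs <;> simp

/-- The stationary chain is decomposed according to its last visit to `i` among the `n` most recent
times; the remainder collects the paths without such a visit. -/
theorem tsum_invariant_iterate (hπ : IsInvariantDistribution (columnChain p) π) (i : ℕ)
    (g : ℕ → ℝ≥0∞) (n : ℕ) :
    ∑' x, π x * g x = π i * ∑ m ∈ Finset.range n, (killedOp p i 0)^[m] g i
      + ∑' x, π x * (killedOp p i 0)^[n] g x := by
  induction n with
  | zero => simp
  | succ n ih =>
    rw [ih, tsum_invariant_killed hπ i ((killedOp p i 0)^[n] g), Finset.sum_range_succ, mul_add,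
      add_assoc]
    simp only [Function.iterate_succ_apply']

/-- For bounded `g` the remainder is at most `c` times a stationary survival probability, which
tends to `0` by dominated convergence. -/
theorem StripWalk.tsum_invariant_bounded (h : StripWalk p k)
    (hπ : IsInvariantDistribution (columnChain p) π) (i : ℕ) {g : ℕ → ℝ≥0∞} {c : ℝ≥0∞}
    (hc : c ≠ ∞) (hg : ∀ x, g x ≤ c) :
    ∑' x, π x * g x ≤ π i * ∑' n, (killedOp p i 0)^[n] g i := by
  have hlim : Tendsto (fun n => ∑' x, π x * (killedOp p i 0)^[n] 1 x) atTop (𝓝 0) := by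
    simp_rw [← PMF.lintegral_eq_tsum' π]
    have := tendsto_lintegral_of_dominated_convergence (μ := π.toMeasure)
      (F := fun n x => (killedOp p i 0)^[n] 1 x) (f := fun _ => 0) (fun _ => 1)
      (fun n => measurable_of_countable _)
      (fun n => ae_of_all _ fun x => by
        simpa using survival_antitone (p := p) (i := i) x (Nat.zero_le n))
      (by simp) (ae_of_all _ fun x => h.tendsto_survival i x)
    simpa using this
  have hlim2 : Tendsto (fun n => π i * ∑' n, (killedOp p i 0)^[n] g i
      + c * ∑' x, π x * (killedOp p i 0)^[n] 1 x) atTop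
      (𝓝 (π i * ∑' n, (killedOp p i 0)^[n] g i + c * 0)) :=
    tendsto_const_nhds.add (ENNReal.Tendsto.const_mul hlim (Or.inr hc))
  rw [mul_zero, add_zero] at hlim2
  refine ge_of_tendsto' hlim2 fun n => ?_
  rw [tsum_invariant_iterate hπ i g n, ← ENNReal.tsum_mul_left (a := c)]
  refine add_le_add (mul_le_mul_right (ENNReal.sum_le_tsum _) _)
    (ENNReal.tsum_le_tsum fun x => ?_)
  · have h1 : (killedOp p i 0)^[n] g x ≤ c * (killedOp p i 0)^[n] 1 x := by
      have := (killedOp_mono (p := p) (i := i) 0).iterate n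
        (show g ≤ c • (1 : ℕ → ℝ≥0∞) from fun y => by simpa using hg y) x
      rwa [killedOp_iterate_smul] at this
    calc _ ≤ π x * (c * (killedOp p i 0)^[n] 1 x) := by gcongr
      _ = _ := by ring

theorem StripWalk.tsum_invariant_le (h : StripWalk p k)
    (hπ : IsInvariantDistribution (columnChain p) π) (i : ℕ) {g : ℕ → ℝ≥0∞}
    (hg : ∀ x, g x ≠ ∞) :
    ∑' x, π x * g x ≤ π i * ∑' n, (killedOp p i 0)^[n] g i := by
  rw [ENNReal.tsum_eq_iSup_sum]
  refine iSup_le fun s => ?_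
  set c := ∑ x ∈ s, g x with hc
  have hctop : c ≠ ∞ := ENNReal.sum_ne_top.2 fun x _ => hg x
  calc ∑ x ∈ s, π x * g x ≤ ∑ x ∈ s, π x * min (g x) c := by
        refine Finset.sum_le_sum fun x hx => ?_
        gcongr
        exact le_min le_rfl (Finset.single_le_sum (f := g) (fun _ _ => zero_le) hx)
    _ ≤ ∑' x, π x * min (g x) c := ENNReal.sum_le_tsum _
    _ ≤ π i * ∑' n, (killedOp p i 0)^[n] (fun x => min (g x) c) i :=
        h.tsum_invariant_bounded hπ i hctop fun x => min_le_right _ _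
    _ ≤ _ := by
        gcongr with n
        exact (killedOp_mono (p := p) (i := i) 0).iterate n (fun x => min_le_left _ _) i

/-- Existence of an invariant distribution: occupation measure of an excursion. -/
theorem StripWalk.exists_invariant (h : StripWalk p k) :
    ∃ π : PMF ℕ, IsInvariantDistribution (columnChain p) π := by
  -- `pot g` is the expected sum of `g` over an excursion from column `0`, the return time excluded.
  set pot : (ℕ → ℝ≥0∞) → ℝ≥0∞ := fun g => ∑' n, (killedOp p 0 0)^[n] g 0 with hpot
  have hiter : ∀ (n : ℕ) (g : ℕ → ℝ≥0∞) (x : ℕ), (killedOp p 0 0)^[n] g x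
      = ∑' y, (killedOp p 0 0)^[n] (Set.indicator {y} 1) x * g y := by
    intro n
    induction n with
    | zero =>
      intro g x
      simp only [Function.iterate_zero, id_eq]
      rw [tsum_eq_single x fun y hy => by simp [hy.symm]]
      simp
    | succ n ih =>
      intro g x
      simp only [Function.iterate_succ_apply']
      rw [killedOp]
      simp only [killedOp, ← ENNReal.tsum_mul_right]
      rw [ENNReal.tsum_comm]
      refine tsum_congr fun d => ?_
      by_cases hd : stepX x d = 0
      · simp [hd]
      · simp only [hd, if_false]
        rw [ih g, ← ENNReal.tsum_mul_left, ← ENNReal.tsum_mul_left]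
        exact tsum_congr fun y => by ring
  set ρ : ℕ → ℝ≥0∞ := fun y => pot (Set.indicator {y} 1) with hρ
  have hpotρ : ∀ g, pot g = ∑' y, ρ y * g y := by
    intro g
    simp only [hρ, hpot, ← ENNReal.tsum_mul_right]
    rw [ENNReal.tsum_comm]
    exact tsum_congr fun n => hiter n g 0
  have hfin : pot 1 ≠ ∞ := by
    obtain ⟨ε, t₁, D, hε, ht₁, hD, -, -, hle⟩ := h.exists_potential_bound 0
    refine ne_top_of_le_ne_top (ENNReal.mul_ne_top hD (expWeight_ne_top ε (0 : ℕ)))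
      (le_trans (ENNReal.tsum_le_tsum fun n => ?_) (hle 0))
    refine (killedOp_mono 0).iterate n (fun y => ?_) 0
    rw [Pi.one_apply, ← expWeight_zero_left 0]
    exact expWeight_mono (by rw [zero_mul]; positivity)
  have hpos : pot 1 ≠ 0 := by
    have : (1 : ℝ≥0∞) ≤ pot 1 := by
      refine le_trans ?_ (ENNReal.le_tsum 0)
      simp
    exact (zero_lt_one.trans_le this).ne'
  have hstep : ∀ g : ℕ → ℝ≥0∞, pot g = g 0 + pot (killedOp p 0 0 g) := by
    intro g
    simp only [hpot]
    rw [tsum_eq_zero_add' ENNReal.summable]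
    rfl
  have hexit : pot (killedExit p 0 0) = 1 := by
    rw [← h.lap_zero 0 0, lap_eq_tsum]
  -- A shift by one step replaces the starting point of the excursion by its end point, and both lie
  -- in column `0` since the return is certain.
  have hinv : ∀ g : ℕ → ℝ≥0∞, g 0 ≠ ∞ →
      pot (fun x => ∑' d, p x d * g (stepX x d)) = pot g := by
    intro g _
    have h1 : (fun x => ∑' d, p x d * g (stepX x d))
        = (fun x => g 0 * killedExit p 0 0 x + killedOp p 0 0 g x) := by
      funext x
      rw [killedExit, killedOp, ← ENNReal.tsum_mul_left, ← ENNReal.tsum_add]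
      refine tsum_congr fun d => ?_
      by_cases hd : stepX x d = 0
      · simp [hd, expWeight_zero_left, mul_comm]
      · simp [hd, expWeight_zero_left]
    rw [h1, hpotρ]
    simp only [mul_add, ENNReal.tsum_add]
    rw [hstep g, hpotρ (killedOp p 0 0 g)]
    congr 1
    calc ∑' x, ρ x * (g 0 * killedExit p 0 0 x) = g 0 * ∑' x, ρ x * killedExit p 0 0 x := by
          rw [← ENNReal.tsum_mul_left]; exact tsum_congr fun x => by ring
      _ = g 0 := by rw [← hpotρ, hexit, mul_one]
  have hρsum : ∑' y, ρ y = pot 1 := by rw [hpotρ 1]; simp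
  refine ⟨PMF.normalize ρ (by rw [hρsum]; exact hpos) (by rw [hρsum]; exact hfin), fun y => ?_⟩
  simp only [PMF.normalize_apply]
  have h2 := hinv (Set.indicator {y} 1) (by by_cases hy : 0 = y <;> simp [hy])
  have h3 : ∀ x, ∑' d, p x d * Set.indicator {y} (1 : ℕ → ℝ≥0∞) (stepX x d)
      = columnChain p x y := by
    intro x
    have := PMF.tsum_map_mul (p x) (stepX x) (Set.indicator {y} 1)
    rw [← this, tsum_eq_single y fun y' hy' => by simp [hy']]
    simp [columnChain]
  simp_rw [h3] at h2
  rw [hpotρ] at h2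
  calc _ = (∑' x, ρ x * columnChain p x y) * (∑' x, ρ x)⁻¹ := by
        rw [← ENNReal.tsum_mul_right]; exact tsum_congr fun x => by ring
    _ = _ := by rw [h2]

/-- The cycle formula: the mean displacement over an excursion from column `i` is `V / π i`. -/
theorem StripWalk.mean_hitMeasure (h : StripWalk p k)
    (hπ : IsInvariantDistribution (columnChain p) π) (i : ℕ) :
    Integrable (fun l : ℤ => (l : ℝ)) (hitMeasure p i i) ∧
    (π i).toReal * ∫ l, (l : ℝ) ∂hitMeasure p i i
      = ∑' x, (π x).toReal * ∑' d : ℤ × ℤ, (d.2 : ℝ) * (p x d).toReal := by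
  have := fun x => h.isProbabilityMeasure_hitMeasure i x
  have := fun x => h.isProbabilityMeasure_hitMeasure₀ i x
  obtain ⟨ε, t₁, D, hε, ht₁, hD, hmom, hlap, hpot⟩ := h.exists_potential_bound i
  have habs : ∀ r : ℝ, ENNReal.ofReal |r|
      ≤ ENNReal.ofReal (1 / t₁) * (expWeight t₁ r + expWeight (-t₁) r) := by
    intro r
    rw [expWeight, expWeight, ← ENNReal.ofReal_add (by positivity) (by positivity),
      ← ENNReal.ofReal_mul (by positivity)]
    refine ENNReal.ofReal_le_ofReal ?_
    rw [one_div, inv_mul_eq_div, le_div_iff₀ ht₁]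
    rcases le_total 0 r with hr | hr
    · rw [abs_of_nonneg hr]
      have := Real.add_one_le_exp (t₁ * r)
      have := Real.exp_pos (-t₁ * r)
      linarith
    · rw [abs_of_nonpos hr]
      have := Real.add_one_le_exp (-t₁ * r)
      have := Real.exp_pos (t₁ * r)
      linarith
  set D' := ENNReal.ofReal (1 / t₁) * (D + D) with hD'
  have hD'top : D' ≠ ∞ := by finiteness
  have hA : ∀ x, ∫⁻ l, ENNReal.ofReal |(l : ℝ)| ∂hitMeasure p i x ≤ D' * expWeight ε x := by
    intro x
    calc _ ≤ ∫⁻ l : ℤ, ENNReal.ofReal (1 / t₁) * (expWeight t₁ l + expWeight (-t₁) l)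
          ∂hitMeasure p i x := lintegral_mono fun l => habs l
      _ = ENNReal.ofReal (1 / t₁) * (lap p i t₁ x + lap p i (-t₁) x) := by
          rw [lintegral_const_mul _ (measurable_of_countable _),
            lintegral_add_left (measurable_of_countable _), lintegral_hitMeasure,
            lintegral_hitMeasure]
          rfl
      _ ≤ ENNReal.ofReal (1 / t₁) * (D * expWeight ε x + D * expWeight ε x) := by
          gcongr
          · exact hlap _ (by rw [abs_of_pos ht₁]) x
          · exact hlap _ (by rw [abs_neg, abs_of_pos ht₁]) x
      _ = _ := by rw [hD']; ring
  have hint : ∀ x, Integrable (fun l : ℤ => (l : ℝ)) (hitMeasure p i x) := fun x =>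
    ⟨(measurable_of_countable _).aestronglyMeasurable, by
      rw [hasFiniteIntegral_iff_enorm]
      simp_rw [Real.enorm_eq_ofReal_abs]
      exact (hA x).trans_lt (ENNReal.mul_lt_top hD'top.lt_top (expWeight_ne_top _ _).lt_top)⟩
  refine ⟨hint i, ?_⟩
  -- First-step analysis gives `M = r + P M₀`, with `r` the mean vertical jump. Integrated against
  -- `π`, stationarity turns `P M₀` into `M₀`, and `M₀` differs from `M` only at `i`, where it
  -- vanishes. This leaves `π r = π(i) M(i)`.
  set M : ℕ → ℝ := fun x => ∫ l, (l : ℝ) ∂hitMeasure p i x with hM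
  set M₀ : ℕ → ℝ := fun x => ∫ l, (l : ℝ) ∂hitMeasure₀ p i x with hM₀
  have hint₀ : ∀ x, Integrable (fun l : ℤ => (l : ℝ)) (hitMeasure₀ p i x) := by
    intro x
    by_cases hx : x = i
    · rw [hx, hitMeasure₀_self]
      exact integrable_dirac (by simp)
    · rw [hitMeasure₀_of_ne hx]; exact hint x
  have hM₀M : ∀ x, M₀ x = if x = i then 0 else M x := by
    intro x
    split_ifs with hx
    · simp only [hM₀, hx, hitMeasure₀_self]; simp
    · simp only [hM₀, hitMeasure₀_of_ne hx]; rfl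
  have hd2 : ∀ x, Integrable (fun d : ℤ × ℤ => (d.2 : ℝ)) (p x).toMeasure := by
    intro x
    have h1 := (hmom x).integrable hD
      (f := fun d => Real.exp (t₁ * (|(d.1 : ℝ)| + |(d.2 : ℝ)|))) fun d => by rw [Real.abs_exp]
    refine (h1.const_mul (1 / t₁)).mono' (measurable_of_countable _).aestronglyMeasurable
      (ae_of_all _ fun d => ?_)
    rw [one_div, inv_mul_eq_div, le_div_iff₀ ht₁, Real.norm_eq_abs]
    have := Real.add_one_le_exp (t₁ * (|(d.1 : ℝ)| + |(d.2 : ℝ)|))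
    nlinarith [abs_nonneg (d.1 : ℝ)]
  have hrec : ∀ x, Integrable (fun d => M₀ (stepX x d)) (p x).toMeasure ∧
      M x = ∫ d, (d.2 : ℝ) ∂(p x).toMeasure + ∫ d, M₀ (stepX x d) ∂(p x).toMeasure := by
    intro x
    obtain ⟨h1, h2⟩ := h.integral_hitMeasure i x (hint x)
    have h3 : ∀ d : ℤ × ℤ, ∫ l, ((d.2 + l : ℤ) : ℝ) ∂hitMeasure₀ p i (stepX x d)
        = d.2 + M₀ (stepX x d) := by
      intro d
      push_cast
      rw [integral_add (integrable_const _) (hint₀ _)]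
      simp [hM₀]
    simp only [h3] at h1 h2
    have h4 : Integrable (fun d => M₀ (stepX x d)) (p x).toMeasure := by
      refine (h1.sub (hd2 x)).congr (ae_of_all _ fun d => ?_)
      simp
    exact ⟨h4, by simp only [hM]; rw [h2, integral_add (hd2 x) h4]⟩
  -- integrability of `M` under `π`
  have hMint : Integrable M π.toMeasure := by
    refine ⟨(measurable_of_countable _).aestronglyMeasurable, ?_⟩
    rw [hasFiniteIntegral_iff_enorm, PMF.lintegral_eq_tsum']
    have h1 : ∀ x, ‖M x‖ₑ ≤ D' * expWeight ε x := fun x =>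
      (enorm_integral_le_lintegral_enorm _).trans (by
        simp_rw [Real.enorm_eq_ofReal_abs]; exact hA x)
    calc _ ≤ ∑' x, π x * (D' * expWeight ε x) :=
          ENNReal.tsum_le_tsum fun x => mul_le_mul_right (h1 x) _
      _ = D' * ∑' x, π x * expWeight ε x := by
          rw [← ENNReal.tsum_mul_left]; exact tsum_congr fun x => by ring
      _ ≤ D' * (π i * (D * expWeight ε i)) := by
          gcongr
          refine (h.tsum_invariant_le hπ i fun x => expWeight_ne_top _ _).trans ?_
          gcongr
          exact hpot i
      _ < ∞ := by
          have := PMF.apply_ne_top π i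
          have := expWeight_ne_top ε (i : ℝ)
          exact (by finiteness : D' * (π i * (D * expWeight ε i)) ≠ ∞).lt_top
  have hsingle : Integrable (fun x => if x = i then M i else 0) π.toMeasure :=
    Integrable.of_bound (C := |M i|) (measurable_of_countable _).aestronglyMeasurable
      (ae_of_all _ fun x => by split_ifs <;> simp)
  have hM₀eq : M₀ = fun x => M x - if x = i then M i else 0 := by
    funext x
    rw [hM₀M]
    split_ifs with hx <;> simp [hx]
  have hM₀int : Integrable M₀ π.toMeasure := by
    rw [hM₀eq]; exact hMint.sub hsingle
  let κ : ℕ → Measure ℕ := fun x => (p x).toMeasure.map (stepX x)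
  have : ∀ x, IsProbabilityMeasure (κ x) := fun x =>
    Measure.isProbabilityMeasure_map (measurable_of_countable _).aemeasurable
  have hmix : ∀ f : ℕ → ℝ≥0∞, ∫⁻ x, f x ∂π.toMeasure = ∫⁻ x, ∫⁻ y, f y ∂κ x ∂π.toMeasure := by
    intro f
    rw [PMF.lintegral_eq_tsum', PMF.lintegral_eq_tsum', ← tsum_invariant hπ f]
    refine tsum_congr fun x => ?_
    rw [lintegral_map (measurable_of_countable _) (measurable_of_countable _),
      PMF.lintegral_eq_tsum']
  obtain ⟨-, hI1, hI2⟩ := integral_mixture hmix hM₀int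
  have hκ : ∀ x, ∫ y, M₀ y ∂κ x = ∫ d, M₀ (stepX x d) ∂(p x).toMeasure := fun x =>
    integral_map (measurable_of_countable _).aemeasurable
      (measurable_of_countable _).aestronglyMeasurable
  simp only [hκ] at hI1 hI2
  -- Integrability of the local drifts follows from `r = M - P M₀`.
  have hr : Integrable (fun x => ∫ d, (d.2 : ℝ) ∂(p x).toMeasure) π.toMeasure := by
    refine (hMint.sub hI1).congr (ae_of_all _ fun x => ?_)
    simp only [Pi.sub_apply]
    rw [(hrec x).2]
    ring
  have hfinal : ∫ x, (∫ d, (d.2 : ℝ) ∂(p x).toMeasure) ∂π.toMeasure = (π i).toReal * M i := by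
    have h1 : ∫ x, M x ∂π.toMeasure = ∫ x, (∫ d, (d.2 : ℝ) ∂(p x).toMeasure) ∂π.toMeasure
        + ∫ x, M₀ x ∂π.toMeasure := by
      rw [hI2, ← integral_add hr hI1]
      exact integral_congr_ae (ae_of_all _ fun x => (hrec x).2)
    have h2 : ∫ x, M₀ x ∂π.toMeasure = ∫ x, M x ∂π.toMeasure - (π i).toReal * M i := by
      rw [hM₀eq, integral_sub hMint hsingle]
      congr 1
      rw [PMF.integral_eq_tsum _ _ hsingle, tsum_eq_single i fun x hx => by simp [hx]]
      simp
    linarith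
  rw [← hfinal, PMF.integral_eq_tsum _ _ hr]
  refine tsum_congr fun x => ?_
  rw [PMF.integral_eq_tsum _ _ (hd2 x), smul_eq_mul]
  congr 1
  exact tsum_congr fun d => by rw [smul_eq_mul, mul_comm]

end Invariant

/-! ## The Green function of the walk on the strip -/

section StripGreen

variable {p : ℕ → PMF (ℤ × ℤ)} {k : ℕ} {π : PMF ℕ}

theorem summable_hitLaw_exp {i x : ℕ} {t : ℝ} (hfin : lap p i t x ≠ ∞) :
    Summable fun l : ℤ => (hitLaw p i x l).toReal * Real.exp (t * l) := by
  have := ENNReal.summable_toReal hfin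
  refine this.congr fun l => ?_
  rw [ENNReal.toReal_mul, expWeight, ENNReal.toReal_ofReal (Real.exp_pos _).le]

theorem StripWalk.hasSum_hitLaw (h : StripWalk p k) (i x : ℕ) :
    HasSum (fun l => (hitLaw p i x l).toReal) 1 := by
  have h1 := h.tsum_hitLaw i x
  have h2 : ∑' l, hitLaw p i x l ≠ ∞ := by rw [h1]; exact ENNReal.one_ne_top
  have h3 := ENNReal.hasSum_toReal h2
  rwa [← ENNReal.tsum_toReal_eq fun l => ENNReal.ne_top_of_tsum_ne_top h2 l, h1,
    ENNReal.toReal_one] at h3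

theorem hasSum_hitLaw_of_integrable {i x : ℕ} {f : ℤ → ℝ}
    (hs : Summable fun l => (hitLaw p i x l).toReal * f l) (hf : Integrable f (hitMeasure p i x)) :
    HasSum (fun l => (hitLaw p i x l).toReal * f l) (∫ l, f l ∂hitMeasure p i x) := by
  have h1 := integral_countable hf
  simp only [hitMeasure_real_singleton, smul_eq_mul] at h1
  rw [h1]
  exact hs.hasSum

theorem StripWalk.renewal_data (h : StripWalk p k) (hπ : IsInvariantDistribution (columnChain p) π)
    (hV : 0 < ∑' x, (π x).toReal * ∑' d : ℤ × ℤ, (d.2 : ℝ) * (p x d).toReal) (i : ℕ) :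
    ∃ m t₁ : ℝ, 0 < m ∧ 0 < t₁ ∧ 0 < (π i).toReal ∧
      (π i).toReal * m = ∑' x, (π x).toReal * ∑' d : ℤ × ℤ, (d.2 : ℝ) * (p x d).toReal ∧
      (∀ t, |t| ≤ t₁ → ∀ x, lap p i t x ≠ ∞) ∧
      (Summable fun l : ℤ => (hitLaw p i i l).toReal * Real.exp (t₁ * l)
        + (hitLaw p i i l).toReal * Real.exp (-t₁ * l)) ∧
      HasSum (fun l : ℤ => (hitLaw p i i l).toReal * l) m := by
  obtain ⟨ε, t₁, D, hε, ht₁, hD, -, hlap, -⟩ := h.exists_potential_bound i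
  obtain ⟨hint, hmean⟩ := h.mean_hitMeasure hπ i
  set m := ∫ l, (l : ℝ) ∂hitMeasure p i i with hm
  have hfin : ∀ t, |t| ≤ t₁ → ∀ x, lap p i t x ≠ ∞ := fun t ht x =>
    ne_top_of_le_ne_top (ENNReal.mul_ne_top hD (expWeight_ne_top _ _)) (hlap t ht x)
  have hsum : Summable fun l : ℤ => (hitLaw p i i l).toReal * Real.exp (t₁ * l)
        + (hitLaw p i i l).toReal * Real.exp (-t₁ * l) :=
    (summable_hitLaw_exp (hfin t₁ (by rw [abs_of_pos ht₁]) i)).add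
      (summable_hitLaw_exp (hfin (-t₁) (by rw [abs_neg, abs_of_pos ht₁]) i))
  have hπm : 0 < (π i).toReal * m := by rw [hmean]; exact hV
  have hπ0 : 0 < (π i).toReal := by
    refine lt_of_le_of_ne ENNReal.toReal_nonneg fun h0 => ?_
    rw [← h0, zero_mul] at hπm
    exact lt_irrefl _ hπm
  refine ⟨m, t₁, pos_of_mul_pos_right hπm hπ0.le, ht₁, hπ0, hmean, hfin, hsum, ?_⟩
  refine hasSum_hitLaw_of_integrable (Summable.of_norm_bounded (hsum.mul_left (1 / t₁)) ?_) hint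
  intro l
  rw [norm_mul, Real.norm_of_nonneg ENNReal.toReal_nonneg, Real.norm_eq_abs, ← mul_add,
    mul_left_comm]
  refine mul_le_mul_of_nonneg_left ?_ ENNReal.toReal_nonneg
  rw [one_div, inv_mul_eq_div, le_div_iff₀ ht₁]
  rcases le_total 0 (l : ℝ) with hr | hr
  · rw [abs_of_nonneg hr]
    linarith [Real.add_one_le_exp (t₁ * l), Real.exp_pos (-t₁ * l)]
  · rw [abs_of_nonpos hr]
    linarith [Real.add_one_le_exp (-t₁ * l), Real.exp_pos (t₁ * l)]

/-- An excursion from column `i` goes up on average, so its Laplace transform falls below `1` for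
small negative tilts. The cap `β` adapts the tilt to a prescribed weight. -/
theorem StripWalk.exists_lap_neg_lt_one (h : StripWalk p k)
    (hπ : IsInvariantDistribution (columnChain p) π)
    (hV : 0 < ∑' x, (π x).toReal * ∑' d : ℤ × ℤ, (d.2 : ℝ) * (p x d).toReal) (i : ℕ) {β : ℝ}
    (hβ : 0 < β) :
    ∃ t, 0 < t ∧ t ≤ β ∧ lap p i (-t) i < 1 ∧ ∀ x, lap p i (-t) x ≠ ∞ := by
  obtain ⟨m, t₁, hm, ht₁, -, -, hfin, hsum, hmean⟩ := h.renewal_data hπ hV i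
  have hev := eventually_tsum_exp_neg_lt_one (fun l => ENNReal.toReal_nonneg)
    (h.hasSum_hitLaw i i) ht₁ hsum hmean hm
  obtain ⟨t, ⟨ht1, ht2⟩, ht3⟩ :=
    ((hev.and (Ioc_mem_nhdsGT hβ)).and (Ioc_mem_nhdsGT ht₁)).exists
  have hf := hfin (-t) (by rw [abs_neg, abs_of_pos ht2.1]; exact ht3.2)
  refine ⟨t, ht2.1, ht2.2, ?_, hf⟩
  have h1 : (lap p i (-t) i).toReal < 1 := by
    rw [lap, ENNReal.tsum_toReal_eq fun l => ENNReal.ne_top_of_tsum_ne_top (hf i) l]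
    refine lt_of_eq_of_lt (tsum_congr fun l => ?_) ht1
    rw [ENNReal.toReal_mul, expWeight, ENNReal.toReal_ofReal (Real.exp_pos _).le]
  rwa [← ENNReal.toReal_one, ENNReal.toReal_lt_toReal (hf i) ENNReal.one_ne_top] at h1

/-- Asymptotics of the Green function of the walk on the strip, with target `(i, 0)`. -/
theorem StripWalk.exists_green_function (h : StripWalk p k)
    (hπ : IsInvariantDistribution (columnChain p) π)
    (hV : 0 < ∑' x, (π x).toReal * ∑' d : ℤ × ℤ, (d.2 : ℝ) * (p x d).toReal) (i : ℕ) {τ : ℝ}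
    (hτ : 0 < τ) :
    0 < (π i).toReal ∧ ∃ (F : ℕ → ℤ → ℝ) (C t δ' M : ℝ), 0 < t ∧ t ≤ τ ∧ 0 < δ' ∧ 0 < C ∧
      (∀ x y, F x y = (if x = i ∧ y = 0 then 1 else 0)
        + ∫ d, F (stepX x d) (y + d.2) ∂(p x).toMeasure) ∧
      (∀ x y, |F x y - (π i).toReal
        / ∑' x, (π x).toReal * ∑' d : ℤ × ℤ, (d.2 : ℝ) * (p x d).toReal|
          ≤ C * Real.exp (t * y - δ' * x)) ∧
      (∀ x y, |F x y| ≤ M) ∧ ∀ x, Tendsto (F x) atTop (𝓝 0) := by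
  have := fun x => h.isProbabilityMeasure_hitMeasure i x
  have := fun x => h.isProbabilityMeasure_hitMeasure₀ i x
  obtain ⟨m, t₁, hm, ht₁, hπ0, hπm, hfin, hsum, hmean⟩ := h.renewal_data hπ hV i
  obtain ⟨U, C, t₂, ht₂, hC, hU, hU1, hU0⟩ := exists_renewal_sequence
    (fun l => ENNReal.toReal_nonneg) (h.hasSum_hitLaw i i) ht₁ hsum hmean hm
    (fun z hz hz1 => h.aperiodic i hz hz1)
  have hconst : (π i).toReal / ∑' x, (π x).toReal * ∑' d : ℤ × ℤ, (d.2 : ℝ) * (p x d).toReal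
      = 1 / m := by
    rw [← hπm]; field_simp
  refine ⟨hπ0, ?_⟩
  rw [hconst]
  have hm' : 0 < 1 / m := by positivity
  set M := C + 1 / m with hM
  have hUM : ∀ k, |U k| ≤ M := by
    intro k
    rcases le_total 0 k with hk | hk
    · have hk' : (0 : ℝ) ≤ k := by exact_mod_cast hk
      have h1 := hU1 k
      have h2 : Real.exp (-t₂ * k) ≤ 1 := Real.exp_le_one_iff.2 (by nlinarith)
      have h3 := abs_sub_abs_le_abs_sub (U k) (1 / m)
      rw [abs_of_pos hm'] at h3
      nlinarith
    · have hk' : (k : ℝ) ≤ 0 := by exact_mod_cast hk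
      have h1 := hU0 k
      have h2 : Real.exp (t₂ * k) ≤ 1 := Real.exp_le_one_iff.2 (by nlinarith)
      nlinarith
  obtain ⟨t, ⟨⟨δ', Cd, hδ', hCd, hdec⟩, ht⟩, htt⟩ := (((h.lap_decay i).and
    (Ioc_mem_nhdsGT ht₂)).and (Ioc_mem_nhdsGT hτ)).exists
  -- A single exponential covers both sides: for `k ≥ 0` it is the rate of convergence, as `t ≤ t₂`,
  -- and for `k ≤ 0` it is at least `1`, so boundedness suffices.
  have hUt : ∀ k : ℤ, |U k - 1 / m| ≤ (C + M + 1 / m) * Real.exp (t * -k) := by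
    intro k
    have he := Real.exp_pos (t * -k)
    rcases le_total 0 k with hk | hk
    · have hk' : (0 : ℝ) ≤ k := by exact_mod_cast hk
      have h1 := hU1 k
      have h2 : Real.exp (-t₂ * k) ≤ Real.exp (t * -k) :=
        Real.exp_le_exp.2 (by nlinarith [ht.2])
      nlinarith
    · have hk' : (k : ℝ) ≤ 0 := by exact_mod_cast hk
      have h1 := (abs_sub (U k) (1 / m)).trans (add_le_add_left (hUM k) _)
      rw [abs_of_pos hm'] at h1
      have h2 : 1 ≤ Real.exp (t * -k) := Real.one_le_exp (by nlinarith [ht.1])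
      nlinarith
  have hint : ∀ (y : ℤ) (ρ : Measure ℤ) [IsProbabilityMeasure ρ],
      Integrable (fun l => U (-y - l)) ρ := fun y ρ _ =>
    Integrable.of_bound (measurable_of_countable _).aestronglyMeasurable M
      (ae_of_all _ fun l => hUM _)
  -- After displacement `l` the walk stands at `(i, y + l)`, and a further displacement `-y - l`
  -- leads to `(i, 0)`.
  set F : ℕ → ℤ → ℝ := fun x y => ∫ l, U (-y - l) ∂hitMeasure₀ p i x with hF
  set C₀ := (C + M + 1 / m) * (Cd + expWeight δ' i).toReal with hC₀
  have hC₀pos : 0 < C₀ := by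
    refine mul_pos (by positivity) (ENNReal.toReal_pos ?_ ?_)
    · exact (lt_of_lt_of_le (pos_iff_ne_zero.2 (expWeight_ne_zero _ _)) le_add_self).ne'
    · exact ENNReal.add_ne_top.2 ⟨hCd, expWeight_ne_top _ _⟩
  refine ⟨F, C₀, t, δ', M, ht.1, htt.2, hδ', hC₀pos, fun x y => ?_, fun x y => ?_, fun x y => ?_,
    fun x => ?_⟩
  · have h1 := (h.integral_hitMeasure i x (hint y (hitMeasure p i x))).2
    have h2 : ∀ d : ℤ × ℤ, ∫ l, U (-y - (d.2 + l)) ∂hitMeasure₀ p i (stepX x d)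
        = F (stepX x d) (y + d.2) := by
      intro d
      simp only [hF]
      refine integral_congr_ae (ae_of_all _ fun l => ?_)
      simp only
      congr 1
      ring
    simp only [h2] at h1
    rw [← h1]
    -- In column `i` the integral against the return law is the renewal equation, which carries the
    -- unit mass; elsewhere `hitMeasure₀` is `hitMeasure`.
    by_cases hx : x = i
    · subst hx
      have h3 := (hasSum_hitLaw_of_integrable (hU (-y)).summable
        (hint y (hitMeasure p x x))).unique (hU (-y))
      rw [h3]
      simp only [hF, hitMeasure₀_self, integral_dirac, sub_zero, true_and, neg_eq_zero]
      ring
    · simp [hF, hitMeasure₀_of_ne hx, hx]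
  · have h1 : F x y - 1 / m = ∫ l, (U (-y - l) - 1 / m) ∂hitMeasure₀ p i x := by
      rw [integral_sub (hint y _) (integrable_const _)]
      simp [hF]
    have hlap₀ : lap₀ p i t x ≤ (Cd + expWeight δ' i) * expWeight (-δ') x := by
      rw [add_mul]
      by_cases hx : x = i
      · rw [hx, lap₀_of_eq]
        refine le_trans (le_of_eq ?_) le_add_self
        rw [expWeight, expWeight, ← ENNReal.ofReal_mul (Real.exp_pos _).le, ← Real.exp_add]
        simp
      · rw [lap₀_of_ne _ hx]
        exact (hdec x).trans le_self_add
    have h2 : ENNReal.ofReal |F x y - 1 / m|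
        ≤ ENNReal.ofReal (C₀ * Real.exp (t * y - δ' * x)) := by
      calc ENNReal.ofReal |F x y - 1 / m| = ‖∫ l, (U (-y - l) - 1 / m) ∂hitMeasure₀ p i x‖ₑ := by
            rw [h1, Real.enorm_eq_ofReal_abs]
        _ ≤ ∫⁻ l, ‖U (-y - l) - 1 / m‖ₑ ∂hitMeasure₀ p i x := enorm_integral_le_lintegral_enorm _
        _ ≤ ∫⁻ l : ℤ, ENNReal.ofReal (C + M + 1 / m) * expWeight t y * expWeight t l
              ∂hitMeasure₀ p i x := by
            refine lintegral_mono fun l => ?_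
            rw [mul_assoc, ← expWeight_add, Real.enorm_eq_ofReal_abs, expWeight,
              ← ENNReal.ofReal_mul (by positivity)]
            refine ENNReal.ofReal_le_ofReal ((hUt _).trans (le_of_eq ?_))
            push_cast
            ring_nf
        _ = ENNReal.ofReal (C + M + 1 / m) * expWeight t y * lap₀ p i t x := by
            rw [lintegral_const_mul _ (measurable_of_countable _), lintegral_hitMeasure₀]
            rfl
        _ ≤ ENNReal.ofReal (C + M + 1 / m) * expWeight t y
              * ((Cd + expWeight δ' i) * expWeight (-δ') x) := by gcongr
        _ = _ := by
            rw [← ENNReal.ofReal_toReal (ENNReal.add_ne_top.2 ⟨hCd, expWeight_ne_top δ' i⟩),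
              expWeight.eq_1 t, expWeight.eq_1 (-δ'), ← ENNReal.ofReal_mul (by positivity),
              ← ENNReal.ofReal_mul (by positivity), ← ENNReal.ofReal_mul (by positivity), hC₀,
              sub_eq_add_neg, Real.exp_add, neg_mul]
            congr 1
            ring
    exact (ENNReal.ofReal_le_ofReal_iff (by positivity)).1 h2
  · have := norm_integral_le_of_norm_le_const (μ := hitMeasure₀ p i x)
      (f := fun l => U (-y - l)) (C := M) (ae_of_all _ fun l => hUM _)
    simpa using this
  · have hlim : Tendsto U atBot (𝓝 0) := by
      refine squeeze_zero_norm hU0 ?_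
      have h1 : Tendsto (fun k : ℤ => t₂ * (k : ℝ)) atBot atBot :=
        (tendsto_intCast_atBot_iff.2 tendsto_id).const_mul_atBot ht₂
      simpa using (Real.tendsto_exp_atBot.comp h1).const_mul C
    have := tendsto_integral_filter_of_dominated_convergence (μ := hitMeasure₀ p i x)
      (F := fun (y : ℤ) l => U (-y - l)) (f := fun _ => 0) (l := atTop) (fun _ => M)
      (Eventually.of_forall fun y => (measurable_of_countable _).aestronglyMeasurable)
      (Eventually.of_forall fun y => ae_of_all _ fun l => hUM _) (integrable_const _)
      (ae_of_all _ fun l => hlim.comp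
        (tendsto_atBot_add_const_right _ (-l) tendsto_neg_atTop_atBot))
    simpa using this

end StripGreen

/-! ## Walks on the quadrant: recurrence to the boundary and bounds on the Green function -/

section Recurrence

theorem iterate_transOp_le {S : Type*} (K : S → PMF S) {h : S → ℝ≥0∞} {C : ℝ≥0∞}
    (hC : ∀ z, transOp K h z ≤ C * h z) (n : ℕ) (z : S) :
    (transOp K)^[n] h z ≤ C ^ n * h z := by
  induction n generalizing z with
  | zero => simp
  | succ n ih =>
    rw [Function.iterate_succ_apply']
    refine (transOp_mono K ih z).trans ?_
    calc transOp K (fun z => C ^ n * h z) z = C ^ n * transOp K h z := by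
          rw [transOp, transOp, ← ENNReal.tsum_mul_left]
          exact tsum_congr fun y => mul_left_comm _ _ _
      _ ≤ C ^ n * (C * h z) := by gcongr; exact hC z
      _ = C ^ (n + 1) * h z := by rw [pow_succ, mul_assoc]

variable {S : Type*} [MeasurableSpace S] [Countable S] [MeasurableSingletonClass S]

/-- A chain with a function `h ≥ 1` that contracts off `A` visits `A` infinitely often. -/
theorem ae_frequently_mem_of_contraction (K : S → PMF S) (x : S) {h : S → ℝ≥0∞} {A : Set S}
    {ρ : ℝ≥0∞} (hρ : ρ < 1) (h1 : ∀ z, 1 ≤ h z) (hcontr : ∀ z ∉ A, transOp K h z ≤ ρ * h z)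
    (hfin : ∀ n, (transOp K)^[n] h x ≠ ∞) :
    ∀ᵐ ω ∂pathLaw K x, ∃ᶠ n in atTop, ω n ∈ A := by
  -- Each step spent outside `A` after time `n` contracts the mean of `h` by `ρ`. As `h ≥ 1`, this
  -- bounds the probability of avoiding `A` from time `n` on.
  have key : ∀ n m : ℕ, ∫⁻ ω, (∏ r ∈ Finset.range m, Aᶜ.indicator 1 (ω (n + r))) * h (ω (n + m))
      ∂pathLaw K x ≤ ρ ^ m * (transOp K)^[n] h x := by
    intro n m
    induction m with
    | zero => simp [pathLaw_lintegral_iterate]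
    | succ m ih =>
      set Φ : ((i : Finset.Iic (n + m)) → S) → ℝ≥0∞ := fun u => ∏ r ∈ Finset.range (m + 1),
        if hr : n + r ≤ n + m then Aᶜ.indicator 1 (u ⟨n + r, Finset.mem_Iic.2 hr⟩) else 1 with hΦ
      have hΦ' : ∀ ω : ℕ → S, Φ (frestrictLe (n + m) ω)
          = ∏ r ∈ Finset.range (m + 1), Aᶜ.indicator 1 (ω (n + r)) := by
        intro ω
        refine Finset.prod_congr rfl fun r hr => ?_
        have : n + r ≤ n + m := by have := Finset.mem_range.1 hr; omega
        rw [dif_pos this]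
        rfl
      have hstep := pathLaw_lintegral_succ K x (n + m) Φ h
      simp only [hΦ'] at hstep
      rw [← add_assoc, hstep]
      calc ∫⁻ ω, (∏ r ∈ Finset.range (m + 1), Aᶜ.indicator 1 (ω (n + r)))
              * transOp K h (ω (n + m)) ∂pathLaw K x
          ≤ ∫⁻ ω, ρ * ((∏ r ∈ Finset.range m, Aᶜ.indicator 1 (ω (n + r))) * h (ω (n + m)))
              ∂pathLaw K x := by
            refine lintegral_mono fun ω => ?_
            simp only
            rw [Finset.prod_range_succ, mul_assoc, mul_left_comm ρ]
            refine mul_le_mul_right ?_ _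
            by_cases hA : ω (n + m) ∈ A
            · simp [hA]
            · simpa [hA] using hcontr _ hA
        _ = ρ * ∫⁻ ω, (∏ r ∈ Finset.range m, Aᶜ.indicator 1 (ω (n + r))) * h (ω (n + m))
              ∂pathLaw K x := by
            refine lintegral_const_mul _ ?_
            have hm : ∀ (g : S → ℝ≥0∞) (j : ℕ), Measurable fun ω : ℕ → S => g (ω j) :=
              fun g j => (measurable_of_countable g).comp (measurable_pi_apply j)
            exact (Finset.measurable_prod _ fun r _ => hm _ _).mul (hm _ _)
        _ ≤ ρ * (ρ ^ m * (transOp K)^[n] h x) := by gcongr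
        _ = _ := by rw [pow_succ', mul_assoc]
  have hnull : ∀ n : ℕ, pathLaw K x {ω | ∀ m, n ≤ m → ω m ∉ A} = 0 := by
    intro n
    have hle : ∀ m, pathLaw K x {ω | ∀ m, n ≤ m → ω m ∉ A} ≤ ρ ^ m * (transOp K)^[n] h x := by
      intro m
      refine le_trans ?_ (key n m)
      have hmeas : MeasurableSet {ω : ℕ → S | ∀ m, n ≤ m → ω m ∉ A} := by
        have : {ω : ℕ → S | ∀ m, n ≤ m → ω m ∉ A}
            = ⋂ m, ⋂ (_ : n ≤ m), (fun ω : ℕ → S => ω m) ⁻¹' Aᶜ := by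
          ext ω; simp
        rw [this]
        exact MeasurableSet.iInter fun m => MeasurableSet.iInter fun _ =>
          (measurable_pi_apply m : Measurable fun ω : ℕ → S => ω m) (Set.to_countable _).measurableSet
      rw [← lintegral_indicator_one hmeas]
      refine lintegral_mono fun ω => ?_
      by_cases hω : ω ∈ {ω : ℕ → S | ∀ m, n ≤ m → ω m ∉ A}
      swap
      · rw [Set.indicator_of_notMem hω]; exact zero_le
      rw [Set.indicator_of_mem hω]
      rw [Finset.prod_eq_one fun r _ => ?_, one_mul]
      · exact h1 _
      · exact Set.indicator_of_mem (hω (n + r) (by omega)) _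
    have hlim : Tendsto (fun m : ℕ => ρ ^ m * (transOp K)^[n] h x) atTop (𝓝 0) := by
      have := ENNReal.Tendsto.mul_const (b := (transOp K)^[n] h x)
        (ENNReal.tendsto_pow_atTop_nhds_zero_of_lt_one hρ) (Or.inr (hfin n))
      simpa using this
    exact le_antisymm (ge_of_tendsto' hlim hle) zero_le
  have hall : ∀ᵐ ω ∂pathLaw K x, ∀ n : ℕ, ¬ ∀ m, n ≤ m → ω m ∉ A :=
    ae_all_iff.2 fun n => by rw [ae_iff]; simpa using hnull n
  filter_upwards [hall] with ω hω
  rw [frequently_atTop]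
  intro n
  have := hω n
  push Not at this
  exact this

/-- Each visit to `w` is followed, `n` steps later, by a visit to `y` with the given probability. -/
theorem green_mul_iterate_le (K : S → PMF S) (x y w : S) (n : ℕ) :
    green K x w * (transOp K)^[n] (Set.indicator {y} 1) w ≤ green K x y := by
  calc green K x w * (transOp K)^[n] (Set.indicator {y} 1) w
      ≤ ∑' w, green K x w * (transOp K)^[n] (Set.indicator {y} 1) w :=
        ENNReal.le_tsum (f := fun w => green K x w * (transOp K)^[n] (Set.indicator {y} 1) w) w
    _ = ∑' m, (transOp K)^[m + n] (Set.indicator {y} 1) x := by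
        rw [tsum_green_mul]
        exact tsum_congr fun m => by rw [Function.iterate_add_apply]
    _ ≤ ∑' m, (transOp K)^[m] (Set.indicator {y} 1) x :=
        ENNReal.tsum_comp_le_tsum_of_injective (add_left_injective n)
          fun m => (transOp K)^[m] (Set.indicator {y} 1) x
    _ = green K x y := (green_eq_tsum_iterate K x y).symm

end Recurrence

/-- Position after the jump `d` from a point of the quadrant. -/
def stepXY (z : ℕ × ℕ) (d : ℤ × ℤ) : ℕ × ℕ := (stepX z.1 d, ((z.2 : ℤ) + d.2).toNat)

/-- A chain `K` which in the coordinates `σ` is the walk on the quadrant with jump laws `J`; above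
row `k` these laws are those of the walk on the strip with jump laws `p`. -/
structure QuadrantWalk {S : Type*} [MeasurableSpace S] [Countable S] [MeasurableSingletonClass S]
    (K : S → PMF S) (σ : S ≃ ℕ × ℕ) (J : ℕ × ℕ → PMF (ℤ × ℤ)) (p : ℕ → PMF (ℤ × ℤ)) (k : ℕ) :
    Prop where
  step : ∀ s, (K s).map σ = (J (σ s)).map (stepXY (σ s))
  eq_of_le : ∀ x y, k ≤ y → J (x, y) = p x
  snd_nonneg : ∀ z d, J z d ≠ 0 → 0 ≤ (z.2 : ℤ) + d.2
  moments : ∃ δ C, 0 < δ ∧ C ≠ ∞ ∧ ∀ z, ExpMoment (J z) δ C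
  strip : StripWalk p k
  irreducible : IsIrreducibleChain K

/-! ### Uniform bounds on the Green function along a column. -/

section Quadrant

variable {S : Type*} [MeasurableSpace S] [Countable S] [MeasurableSingletonClass S]
  {K : S → PMF S} {σ : S ≃ ℕ × ℕ} {J : ℕ × ℕ → PMF (ℤ × ℤ)} {p : ℕ → PMF (ℤ × ℤ)} {k : ℕ}
  {π : PMF ℕ}

theorem QuadrantWalk.transOp_comp (h : QuadrantWalk K σ J p k) (f : ℕ × ℕ → ℝ≥0∞) (s : S) :
    transOp K (fun s => f (σ s)) s = ∑' d, J (σ s) d * f (stepXY (σ s) d) := by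
  rw [← PMF.tsum_map_mul (J (σ s)), ← h.step, PMF.tsum_map_mul]
  rfl

theorem QuadrantWalk.integral_comp (h : QuadrantWalk K σ J p k) (f : ℕ × ℕ → ℝ) (s : S) :
    ∫ s', f (σ s') ∂(K s).toMeasure = ∫ d, f (stepXY (σ s) d) ∂(J (σ s)).toMeasure := by
  have h1 : (K s).toMeasure.map σ = (J (σ s)).toMeasure.map (stepXY (σ s)) := by
    rw [PMF.toMeasure_map _ _ (measurable_of_countable _), h.step,
      PMF.toMeasure_map _ _ (measurable_of_countable _)]
  rw [← integral_map (φ := σ) (f := f) (measurable_of_countable _).aemeasurable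
      (measurable_of_countable _).aestronglyMeasurable, h1,
    integral_map (measurable_of_countable _).aemeasurable
      (measurable_of_countable _).aestronglyMeasurable]

theorem QuadrantWalk.stepXY_snd_cast (h : QuadrantWalk K σ J p k) {z : ℕ × ℕ} {d : ℤ × ℤ}
    (hd : J z d ≠ 0) : (((stepXY z d).2 : ℕ) : ℤ) = z.2 + d.2 :=
  Int.toNat_of_nonneg (h.snd_nonneg z d hd)

/-- Bound on the Green function high up column `i`, from a superharmonic function bounded by `1` with
a strict defect there. -/
theorem QuadrantWalk.tsum_green_high_le (h : QuadrantWalk K σ J p k)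
    (hπ : IsInvariantDistribution (columnChain p) π)
    (hV : 0 < ∑' x, (π x).toReal * ∑' d : ℤ × ℤ, (d.2 : ℝ) * (p x d).toReal) (i : ℕ) {β : ℝ}
    (hβ : 0 < β) :
    ∃ (y₀ : ℕ) (D : ℝ≥0∞), D ≠ ∞ ∧ ∀ s, ∑' y : ℕ, (if y₀ ≤ y then
      green K s (σ.symm (i, y)) * expWeight (-β) y else 0) ≤ D := by
  obtain ⟨t, ht, htβ, hlt, -⟩ := h.strip.exists_lap_neg_lt_one hπ hV i hβ
  obtain ⟨c, hc, hclap⟩ := h.strip.lap_neg_lower i ht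
  have hlap₀ : ∀ x, min (ENNReal.ofReal c) 1 ≤ lap₀ p i (-t) x := by
    intro x
    by_cases hx : x = i
    · rw [hx, lap₀_of_eq]; exact min_le_right _ _
    · rw [lap₀_of_ne _ hx]; exact (min_le_left _ _).trans (hclap x)
  -- `a` bounds `e^{-ty} lap₀` from below on the rows under `k`. Hence `Ψ ≥ 1` there, and `min 1 Ψ`
  -- is constant where `J` may differ from `p`.
  set a : ℝ≥0∞ := expWeight (-t) k * min (ENNReal.ofReal c) 1 with ha
  have ha0 : a ≠ 0 := mul_ne_zero (expWeight_ne_zero _ _)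
    (lt_min (ENNReal.ofReal_pos.2 hc) one_pos).ne'
  have hatop : a ≠ ∞ := ENNReal.mul_ne_top (expWeight_ne_top _ _)
    (ne_top_of_le_ne_top ENNReal.one_ne_top (min_le_right _ _))
  set Ψ : ℕ × ℕ → ℝ≥0∞ := fun z => a⁻¹ * (expWeight (-t) z.2 * lap₀ p i (-t) z.1) with hΨ
  set f : ℕ × ℕ → ℝ≥0∞ := fun z => min 1 (Ψ z) with hf
  have hΨ1 : ∀ z : ℕ × ℕ, z.2 < k → 1 ≤ Ψ z := by
    intro z hz
    rw [← ENNReal.inv_mul_cancel ha0 hatop]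
    refine mul_le_mul_right (mul_le_mul' (expWeight_mono ?_) (hlap₀ _)) _
    have : (z.2 : ℝ) ≤ k := by exact_mod_cast hz.le
    nlinarith
  have hTle1 : ∀ s, transOp K (fun s => f (σ s)) s ≤ 1 := by
    intro s
    refine (transOp_mono K (show (fun s => f (σ s)) ≤ fun _ => 1 from fun s => min_le_left _ _)
      s).trans ?_
    simp [transOp, PMF.tsum_coe]
  -- One step replaces `lap₀` by `lap`. They agree off column `i`; in column `i` the value `1` drops
  -- to `r < 1`.
  have hTle : ∀ s, k ≤ (σ s).2 → transOp K (fun s => f (σ s)) s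
      ≤ a⁻¹ * (expWeight (-t) (σ s).2 * lap p i (-t) (σ s).1) := by
    intro s hs
    rw [h.transOp_comp, lap_eq, ← ENNReal.tsum_mul_left, ← ENNReal.tsum_mul_left]
    refine ENNReal.tsum_le_tsum fun d => ?_
    by_cases hd : J (σ s) d = 0
    · simp [hd]
    have hcast : (((stepXY (σ s) d).2 : ℕ) : ℝ) = (σ s).2 + d.2 := by
      exact_mod_cast h.stepXY_snd_cast hd
    calc J (σ s) d * f (stepXY (σ s) d) ≤ J (σ s) d * Ψ (stepXY (σ s) d) := by
          gcongr; exact min_le_right _ _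
      _ = _ := by
          rw [hΨ]
          simp only
          rw [hcast, expWeight_add, ← h.eq_of_le (σ s).1 (σ s).2 hs]
          simp only [stepXY]
          ring
  set r := lap p i (-t) i with hr
  obtain ⟨y₁, hy₁⟩ : ∃ y₁ : ℕ, ∀ y : ℕ, y₁ ≤ y → a⁻¹ * expWeight (-t) y ≤ 1 := by
    have hlim : Tendsto (fun y : ℕ => expWeight (-t) y) atTop (𝓝 0) := by
      have h1 : Tendsto (fun y : ℕ => -t * (y : ℝ)) atTop atBot :=
        tendsto_natCast_atTop_atTop.const_mul_atTop_of_neg (by linarith)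
      have h2 := ENNReal.tendsto_ofReal (Real.tendsto_exp_atBot.comp h1)
      rw [ENNReal.ofReal_zero] at h2
      exact h2
    obtain ⟨y₁, hy₁⟩ := eventually_atTop.1 (hlim.eventually_le_const (pos_iff_ne_zero.2 ha0))
    refine ⟨y₁, fun y hy => ?_⟩
    rw [← ENNReal.inv_mul_cancel ha0 hatop]
    exact mul_le_mul_right (hy₁ y hy) _
  set y₀ := max k y₁ with hy₀
  -- The defect is claimed only from height `y₀` on, where `Ψ ≤ 1` in column `i` and the minimum
  -- with `1` does not hide the gain `1 - r`.
  set e : ℕ × ℕ → ℝ≥0∞ := fun z =>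
    if z.1 = i ∧ y₀ ≤ z.2 then a⁻¹ * (expWeight (-t) z.2 * (1 - r)) else 0 with he
  have hsuper : (fun s => e (σ s)) + transOp K (fun s => f (σ s)) ≤ fun s => f (σ s) := by
    intro s
    simp only [Pi.add_apply]
    by_cases hs : k ≤ (σ s).2
    · by_cases hi : (σ s).1 = i
      · by_cases hy : y₀ ≤ (σ s).2
        · have hfs : f (σ s) = a⁻¹ * expWeight (-t) (σ s).2 := by
            simp only [hf, hΨ, hi, lap₀_of_eq, mul_one]
            exact min_eq_right (hy₁ _ ((le_max_right _ _).trans hy))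
          rw [hfs]
          simp only [he, hi, hy, and_self, if_true]
          refine (add_le_add_right (hTle s hs) _).trans (le_of_eq ?_)
          rw [hi, ← hr, ← mul_add, ← mul_add, tsub_add_cancel_of_le hlt.le, mul_one]
        · simp only [he, hy, and_false, if_false, zero_add]
          refine le_min (hTle1 s) ((hTle s hs).trans ?_)
          simp only [hΨ, hi, lap₀_of_eq]
          gcongr
      · simp only [he, hi, false_and, if_false, zero_add]
        refine le_min (hTle1 s) ((hTle s hs).trans ?_)
        simp only [hΨ, lap₀_of_ne _ hi]; rfl
    · have hy : ¬ y₀ ≤ (σ s).2 := fun hy => hs ((le_max_left _ _).trans hy)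
      simp only [he, hy, and_false, if_false, zero_add]
      exact (hTle1 s).trans (le_min le_rfl (hΨ1 _ (not_le.1 hs)))
  set b : ℝ≥0∞ := a⁻¹ * (1 - r) with hb
  have hb0 : b ≠ 0 := mul_ne_zero (ENNReal.inv_ne_zero.2 hatop) (tsub_pos_of_lt hlt).ne'
  have hbtop : b ≠ ∞ := ENNReal.mul_ne_top (ENNReal.inv_ne_top.2 ha0)
    (ne_top_of_le_ne_top ENNReal.one_ne_top tsub_le_self)
  refine ⟨y₀, b⁻¹, ENNReal.inv_ne_top.2 hb0, fun s => ?_⟩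
  have h1 : ∑' s', green K s s' * e (σ s') ≤ 1 :=
    (tsum_green_mul_le K hsuper s).trans (min_le_left _ _)
  have hinj : Function.Injective fun y : ℕ => σ.symm (i, y) := by
    intro y y' hyy
    simpa using hyy
  rw [← one_div, ENNReal.le_div_iff_mul_le (Or.inl hb0) (Or.inl hbtop), mul_comm,
    ← ENNReal.tsum_mul_left]
  refine le_trans ?_ h1
  refine le_trans (ENNReal.tsum_le_tsum fun y => ?_) (ENNReal.tsum_comp_le_tsum_of_injective hinj
    fun s' => green K s s' * e (σ s'))
  by_cases hy : y₀ ≤ y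
  · simp only [hy, if_true, he, Equiv.apply_symm_apply, and_self]
    calc b * (green K s (σ.symm (i, y)) * expWeight (-β) y)
        ≤ b * (green K s (σ.symm (i, y)) * expWeight (-t) y) := by
          gcongr
          refine expWeight_mono ?_
          have : (0 : ℝ) ≤ y := by positivity
          nlinarith
      _ = _ := by rw [hb]; ring
  · simp [hy]

/-- Exponentially weighted sums of the Green function over a column are bounded, uniformly in the
starting point. -/
theorem QuadrantWalk.tsum_green_column_le (h : QuadrantWalk K σ J p k)
    (hπ : IsInvariantDistribution (columnChain p) π)
    (hV : 0 < ∑' x, (π x).toReal * ∑' d : ℤ × ℤ, (d.2 : ℝ) * (p x d).toReal) (i : ℕ) {β : ℝ}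
    (hβ : 0 < β) :
    ∃ D : ℝ≥0∞, D ≠ ∞ ∧
      ∀ s, ∑' y : ℕ, green K s (σ.symm (i, y)) * expWeight (-β) y ≤ D := by
  obtain ⟨y₀, D, hD, hle⟩ := h.tsum_green_high_le hπ hV i hβ
  have hirr := (isIrreducibleChain_iff K).1 h.irreducible
  -- The heights below `y₀` are handled by irreducibility, through a path from `(i, y)` to `(i,
  -- y₀)`.
  have hcol : ∀ y : ℕ, ∃ B : ℝ≥0∞, B ≠ ∞ ∧ ∀ s, green K s (σ.symm (i, y)) ≤ B := by
    intro y
    obtain ⟨n, hn⟩ := hirr (σ.symm (i, y)) (σ.symm (i, y₀))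
    set ε := (transOp K)^[n] (Set.indicator {σ.symm (i, y₀)} 1) (σ.symm (i, y)) with hε
    set w := expWeight (-β) y₀ with hw
    refine ⟨D / (ε * w), ?_, fun s => ?_⟩
    · exact ENNReal.div_ne_top hD (mul_ne_zero hn.ne' (expWeight_ne_zero _ _))
    · rw [ENNReal.le_div_iff_mul_le (Or.inl (mul_ne_zero hn.ne' (expWeight_ne_zero _ _)))
        (Or.inr hD)]
      calc green K s (σ.symm (i, y)) * (ε * w) = green K s (σ.symm (i, y)) * ε * w := by ring
        _ ≤ green K s (σ.symm (i, y₀)) * w := by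
            gcongr; exact green_mul_iterate_le K s _ _ n
        _ ≤ D := by
            refine le_trans ?_ (hle s)
            refine le_trans (le_of_eq ?_) (ENNReal.le_tsum y₀)
            simp [hw]
  choose B hB hgB using hcol
  refine ⟨∑ y ∈ Finset.range y₀, B y + D, ENNReal.add_ne_top.2
    ⟨ENNReal.sum_ne_top.2 fun y _ => hB y, hD⟩, fun s => ?_⟩
  calc ∑' y : ℕ, green K s (σ.symm (i, y)) * expWeight (-β) y
      ≤ ∑' y : ℕ, ((if y ∈ Finset.range y₀ then B y else 0) + if y₀ ≤ y then
          green K s (σ.symm (i, y)) * expWeight (-β) y else 0) := by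
        refine ENNReal.tsum_le_tsum fun y => ?_
        by_cases hy : y₀ ≤ y
        · simp [hy]
        · simp only [Finset.mem_range, not_le.1 hy, if_true, hy, if_false, add_zero]
          refine le_trans (mul_le_mul' (hgB y s) ?_) (mul_one _).le
          rw [← expWeight_zero_left 0]
          refine expWeight_mono ?_
          have : (0 : ℝ) ≤ y := by positivity
          nlinarith
    _ ≤ _ := by
        rw [ENNReal.tsum_add]
        refine add_le_add (le_of_eq ?_) (hle s)
        rw [tsum_eq_sum (s := Finset.range y₀) fun y hy => by rw [if_neg hy]]
        exact Finset.sum_congr rfl fun y hy => by rw [if_pos hy]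

end Quadrant

/-! ## Asymptotics of the Green function along a column of the quadrant -/

theorem tendsto_cofinite_inf_principal {S : Type*} {f : S → ℝ} {c : ℝ} {A : Set S}
    (h : ∀ ε > 0, {s | s ∈ A ∧ ε ≤ |f s - c|}.Finite) : Tendsto f (cofinite ⊓ 𝓟 A) (𝓝 c) := by
  rw [Metric.tendsto_nhds]
  intro ε hε
  rw [eventually_inf_principal, eventually_cofinite]
  refine (h ε hε).subset fun s hs => ?_
  simp only [Set.mem_ofPred_eq, Classical.not_imp, not_lt, Real.dist_eq] at hs
  exact hs

theorem finite_setOf_coord_lt {S : Type*} (σ : S ≃ ℕ × ℕ) (m n : ℕ) :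
    {s | (σ s).1 < m ∧ (σ s).2 < n}.Finite :=
  (((Set.finite_Iio m).prod (Set.finite_Iio n)).preimage σ.injective.injOn).subset
    fun _ hs => hs

section GreenAsymptotics

variable {S : Type*} [MeasurableSpace S] [Countable S] [MeasurableSingletonClass S]

/-- If `f` is harmonic up to a unit mass at `w` and an error `E`, the Green function with target `w`
is `f` minus its limit along the trajectories, up to the potential of the error. -/
theorem abs_green_sub_le (K : S → PMF S) (x w : S) {f : S → ℝ} {M : ℝ} (hM : ∀ y, |f y| ≤ M)
    (hgreen : ∀ y, green K x y ≠ ∞) {A B : Set S}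
    (hAB : ∀ᵐ ω ∂pathLaw K x, (∃ᶠ n in atTop, ω n ∈ A) ∨ ∃ᶠ n in atTop, ω n ∈ B) {c : ℝ}
    (hA : Tendsto f (cofinite ⊓ 𝓟 A) (𝓝 c)) (hB : Tendsto f (cofinite ⊓ 𝓟 B) (𝓝 0))
    {R : ℝ} (hR0 : 0 ≤ R)
    (hR : ∑' y, green K x y * ENNReal.ofReal |defect K f y - Set.indicator {w} 1 y|
      ≤ ENNReal.ofReal R) :
    |(green K x w).toReal - (f x - c * (1 - (pathLaw K x).real {ω | visits A ω < ∞}))| ≤ R := by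
  set E : S → ℝ := fun y => defect K f y - Set.indicator {w} 1 y with hE
  have hEbd : ∀ y, |E y| ≤ M + M + 1 := by
    intro y
    refine (abs_sub _ _).trans (add_le_add (abs_defect_le K hM y) ?_)
    by_cases hy : y = w <;> simp [hy]
  have hind : ∀ y, |Set.indicator {w} (1 : S → ℝ) y| ≤ 1 := by
    intro y
    by_cases hy : y = w <;> simp [hy]
  have hsumE : ∑' n, ∫⁻ ω, ENNReal.ofReal |E (ω n)| ∂pathLaw K x ≤ ENNReal.ofReal R := by
    refine le_trans (le_of_eq ?_) hR
    rw [tsum_green_mul K x fun y => ENNReal.ofReal |E y|]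
    exact tsum_congr fun n => pathLaw_lintegral_iterate K x n fun y => ENNReal.ofReal |E y|
  have hsumD : ∑' n, ∫⁻ ω, ENNReal.ofReal |defect K f (ω n)| ∂pathLaw K x ≠ ∞ := by
    have hle : ∑' y, green K x y * ENNReal.ofReal |defect K f y|
        ≤ ENNReal.ofReal R + green K x w := by
      calc ∑' y, green K x y * ENNReal.ofReal |defect K f y|
          ≤ ∑' y, (green K x y * ENNReal.ofReal |E y|
              + green K x y * Set.indicator {w} 1 y) := by
            refine ENNReal.tsum_le_tsum fun y => ?_
            rw [← mul_add]
            refine mul_le_mul_right ?_ _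
            by_cases hy : y = w
            · have h1 : |defect K f y| ≤ |E y| + 1 := by
                have : defect K f y = E y + 1 := by simp [hE, hy]
                rw [this]
                exact (abs_add_le _ _).trans (by simp)
              refine (ENNReal.ofReal_le_ofReal h1).trans ?_
              rw [ENNReal.ofReal_add (abs_nonneg _) zero_le_one]
              simp [hy]
            · simp [hE, hy]
        _ ≤ _ := by
            rw [ENNReal.tsum_add]
            refine add_le_add hR (le_of_eq ?_)
            rw [tsum_eq_single w fun y hy => by simp [hy]]
            simp
    refine ne_top_of_le_ne_top (ENNReal.add_ne_top.2 ⟨ENNReal.ofReal_ne_top, hgreen w⟩)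
      (le_trans (le_of_eq ?_) hle)
    rw [tsum_green_mul K x fun y => ENNReal.ofReal |defect K f y|]
    exact tsum_congr fun n => pathLaw_lintegral_iterate K x n fun y => ENNReal.ofReal |defect K f y|
  have hlim := tendsto_integral_eval K x hM hsumD hgreen hAB hA hB
  have hsplit : ∀ m : ℕ, ∫ ω, defect K f (ω m) ∂pathLaw K x
      = (pathLaw K x {ω | ω m = w}).toReal + ∫ ω, E (ω m) ∂pathLaw K x := by
    intro m
    have h1 : ∀ ω : ℕ → S, defect K f (ω m) = Set.indicator {w} (1 : S → ℝ) (ω m) + E (ω m) := by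
      intro ω; simp [hE]
    simp_rw [h1]
    rw [integral_add (integrable_eval K x m hind) (integrable_eval K x m hEbd)]
    congr 1
    have hmeas : MeasurableSet {ω : ℕ → S | ω m = w} :=
      measurableSet_eq_fun (measurable_pi_apply m) measurable_const
    rw [← measureReal_def, ← integral_indicator_one hmeas]
    rfl
  have hgsum : Tendsto (fun n => ∑ m ∈ Finset.range n, (pathLaw K x {ω | ω m = w}).toReal) atTop
      (𝓝 (green K x w).toReal) := by
    rw [green, ENNReal.tsum_toReal_eq fun m => measure_ne_top _ _]
    exact (ENNReal.summable_toReal (hgreen w)).hasSum.tendsto_sum_nat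
  have hRn : ∀ n, |∑ m ∈ Finset.range n, ∫ ω, E (ω m) ∂pathLaw K x| ≤ R := by
    intro n
    rw [← ENNReal.ofReal_le_ofReal_iff hR0]
    refine le_trans ?_ hsumE
    refine le_trans ?_ (ENNReal.sum_le_tsum (Finset.range n))
    refine (ENNReal.ofReal_le_ofReal (Finset.abs_sum_le_sum_abs _ _)).trans ?_
    rw [ENNReal.ofReal_sum_of_nonneg fun _ _ => abs_nonneg _]
    refine Finset.sum_le_sum fun m _ => ?_
    rw [← Real.enorm_eq_ofReal_abs]
    refine (enorm_integral_le_lintegral_enorm _).trans (le_of_eq ?_)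
    simp_rw [Real.enorm_eq_ofReal_abs]
  -- Since `f x - 𝔼 f(ω n)` is the sum of the mean defects before `n`, this difference is, up to
  -- sign, the partial sum of the mean errors, which `hRn` bounds by `R`.
  have hdiff : Tendsto (fun n => (∑ m ∈ Finset.range n, (pathLaw K x {ω | ω m = w}).toReal)
      - (f x - ∫ ω, f (ω n) ∂pathLaw K x)) atTop (𝓝 ((green K x w).toReal
        - (f x - c * (1 - (pathLaw K x).real {ω | visits A ω < ∞})))) :=
    hgsum.sub (tendsto_const_nhds.sub hlim)
  refine le_of_tendsto' hdiff.abs fun n => ?_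
  rw [integral_eval_eq K x hM n]
  simp_rw [hsplit]
  rw [Finset.sum_add_distrib, abs_sub_comm]
  refine le_trans (le_of_eq (congrArg _ ?_)) (hRn n)
  ring

end GreenAsymptotics

/-! ### Comparison of the quadrant with the strip. -/

section Quadrant

variable {S : Type*} [MeasurableSpace S] [Countable S] [MeasurableSingletonClass S]
  {K : S → PMF S} {σ : S ≃ ℕ × ℕ} {J : ℕ × ℕ → PMF (ℤ × ℤ)} {p : ℕ → PMF (ℤ × ℤ)} {k : ℕ}
  {π : PMF ℕ}

/-- The defect of the translated Green function of the strip is a unit mass plus an error carried by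
the rows below `k`. -/
theorem QuadrantWalk.exists_defect_le (h : QuadrantWalk K σ J p k) {δ : ℝ} {Cm : ℝ≥0∞}
    (hCm : Cm ≠ ∞) (hmom : ∀ z, ExpMoment (J z) δ Cm) {i : ℕ} {F : ℕ → ℤ → ℝ}
    {c C t δ' M : ℝ} (ht : 0 < t) (htδ : t ≤ δ) (hδ' : 0 < δ') (hδδ : δ' ≤ δ) (hC : 0 < C)
    (heq : ∀ x y, F x y = (if x = i ∧ y = 0 then 1 else 0)
        + ∫ d, F (stepX x d) (y + d.2) ∂(p x).toMeasure)
    (hdec : ∀ x y, |F x y - c| ≤ C * Real.exp (t * y - δ' * x)) (hM : ∀ x y, |F x y| ≤ M) :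
    ∃ C' : ℝ, 0 < C' ∧ ∀ (j : ℕ) (s : S),
      |defect K (fun s => F (σ s).1 ((σ s).2 - j)) s - Set.indicator {σ.symm (i, j)} 1 s|
        ≤ if (σ s).2 < k then C' * Real.exp (-(t * j) - δ' * (σ s).1) else 0 := by
  -- The first term bounds the distance of `F` to `c` before and after the jump. The second pays for
  -- the unit mass when the target itself lies below row `k`, that is `j < k`.
  set C' := C * Real.exp (t * k) * (1 + Cm.toReal) + Real.exp (t * k + δ' * i) with hC'
  refine ⟨C', by positivity, fun j s => ?_⟩
  obtain ⟨⟨x, y⟩, rfl⟩ := σ.symm.surjective s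
  have hint : ∫ s', F (σ s').1 ((σ s').2 - j) ∂(K (σ.symm (x, y))).toMeasure
      = ∫ d, F (stepX x d) ((y : ℤ) - j + d.2) ∂(J (x, y)).toMeasure := by
    rw [h.integral_comp fun z => F z.1 (z.2 - j), Equiv.apply_symm_apply]
    refine integral_congr_ae ((PMF.ae_iff_forall _).2 fun d hd => ?_)
    simp only
    rw [h.stepXY_snd_cast hd]
    simp only [stepXY]
    congr 1
    ring
  have hind : Set.indicator {σ.symm (i, j)} (1 : S → ℝ) (σ.symm (x, y))
      = if x = i ∧ (y : ℤ) - j = 0 then 1 else 0 := by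
    by_cases hxy : x = i ∧ y = j
    · obtain ⟨rfl, rfl⟩ := hxy
      simp
    · have h1 : ¬ (x = i ∧ (y : ℤ) - j = 0) := by
        intro h1; exact hxy ⟨h1.1, by omega⟩
      rw [if_neg h1, Set.indicator_of_notMem]
      simpa using hxy
  rw [defect, hint, hind]
  simp only [Equiv.apply_symm_apply]
  split_ifs with hx hy hy
  rotate_left
  · rw [h.eq_of_le x y (not_lt.1 hy), heq x (y - j), if_pos hx]
    simp
  rotate_left
  · rw [h.eq_of_le x y (not_lt.1 hy), heq x (y - j), if_neg hx]
    simp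
  all_goals
    have hyk : (y : ℝ) ≤ k := by exact_mod_cast hy.le
    have hmain : |F x (y - j) - ∫ d, F (stepX x d) ((y : ℤ) - j + d.2) ∂(J (x, y)).toMeasure|
        ≤ C * Real.exp (t * k) * (1 + Cm.toReal) * Real.exp (-(t * j) - δ' * x) := by
      set A := C * Real.exp (t * k) * Real.exp (-(t * j) - δ' * x) with hA
      have hA0 : 0 < A := by positivity
      have hAe : ∀ r : ℝ, C * Real.exp (t * k + (-(t * j) - δ' * x) + r) = A * Real.exp r := by
        intro r
        rw [Real.exp_add, Real.exp_add, hA]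
        ring
      have hpt : ∀ d : ℤ × ℤ, |F (stepX x d) ((y : ℤ) - j + d.2) - c|
          ≤ A * Real.exp (δ * (|(d.1 : ℝ)| + |(d.2 : ℝ)|)) := by
        intro d
        refine (hdec _ _).trans ?_
        rw [← hAe]
        refine mul_le_mul_of_nonneg_left (Real.exp_le_exp.2 ?_) hC.le
        -- Truncation at `0` can only increase the abscissa, which helps because the bound decreases
        -- in `x`.
        have h1 : (x : ℝ) + d.1 ≤ stepX x d := by
          exact_mod_cast Int.self_le_toNat ((x : ℤ) + d.1)
        have h2 : δ' * (x + d.1) ≤ δ' * stepX x d := mul_le_mul_of_nonneg_left h1 hδ'.le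
        have h3 : -(δ' * d.1) ≤ δ * |(d.1 : ℝ)| := by
          nlinarith [neg_abs_le (d.1 : ℝ), abs_nonneg (d.1 : ℝ)]
        have h4 : t * d.2 ≤ δ * |(d.2 : ℝ)| := by
          nlinarith [le_abs_self (d.2 : ℝ), abs_nonneg (d.2 : ℝ)]
        push_cast
        nlinarith
      have hfirst : |F x (y - j) - c| ≤ A := by
        refine (hdec _ _).trans ?_
        have := hAe 0
        rw [Real.exp_zero, mul_one] at this
        rw [← this]
        refine mul_le_mul_of_nonneg_left (Real.exp_le_exp.2 ?_) hC.le
        push_cast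
        nlinarith
      have hsecond : |∫ d, (F (stepX x d) ((y : ℤ) - j + d.2) - c) ∂(J (x, y)).toMeasure|
          ≤ A * Cm.toReal := by
        rw [← ENNReal.ofReal_le_ofReal_iff (by positivity), ← Real.enorm_eq_ofReal_abs,
          ENNReal.ofReal_mul hA0.le, ENNReal.ofReal_toReal hCm]
        refine (enorm_integral_le_lintegral_enorm _).trans ?_
        rw [PMF.lintegral_eq_tsum']
        refine le_trans ?_ (mul_le_mul_right (hmom (x, y)) _)
        rw [← ENNReal.tsum_mul_left]
        refine ENNReal.tsum_le_tsum fun d => ?_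
        rw [mul_left_comm, expWeight, ← ENNReal.ofReal_mul hA0.le, Real.enorm_eq_ofReal_abs]
        exact mul_le_mul_right (ENNReal.ofReal_le_ofReal (hpt d)) _
      rw [integral_sub (Integrable.of_bound (measurable_of_countable _).aestronglyMeasurable M
        (ae_of_all _ fun d => hM _ _)) (integrable_const _), integral_const, probReal_univ,
        one_smul] at hsecond
      have hsplit : F x (y - j) - ∫ d, F (stepX x d) ((y : ℤ) - j + d.2) ∂(J (x, y)).toMeasure
          = (F x (y - j) - c)
            - (∫ d, F (stepX x d) ((y : ℤ) - j + d.2) ∂(J (x, y)).toMeasure - c) := by ring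
      rw [hsplit]
      refine ((abs_sub _ _).trans (add_le_add hfirst hsecond)).trans (le_of_eq ?_)
      rw [hA]
      ring
    rw [hC', add_mul]
  · refine (abs_sub _ _).trans (add_le_add hmain ?_)
    rw [abs_one, ← Real.exp_add, hx.1]
    refine Real.one_le_exp ?_
    have : (y : ℝ) = j := by have := hx.2; exact_mod_cast (by omega : (y : ℤ) = j)
    nlinarith
  · rw [sub_zero]
    exact hmain.trans (le_add_of_nonneg_right (by positivity))

/-- Asymptotics of the Green function of the quadrant along column `i`. -/
theorem QuadrantWalk.green_asymptotics (h : QuadrantWalk K σ J p k)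
    (hπ : IsInvariantDistribution (columnChain p) π)
    (hV : 0 < ∑' x, (π x).toReal * ∑' d : ℤ × ℤ, (d.2 : ℝ) * (p x d).toReal)
    (hrow : ∀ (j : ℕ) (β : ℝ), 0 < β → ∃ D : ℝ≥0∞, D ≠ ∞ ∧
      ∀ s, ∑' x : ℕ, green K s (σ.symm (x, j)) * expWeight (-β) x ≤ D)
    (hrec : ∀ s, ∀ᵐ ω ∂pathLaw K s, ∃ᶠ n in atTop, (σ (ω n)).2 < k ∨ (σ (ω n)).1 < k) (i : ℕ) :
    ∃ C δ : ℝ, 0 < C ∧ 0 < δ ∧ ∀ (s : S) (j : ℕ), green K s (σ.symm (i, j)) ≠ ∞ ∧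
      |(green K s (σ.symm (i, j))).toReal
        - (pathLaw K s).real {ω | visits {s | (σ s).2 < k} ω < ∞} * ((π i).toReal
          / ∑' x, (π x).toReal * ∑' d : ℤ × ℤ, (d.2 : ℝ) * (p x d).toReal)|
        ≤ C * Real.exp (-δ * ((j : ℝ) - (σ s).2)) := by
  have hgreen : ∀ s w, green K s w ≠ ∞ := by
    intro s w
    obtain ⟨⟨x, j⟩, rfl⟩ := σ.symm.surjective w
    obtain ⟨D, hD, hle⟩ := hrow j 1 one_pos
    intro htop
    have h1 := (ENNReal.le_tsum (f := fun x : ℕ => green K s (σ.symm (x, j)) * expWeight (-1) x)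
      x).trans (hle s)
    simp only [htop, ENNReal.top_mul (expWeight_ne_zero _ _), top_le_iff] at h1
    exact hD h1
  obtain ⟨δ, Cm, hδ, hCm, hmom⟩ := h.moments
  obtain ⟨-, F, C, t, δ₀, M, ht, htδ, hδ₀, hC, heq, hdec₀, hM, hF0⟩ :=
    h.strip.exists_green_function hπ hV i hδ
  set c := (π i).toReal / ∑' x, (π x).toReal * ∑' d : ℤ × ℤ, (d.2 : ℝ) * (p x d).toReal
  -- Capped by `δ` so that the exponential moments of the jumps control the factor `e^{-δ' d.1}`.
  set δ' := min δ₀ δ with hδ'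
  have hδ'0 : 0 < δ' := lt_min hδ₀ hδ
  have hdec : ∀ x y, |F x y - c| ≤ C * Real.exp (t * y - δ' * x) := by
    refine fun x y => (hdec₀ x y).trans (mul_le_mul_of_nonneg_left (Real.exp_le_exp.2 ?_) hC.le)
    have : δ' * x ≤ δ₀ * x := mul_le_mul_of_nonneg_right (min_le_left _ _) (by positivity)
    linarith
  obtain ⟨C', hC', hdef⟩ := h.exists_defect_le hCm hmom ht htδ hδ'0 (min_le_right _ _) hC heq
    hdec hM
  choose D hD hDle using fun j => hrow j δ' hδ'0
  set D' := (∑ j ∈ Finset.range k, D j).toReal with hD'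
  have hDsum : ∑ j ∈ Finset.range k, D j ≠ ∞ := ENNReal.sum_ne_top.2 fun j _ => hD j
  refine ⟨C' * D' + C, t, by positivity, ht, fun s j => ⟨hgreen _ _, ?_⟩⟩
  -- Leaving finite sets along finitely many rows means `x → ∞`, where the factor `e^{-δ'x}` brings
  -- `F` to `c`.
  have hA : Tendsto (fun s => F (σ s).1 ((σ s).2 - j)) (cofinite ⊓ 𝓟 {s | (σ s).2 < k}) (𝓝 c) := by
    refine tendsto_cofinite_inf_principal fun ε hε => ?_
    have hlim : Tendsto (fun x : ℕ => C * Real.exp (t * k - δ' * x)) atTop (𝓝 0) := by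
      have h1 : Tendsto (fun x : ℕ => t * k - δ' * (x : ℝ)) atTop atBot :=
        tendsto_atBot_add_const_left _ _ (tendsto_neg_atTop_atBot.comp
          (tendsto_natCast_atTop_atTop.const_mul_atTop hδ'0))
      simpa using (Real.tendsto_exp_atBot.comp h1).const_mul C
    obtain ⟨N, hN⟩ := eventually_atTop.1 (hlim.eventually_lt_const hε)
    refine (finite_setOf_coord_lt σ N k).subset fun s ⟨hs, hes⟩ => ⟨?_, hs⟩
    by_contra hlt
    refine absurd hes (not_le.2 (((hdec _ _).trans ?_).trans_lt (hN _ (not_lt.1 hlt))))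
    refine mul_le_mul_of_nonneg_left (Real.exp_le_exp.2 ?_) hC.le
    have : ((σ s).2 : ℝ) ≤ k := by exact_mod_cast (le_of_lt hs)
    push_cast
    nlinarith [(Nat.cast_nonneg j : (0 : ℝ) ≤ j)]
  -- Only the columns `x < k` matter, so the limits of `F x` at `+∞` need no uniformity in `x`.
  have hB : Tendsto (fun s => F (σ s).1 ((σ s).2 - j)) (cofinite ⊓ 𝓟 {s | (σ s).1 < k}) (𝓝 0) := by
    refine tendsto_cofinite_inf_principal fun ε hε => ?_
    have hN : ∀ x, ∃ N : ℕ, ∀ y : ℕ, N ≤ y → |F x (y - j)| < ε := by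
      intro x
      have h1 : Tendsto (fun y : ℕ => F x ((y : ℤ) - j)) atTop (𝓝 0) :=
        (hF0 x).comp (tendsto_atTop_add_const_right _ (-(j : ℤ)) tendsto_natCast_atTop_atTop)
      have h2 := h1.abs
      rw [abs_zero] at h2
      exact eventually_atTop.1 (h2.eventually_lt_const hε)
    choose N hN using hN
    refine (finite_setOf_coord_lt σ k ((Finset.range k).sup N)).subset fun s ⟨hs, hes⟩ => ⟨hs, ?_⟩
    by_contra hlt
    rw [sub_zero] at hes
    have hle : N (σ s).1 ≤ (Finset.range k).sup N := Finset.le_sup (Finset.mem_range.2 hs)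
    exact absurd hes (not_le.2 (hN _ _ (hle.trans (not_lt.1 hlt))))
  -- The error is carried by `k` rows; on each, the weighted sum of the Green function is bounded
  -- independently of `s`.
  have hR : ∑' y, green K s y * ENNReal.ofReal
      |defect K (fun s => F (σ s).1 ((σ s).2 - j)) y - Set.indicator {σ.symm (i, j)} 1 y|
      ≤ ENNReal.ofReal (C' * D' * Real.exp (-(t * j))) := by
    calc ∑' y, green K s y * ENNReal.ofReal
          |defect K (fun s => F (σ s).1 ((σ s).2 - j)) y - Set.indicator {σ.symm (i, j)} 1 y|
        ≤ ∑' y, green K s y * ENNReal.ofReal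
          (if (σ y).2 < k then C' * Real.exp (-(t * j) - δ' * (σ y).1) else 0) :=
          ENNReal.tsum_le_tsum fun y => mul_le_mul_right (ENNReal.ofReal_le_ofReal (hdef j y)) _
      _ = ∑' (y : ℕ) (x : ℕ), green K s (σ.symm (x, y)) * ENNReal.ofReal
          (if y < k then C' * Real.exp (-(t * j) - δ' * x) else 0) := by
          rw [← σ.symm.tsum_eq, ENNReal.tsum_prod', ENNReal.tsum_comm]
          simp only [Equiv.apply_symm_apply]
      _ = ∑ y ∈ Finset.range k, ∑' x : ℕ, green K s (σ.symm (x, y)) * ENNReal.ofReal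
          (if y < k then C' * Real.exp (-(t * j) - δ' * x) else 0) := by
          refine tsum_eq_sum fun y hy => ?_
          simp [Finset.mem_range.not.1 hy]
      _ ≤ ∑ y ∈ Finset.range k, ENNReal.ofReal (C' * Real.exp (-(t * j))) * D y := by
          refine Finset.sum_le_sum fun y hy => ?_
          refine le_trans (le_of_eq ?_) (mul_le_mul_right (hDle y s) _)
          rw [← ENNReal.tsum_mul_left]
          refine tsum_congr fun x => ?_
          rw [if_pos (Finset.mem_range.1 hy), expWeight, mul_left_comm,
            ← ENNReal.ofReal_mul (by positivity), mul_assoc, ← Real.exp_add]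
          ring_nf
      _ = _ := by
          rw [← Finset.mul_sum, ← ENNReal.ofReal_toReal hDsum,
            ← ENNReal.ofReal_mul (by positivity)]
          congr 1
          rw [hD']
          ring
  have hmain := abs_green_sub_le K s (σ.symm (i, j)) (fun s => hM _ _) (hgreen s)
    ((hrec s).mono fun ω hω => frequently_or_distrib.1 hω) hA hB (by positivity) hR
  set esc := (pathLaw K s).real {ω | visits {s | (σ s).2 < k} ω < ∞}
  have hfar := hdec (σ s).1 ((σ s).2 - j)
  have hexp1 : Real.exp (-(t * j)) ≤ Real.exp (-t * ((j : ℝ) - (σ s).2)) :=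
    Real.exp_le_exp.2 (by nlinarith [(Nat.cast_nonneg (σ s).2 : (0 : ℝ) ≤ (σ s).2)])
  have hexp2 : Real.exp (t * (((σ s).2 - j : ℤ) : ℝ) - δ' * (σ s).1)
      ≤ Real.exp (-t * ((j : ℝ) - (σ s).2)) := by
    refine Real.exp_le_exp.2 ?_
    push_cast
    nlinarith [mul_nonneg hδ'0.le (Nat.cast_nonneg (σ s).1 : (0 : ℝ) ≤ (σ s).1)]
  have hsplit : (green K s (σ.symm (i, j))).toReal - esc * c
      = ((green K s (σ.symm (i, j))).toReal - (F (σ s).1 ((σ s).2 - j) - c * (1 - esc)))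
        + (F (σ s).1 ((σ s).2 - j) - c) := by ring
  rw [hsplit, add_mul]
  refine (abs_add_le _ _).trans (add_le_add (hmain.trans ?_) (hfar.trans ?_))
  · exact mul_le_mul_of_nonneg_left hexp1 (by positivity)
  · exact mul_le_mul_of_nonneg_left hexp2 hC.le

end Quadrant

/-! ## The reflected walk and its mirror image -/

/-- Transport of irreducibility along a bijection intertwining two chains. -/
theorem IsIrreducibleChain.of_equiv {S T : Type*} [MeasurableSpace S] [Countable S]
    [MeasurableSingletonClass S] [MeasurableSpace T] [Countable T] [MeasurableSingletonClass T]
    {K : S → PMF S} {L : T → PMF T} (e : S ≃ T) (he : ∀ s, (K s).map e = L (e s))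
    (hK : IsIrreducibleChain K) : IsIrreducibleChain L := by
  rw [isIrreducibleChain_iff] at hK ⊢
  have hop : ∀ (n : ℕ) (f : T → ℝ≥0∞) (s : S),
      (transOp K)^[n] (fun s => f (e s)) s = (transOp L)^[n] f (e s) := by
    intro n
    induction n with
    | zero => intro f s; rfl
    | succ n ih =>
      intro f s
      rw [Function.iterate_succ_apply, Function.iterate_succ_apply, ← ih]
      refine congrFun (congrArg _ (funext fun s => ?_)) _
      rw [transOp, transOp, ← he, PMF.tsum_map_mul]
  intro x y
  obtain ⟨n, hn⟩ := hK (e.symm x) (e.symm y)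
  refine ⟨n, ?_⟩
  have h1 := hop n (Set.indicator {y} 1) (e.symm x)
  rw [e.apply_symm_apply] at h1
  rw [← h1]
  refine lt_of_lt_of_eq hn ?_
  refine congrFun (congrArg _ (funext fun s => ?_)) _
  by_cases hs : e s = y
  · have : s = e.symm y := by rw [← hs, e.symm_apply_apply]
    simp [this]
  · have : s ≠ e.symm y := fun h => hs (by rw [h, e.apply_symm_apply])
    simp [hs, this]

theorem PMF.map_swap_apply (q : PMF (ℤ × ℤ)) (d : ℤ × ℤ) : q.map Prod.swap d = q d.swap := by
  rw [PMF.map_apply, tsum_eq_single d.swap]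
  · simp
  · intro d' hd'
    rw [if_neg]
    rintro rfl
    simp at hd'

theorem PMF.tsum_map_swap {M : Type*} [AddCommMonoid M] [TopologicalSpace M] (q : PMF (ℤ × ℤ))
    (f : ℝ≥0∞ → ℤ → ℤ → M) :
    ∑' d : ℤ × ℤ, f (q.map Prod.swap d) d.1 d.2 = ∑' d : ℤ × ℤ, f (q d) d.2 d.1 := by
  rw [← (Equiv.prodComm ℤ ℤ).tsum_eq]
  refine tsum_congr fun d => ?_
  rw [PMF.map_swap_apply]
  rfl

namespace ReflectedWalk

/-- The mirror image of the walk with respect to the diagonal. -/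
def swap (W : ReflectedWalk) : ReflectedWalk where
  k₀ := W.k₀
  k₀_pos := W.k₀_pos
  μ := W.μ.map Prod.swap
  μ' j := (W.μ'' j).map Prod.swap
  μ'' i := (W.μ' i).map Prod.swap
  μc i j := (W.μc j i).map Prod.swap

variable {W : ReflectedWalk}

theorem swap_jump (z : ℕ × ℕ) : W.swap.jump z = (W.jump z.swap).map Prod.swap := by
  by_cases h1 : W.k₀ ≤ z.1 <;> by_cases h2 : W.k₀ ≤ z.2 <;> simp [jump, swap, h1, h2]

theorem swap_jump₁ (i : ℕ) : W.swap.jump₁ i = (W.jump₂ i).map Prod.swap := by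
  by_cases h : W.k₀ ≤ i <;> simp [jump₁, jump₂, swap, h]

theorem swap_m₁ : W.swap.m₁ = W.m₂ :=
  PMF.tsum_map_swap W.μ fun q a _ => (a : ℝ) * q.toReal

theorem swap_m₂ : W.swap.m₂ = W.m₁ :=
  PMF.tsum_map_swap W.μ fun q _ b => (b : ℝ) * q.toReal

theorem swap_jumpsBoundedBelow (h : W.JumpsBoundedBelow) : W.swap.JumpsBoundedBelow := by
  obtain ⟨h1, h2, h3, h4⟩ := h
  refine ⟨fun d hd => ?_, fun j hj d hd => ?_, fun i hi d hd => ?_, fun i hi j hj d hd => ?_⟩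
  · exact (PMF.map_swap_apply _ _).trans (h1 _ hd.symm)
  · exact (PMF.map_swap_apply _ _).trans (h3 j hj _ hd)
  · exact (PMF.map_swap_apply _ _).trans (h2 i hi _ hd)
  · exact (PMF.map_swap_apply _ _).trans (h4 j hj i hi _ hd.symm)

theorem swap_exponentialMoments (h : W.ExponentialMoments) : W.swap.ExponentialMoments := by
  obtain ⟨δ, γ, C, hδ, hγ, hC, hle⟩ := h
  refine ⟨γ, δ, C, hγ, hδ, hC, fun z => ?_⟩
  rw [swap_jump]
  refine le_trans (le_of_eq ?_) (hle z.swap)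
  rw [PMF.tsum_map_swap (W.jump z.swap)
    fun q a b => q * ENNReal.ofReal (Real.exp (γ * a + δ * b))]
  simp_rw [add_comm]

theorem swap_X₁ : W.swap.X₁ = W.Y₂ := by
  funext i
  simp only [X₁, Y₂, Z₁, Z₂, swap_jump₁, PMF.map_comp]
  rfl

theorem swap_π₁ : W.swap.π₁ = W.π₂ := by rw [π₁, swap_X₁]; rfl

theorem swap_V₁ : W.swap.V₁ = W.V₂ := by
  rw [V₁, V₂, swap_π₁]
  refine tsum_congr fun i => ?_
  rw [swap_jump₁]
  congr 1
  exact PMF.tsum_map_swap (W.jump₂ i) fun q _ b => (b : ℝ) * q.toReal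

theorem map_swap_Z₂ (z : ℤ × ℕ) :
    (W.Z₂ z).map (Equiv.prodComm ℤ ℕ) = W.swap.Z₁ (Equiv.prodComm ℤ ℕ z) := by
  simp only [Z₁, Z₂, swap_jump₁, PMF.map_comp]
  rfl

theorem columnChain_jump₁ : columnChain W.jump₁ = W.X₁ := by
  funext i
  simp only [columnChain, X₁, Z₁, PMF.map_comp]
  rfl

theorem jump_fst_ge (h : W.JumpsBoundedBelow) {z : ℕ × ℕ} {d : ℤ × ℤ} (hd : W.jump z d ≠ 0) :
    -(W.k₀ : ℤ) ≤ d.1 ∧ 0 ≤ (z.1 : ℤ) + d.1 := by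
  obtain ⟨h1, h2, h3, h4⟩ := h
  simp only [jump] at hd
  split_ifs at hd with hx hy hy
  · have := mt (fun hlt => h1 d (Or.inl hlt)) hd
    omega
  · have := mt (fun hlt => h2 _ (not_le.1 hy) d (Or.inl hlt)) hd
    omega
  · have := mt (fun hlt => h3 _ (not_le.1 hx) d (Or.inr hlt)) hd
    omega
  · have := mt (fun hlt => h4 _ (not_le.1 hx) _ (not_le.1 hy) d (Or.inl hlt)) hd
    omega

theorem jump_snd_ge (h : W.JumpsBoundedBelow) {z : ℕ × ℕ} {d : ℤ × ℤ} (hd : W.jump z d ≠ 0) :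
    -(W.k₀ : ℤ) ≤ d.2 ∧ 0 ≤ (z.2 : ℤ) + d.2 := by
  have h1 : W.swap.jump z.swap d.swap ≠ 0 := by
    rwa [swap_jump, PMF.map_swap_apply, Prod.swap_swap, Prod.swap_swap]
  exact jump_fst_ge (swap_jumpsBoundedBelow h) h1

/-- Jumps are at least `-k₀`, so `|r| ≤ r + 2 k₀` for each coordinate, and one-sided exponential
moments are two-sided up to a constant. -/
theorem exists_expMoment (h : W.JumpsBoundedBelow) (hm : W.ExponentialMoments) :
    ∃ δ C, 0 < δ ∧ C ≠ ∞ ∧ ∀ z, ExpMoment (W.jump z) δ C := by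
  obtain ⟨δ, γ, C, hδ, hγ, -, hle⟩ := hm
  set η := min δ γ with hη
  have hη0 : 0 < η := lt_min hδ hγ
  refine ⟨η, ENNReal.ofReal (Real.exp ((2 * δ + 2 * γ) * W.k₀)) * ENNReal.ofReal C, hη0,
    ENNReal.mul_ne_top ENNReal.ofReal_ne_top ENNReal.ofReal_ne_top, fun z => ?_⟩
  refine le_trans ?_ (mul_le_mul_right (hle z) _)
  rw [← ENNReal.tsum_mul_left]
  refine ENNReal.tsum_le_tsum fun d => ?_
  by_cases hd : W.jump z d = 0
  · simp [hd]
  rw [mul_left_comm, ← ENNReal.ofReal_mul (Real.exp_pos _).le, ← Real.exp_add, expWeight]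
  refine mul_le_mul_right (ENNReal.ofReal_le_ofReal (Real.exp_le_exp.2 ?_)) _
  have hk : (0 : ℝ) ≤ W.k₀ := by positivity
  have hbound : ∀ {r θ : ℝ}, -(W.k₀ : ℝ) ≤ r → η ≤ θ → η * |r| ≤ θ * r + 2 * θ * W.k₀ := by
    intro r θ hr hθ
    have h1 : η * |r| ≤ θ * |r| := mul_le_mul_of_nonneg_right hθ (abs_nonneg _)
    have h2 : |r| ≤ r + 2 * W.k₀ := abs_le.2 ⟨by linarith, by linarith⟩
    nlinarith
  have h1 := hbound (r := d.1) (by exact_mod_cast (jump_fst_ge h hd).1) (min_le_left δ γ)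
  have h2 := hbound (r := d.2) (by exact_mod_cast (jump_snd_ge h hd).1) (min_le_right δ γ)
  linarith

theorem jump₁_eq (x : ℕ) {y : ℕ} (hy : W.k₀ ≤ y) : W.jump₁ x = W.jump (x, y) := by
  simp only [jump, jump₁, hy, if_true]

theorem stripWalk_jump₁ (h : W.JumpsBoundedBelow) (hm : W.ExponentialMoments)
    (hirr : IsIrreducibleChain W.Z₁) (h₁ : W.m₁ < 0) (h₂ : W.m₂ < 0) :
    StripWalk W.jump₁ W.k₀ := by
  have hμ : W.jump₁ W.k₀ = W.μ := by simp [jump₁]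
  refine ⟨fun x hx => by simp [jump₁, hx], fun x d hd => ?_, fun x d hd => ?_, ?_, ?_, ?_, hirr⟩
  · rw [jump₁_eq x le_rfl] at hd; exact (jump_fst_ge h hd).1
  · rw [jump₁_eq x le_rfl] at hd; exact (jump_fst_ge h hd).2
  · obtain ⟨δ, C, hδ, hC, hmom⟩ := exists_expMoment h hm
    exact ⟨δ, C, hδ, hC, fun x => by rw [jump₁_eq x le_rfl]; exact hmom _⟩
  · rw [hμ]; exact h₁
  · rw [hμ]; exact h₂

/-- Existence is enough for the choice operator to return an invariant distribution. The cycle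
formula holds for any of them, so uniqueness is not needed. -/
theorem invariant_π₁ (h : StripWalk W.jump₁ W.k₀) :
    IsInvariantDistribution (columnChain W.jump₁) W.π₁ := by
  obtain ⟨π, hπ⟩ := h.exists_invariant
  rw [columnChain_jump₁] at hπ ⊢
  exact Classical.epsilon_spec_aux _ (IsInvariantDistribution W.X₁) ⟨π, hπ⟩

theorem quadrantWalk (h : W.JumpsBoundedBelow) (hm : W.ExponentialMoments)
    (hirr : IsIrreducibleChain W.Z) (hstrip : StripWalk W.jump₁ W.k₀) :
    QuadrantWalk W.Z (Equiv.refl _) W.jump W.jump₁ W.k₀ where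
  step _ := PMF.map_id _
  eq_of_le x _ hy := (jump₁_eq x hy).symm
  snd_nonneg _ _ hd := (jump_snd_ge h hd).2
  moments := exists_expMoment h hm
  strip := hstrip
  irreducible := hirr

/-- The chain remains `W.Z`, only read in exchanged coordinates. Its Green function and path law
therefore need no transport to the mirror image. -/
theorem quadrantWalk_swap (h : W.JumpsBoundedBelow) (hm : W.ExponentialMoments)
    (hirr : IsIrreducibleChain W.Z) (hstrip : StripWalk W.swap.jump₁ W.k₀) :
    QuadrantWalk W.Z (Equiv.prodComm ℕ ℕ) W.swap.jump W.swap.jump₁ W.k₀ where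
  step s := by
    rw [swap_jump, Z, PMF.map_comp, PMF.map_comp]
    rfl
  eq_of_le x _ hy := (jump₁_eq (W := W.swap) x hy).symm
  snd_nonneg _ _ hd := (jump_snd_ge (swap_jumpsBoundedBelow h) hd).2
  moments := exists_expMoment (swap_jumpsBoundedBelow h) (swap_exponentialMoments hm)
  strip := hstrip
  irreducible := hirr

/-- The walk visits the boundary strips infinitely often. -/
theorem ae_frequently_boundary (h : W.JumpsBoundedBelow) (hm : W.ExponentialMoments)
    (h₁ : W.m₁ < 0) (z : ℕ × ℕ) :
    ∀ᵐ ω ∂pathLaw W.Z z, ∃ᶠ n in atTop, (ω n).2 < W.k₀ ∨ (ω n).1 < W.k₀ := by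
  obtain ⟨δ, C, hδ, hC, hmom⟩ := exists_expMoment h hm
  have hμ : ExpMoment W.μ δ C := by simpa [jump] using hmom (W.k₀, W.k₀)
  have hneg : (1 : ℝ) * (∑' d : ℤ × ℤ, (d.1 : ℝ) * (W.μ d).toReal)
      + 0 * (∑' d : ℤ × ℤ, (d.2 : ℝ) * (W.μ d).toReal) < 0 := by
    rw [one_mul, zero_mul, add_zero]; exact h₁
  -- The drift `m₁ < 0` alone makes `e^{εx}` contract off the two strips.
  obtain ⟨ε, hε1, hε, hεδ⟩ :=
    ((hμ.eventually_lt_one hδ hC hneg).and (Ioc_mem_nhdsGT hδ)).exists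
  have hop : ∀ z : ℕ × ℕ, transOp W.Z (fun z => expWeight ε z.1) z
      = (∑' d, W.jump z d * expWeight ε d.1) * expWeight ε z.1 := by
    intro z
    rw [transOp, Z, PMF.tsum_map_mul, ← ENNReal.tsum_mul_right]
    refine tsum_congr fun d => ?_
    by_cases hd : W.jump z d = 0
    · simp [hd]
    have hcast : ((((z.1 : ℤ) + d.1).toNat : ℕ) : ℝ) = z.1 + d.1 := by
      exact_mod_cast Int.toNat_of_nonneg (jump_fst_ge h hd).2
    simp only
    rw [hcast, expWeight_add]
    ring
  refine ae_frequently_mem_of_contraction W.Z z (A := {z | z.2 < W.k₀ ∨ z.1 < W.k₀})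
    (h := fun z => expWeight ε z.1) hε1 (fun z => ?_) (fun z hz => ?_) fun n => ?_
  · rw [← expWeight_zero_left 0]
    exact expWeight_mono (by rw [zero_mul]; positivity)
  · simp only [Set.mem_ofPred_eq, not_or, not_lt] at hz
    rw [hop]
    refine mul_le_mul_left (le_of_eq (tsum_congr fun d => ?_)) _
    simp [jump, hz.1, hz.2]
  · refine ne_top_of_le_ne_top (ENNReal.mul_ne_top (ENNReal.pow_ne_top hC) (expWeight_ne_top _ _))
      (iterate_transOp_le W.Z (C := C) (fun z => ?_) n z)
    rw [hop]
    refine mul_le_mul_left (le_trans (ENNReal.tsum_le_tsum fun d => ?_) (hmom z)) _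
    refine mul_le_mul_right (expWeight_mono ?_) _
    nlinarith [le_abs_self (d.1 : ℝ), abs_nonneg (d.1 : ℝ), abs_nonneg (d.2 : ℝ)]

end ReflectedWalk

end

theorem theorem1 (W : ReflectedWalk)
    (h_jumps : W.JumpsBoundedBelow)
    (h_moments : W.ExponentialMoments)
    (h_irreducible : W.Irreducible)
    (h_drift : W.m₁ < 0 ∧ W.m₂ < 0)
    (h_velocity : 0 < W.V₁ ∧ 0 < W.V₂) :
    (∀ i : ℕ, ∃ C δ : ℝ, 0 < C ∧ 0 < δ ∧ ∀ i₀ j₀ j : ℕ,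
      green W.Z (i₀, j₀) (i, j) ≠ ∞ ∧
      |(green W.Z (i₀, j₀) (i, j)).toReal - W.escape₁ (i₀, j₀) * ((W.π₁ i).toReal / W.V₁)|
        ≤ C * Real.exp (-δ * ((j : ℝ) - (j₀ : ℝ)))) ∧
    (∀ j : ℕ, ∃ C δ : ℝ, 0 < C ∧ 0 < δ ∧ ∀ i₀ j₀ i : ℕ,
      green W.Z (i₀, j₀) (i, j) ≠ ∞ ∧
      |(green W.Z (i₀, j₀) (i, j)).toReal - W.escape₂ (i₀, j₀) * ((W.π₂ j).toReal / W.V₂)|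
        ≤ C * Real.exp (-δ * ((i : ℝ) - (i₀ : ℝ)))) := by
  obtain ⟨-, hZ₁, hZ₂, hZ⟩ := h_irreducible
  have hs := ReflectedWalk.stripWalk_jump₁ h_jumps h_moments hZ₁ h_drift.1 h_drift.2
  have hs' : StripWalk W.swap.jump₁ W.swap.k₀ :=
    ReflectedWalk.stripWalk_jump₁ (ReflectedWalk.swap_jumpsBoundedBelow h_jumps)
      (ReflectedWalk.swap_exponentialMoments h_moments)
      (hZ₂.of_equiv (Equiv.prodComm ℤ ℕ) ReflectedWalk.map_swap_Z₂)
      (by rw [ReflectedWalk.swap_m₁]; exact h_drift.2)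
      (by rw [ReflectedWalk.swap_m₂]; exact h_drift.1)
  have hq := ReflectedWalk.quadrantWalk h_jumps h_moments hZ hs
  have hq' := ReflectedWalk.quadrantWalk_swap h_jumps h_moments hZ hs'
  have hπ := ReflectedWalk.invariant_π₁ hs
  have hπ' := ReflectedWalk.invariant_π₁ hs'
  have hV' : 0 < W.swap.V₁ := by rw [ReflectedWalk.swap_V₁]; exact h_velocity.2
  have hrec := ReflectedWalk.ae_frequently_boundary h_jumps h_moments h_drift.1
  refine ⟨fun i => ?_, fun j => ?_⟩
  -- The row sums needed in one system of coordinates are the column sums bounded in the other, so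
  -- each half uses both velocities.
  · obtain ⟨C, δ, hC, hδ, hmain⟩ := hq.green_asymptotics hπ h_velocity.1
      (fun j β hβ => hq'.tsum_green_column_le hπ' hV' j hβ) hrec i
    exact ⟨C, δ, hC, hδ, fun i₀ j₀ j => hmain (i₀, j₀) j⟩
  · obtain ⟨C, δ, hC, hδ, hmain⟩ := hq'.green_asymptotics hπ' hV'
      (fun i β hβ => hq.tsum_green_column_le hπ h_velocity.1 i hβ)
      (fun z => (hrec z).mono fun ω hω => hω.mono fun n hn => hn.symm) j
    refine ⟨C, δ, hC, hδ, fun i₀ j₀ i => ?_⟩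
    rw [← ReflectedWalk.swap_π₁, ← ReflectedWalk.swap_V₁]
    exact hmain (i₀, j₀) i
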